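/- Let $K$ be an infinite field and $S=K[x_1,\dots,x_n]$ with $\deg x_i=1$ for all $i$. For a homogeneous ideal $I\subseteq S$ let $\beta_{ij}(I)=\dim_K \operatorname{Tor}_i^S(K,I)_j$ be its graded Betti numbers and $\beta_i(I)=\sum_j\beta_{ij}(I)$ its total Betti numbers. Let $\operatorname{Gin}(I)$ be the generic initial ideal of $I$ with respect to the (degree) reverse lexicographic order with $x_1>\cdots>x_n$, that is, the initial ideal of $gI$ for all $g$ in a nonempty Zariski open subset of $GL_n(K)$. For a monomial ideal $J$ let $G(J)$ be its set of minimal monomial generators. A homogeneous ideal $I$ is componentwise linear if for every $d$ the ideal $I_{\langle d\rangle}$ generated by the homogeneous elements of degree $d$ of $I$ has a $d$-linear resolution, i.e. $\beta_{ij}(I_{\langle d\rangle})=0$ for $j\neq i+d$. A monomial ideal $L$ is lexsegment if, for all monomials $u\in L$ and $v$ of the same degree with $u<_{\mathrm{lex}}v$ (where $x_1>\cdots>x_n$), one has $v\in L$. A homogeneous ideal $I$ is Gotzmann if $\beta_{ij}(I)=\beta_{ij}(I^{\mathrm{lex}})$ for all $i,j$, where $I^{\mathrm{lex}}$ is the unique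 lexsegment ideal with the same Hilbert function as $I$. Theorem. Let $I\subseteq S$ be a componentwise linear ideal and let $s=|G(\operatorname{Gin}(I))|$. Suppose that $\beta_i(\operatorname{Gin}(I))=\binom{s}{i+1}$ for some $i$ with $1\le i<s$. Then $I$ is Gotzmann, and $\beta_j(I)=\binom{s}{j+1}$ for all $j\ge 0$. -/

import Mathlib

/-! Graded Betti numbers, the generic initial ideal for the reverse lexicographic order,
componentwise linear ideals and Gotzmann ideals in `S = K[x₀, …, xₙ₋₁]`, with `x₀ > ⋯ > xₙ₋₁`. -/

open MvPolynomial

noncomputable section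

namespace CompLinear

/-! ### The (degree) reverse lexicographic order -/

/-- Exponent vectors, to be ordered by the degree reverse lexicographic order. -/
def DegRevLexSyn (n : ℕ) : Type := Fin n →₀ ℕ

instance (n : ℕ) : AddCommMonoid (DegRevLexSyn n) := inferInstanceAs (AddCommMonoid (Fin n →₀ ℕ))

/-- The vector of partial sums `(u₀ + ⋯ + uₙ₋₁, u₀ + ⋯ + uₙ₋₂, …, u₀)`. The degree reverse
lexicographic order compares these vectors lexicographically. -/
def revKey {n : ℕ} (u : Fin n →₀ ℕ) : Lex (Fin n → ℕ) :=
  toLex fun k => ∑ i ∈ Finset.univ.filter (fun i => i ≤ k.rev), u i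

theorem revKey_apply {n : ℕ} (u : Fin n →₀ ℕ) (k : Fin n) :
    ofLex (revKey u) k = ∑ i ∈ Finset.univ.filter (fun i => i ≤ k.rev), u i := rfl

theorem revKey_zero {n : ℕ} (u : Fin n →₀ ℕ) (k : Fin n) (hk : (k : ℕ) = 0) :
    ofLex (revKey u) k = u.degree := by
  rw [revKey_apply, Finsupp.degree_eq_sum]
  congr 1
  ext i
  simp only [Finset.mem_filter, Finset.mem_univ, true_and, iff_true, Fin.le_def, Fin.val_rev]
  omega

theorem revKey_succ {n : ℕ} (u : Fin n →₀ ℕ) (k : Fin n) :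
    ofLex (revKey u) k =
      u k.rev + if h : (k : ℕ) + 1 < n then ofLex (revKey u) ⟨k + 1, h⟩ else 0 := by
  have h1 : Finset.univ.filter (fun i => i ≤ k.rev) =
      insert k.rev (Finset.univ.filter (fun i => i < k.rev)) := by
    ext i
    simp [le_iff_eq_or_lt]
  rw [revKey_apply, h1, Finset.sum_insert (by simp)]
  congr 1
  split_ifs with h
  · rw [revKey_apply]
    congr 1
    ext i
    simp only [Finset.mem_filter, Finset.mem_univ, true_and, Fin.le_def, Fin.lt_def, Fin.val_rev]
    omega
  · apply Finset.sum_eq_zero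
    intro i hi
    simp only [Finset.mem_filter, Finset.mem_univ, true_and, Fin.lt_def, Fin.val_rev] at hi
    omega

theorem revKey_injective (n : ℕ) : Function.Injective (revKey (n := n)) := by
  intro u v h
  ext i
  have hu := revKey_succ u i.rev
  have hv := revKey_succ v i.rev
  rw [h, hv, Fin.rev_rev] at hu
  exact (Nat.add_right_cancel hu).symm

theorem revKey_lt_iff {n : ℕ} (u v : Fin n →₀ ℕ) :
    revKey u < revKey v ↔ u.degree < v.degree ∨
      (u.degree = v.degree ∧ ∃ i, (∀ j, i < j → u j = v j) ∧ v i < u i) := by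
  have key : ∀ u v : Fin n →₀ ℕ, revKey u < revKey v → u.degree < v.degree ∨
      (u.degree = v.degree ∧ ∃ i, (∀ j, i < j → u j = v j) ∧ v i < u i) := by
    rintro u v ⟨k, hk, hlt⟩
    change ∀ l, l < k → ofLex (revKey u) l = ofLex (revKey v) l at hk
    change ofLex (revKey u) k < ofLex (revKey v) k at hlt
    by_cases h0 : (k : ℕ) = 0
    · left
      rwa [revKey_zero u k h0, revKey_zero v k h0] at hlt
    · right
      have hkn := k.isLt
      refine ⟨?_, (⟨k - 1, by omega⟩ : Fin n).rev, ?_, ?_⟩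
      · have := hk ⟨0, by omega⟩ (Fin.lt_def.2 (by simp only; omega))
        rwa [revKey_zero u _ rfl, revKey_zero v _ rfl] at this
      · intro j hj
        rw [Fin.lt_def, Fin.val_rev] at hj
        have hjn := j.isLt
        have hu := revKey_succ u j.rev
        have hv := revKey_succ v j.rev
        simp only [Fin.rev_rev, Fin.val_rev] at hu hv
        simp only at hj
        rw [dif_pos (by omega)] at hu hv
        rw [hk _ (Fin.lt_def.2 (by simp only [Fin.val_rev]; omega)), hv,
          hk _ (Fin.lt_def.2 (by simp only; omega))] at hu
        omega
      · have hu := revKey_succ u ⟨k - 1, by omega⟩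
        have hv := revKey_succ v ⟨k - 1, by omega⟩
        have e : (k : ℕ) - 1 + 1 < n := by omega
        have e2 : (⟨(k : ℕ) - 1 + 1, e⟩ : Fin n) = k := Fin.ext (by simp only; omega)
        simp only at hu hv
        rw [dif_pos e, e2] at hu hv
        rw [hk _ (Fin.lt_def.2 (by simp only; omega)), hv] at hu
        omega
  refine ⟨key u v, fun h => ?_⟩
  rcases lt_trichotomy (revKey u) (revKey v) with h1 | h1 | h1
  · exact h1
  · obtain rfl := revKey_injective n h1
    rcases h with h | ⟨-, i, -, h⟩ <;> exact absurd h (lt_irrefl _)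
  · rcases h with h | ⟨he, i, hi, hlt⟩ <;> rcases key v u h1 with h' | ⟨he', i', hi', hlt'⟩
    · omega
    · omega
    · omega
    · rcases lt_trichotomy i i' with hh | rfl | hh
      · have := hi i' hh
        omega
      · omega
      · have := hi' i hh
        omega

theorem revKey_add {n : ℕ} (u v : Fin n →₀ ℕ) : revKey (u + v) = revKey u + revKey v := by
  apply ofLex.injective
  funext k
  change ofLex (revKey (u + v)) k = ofLex (revKey u) k + ofLex (revKey v) k
  rw [revKey_apply, revKey_apply, revKey_apply, ← Finset.sum_add_distrib]
  rfl

instance (n : ℕ) : LinearOrder (DegRevLexSyn n) :=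
  LinearOrder.lift' (fun u : DegRevLexSyn n => revKey (n := n) u) (revKey_injective n)

/-- The degree reverse lexicographic order on the monomials in `x₀ > x₁ > ⋯ > xₙ₋₁`. -/
def degRevLex (n : ℕ) : MonomialOrder (Fin n) where
  syn := DegRevLexSyn n
  isOrderedAddMonoid_syn :=
    { add_le_add_left := fun a b h c => by
        change revKey (n := n) a ≤ revKey (n := n) b at h
        change revKey (n := n) ((a : Fin n →₀ ℕ) + c) ≤ revKey (n := n) ((b : Fin n →₀ ℕ) + c)
        have h1 := revKey_add (n := n) a c
        have h2 := revKey_add (n := n) b c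
        exact (h1.le.trans (add_le_add_left h _)).trans h2.ge }
  toSyn := { toEquiv := Equiv.refl (Fin n →₀ ℕ), map_add' := fun _ _ => rfl }
  toSyn_monotone := by
    intro a b h
    change revKey a ≤ revKey b
    apply Pi.toLex_monotone
    intro k
    exact Finset.sum_le_sum fun i _ => h i
  wellFoundedLT_syn := ⟨InvImage.wf (fun u : DegRevLexSyn n => revKey (n := n) u) wellFounded_lt⟩

open scoped MonomialOrder in
/-- `x^u < x^v` iff `deg u < deg v`, or the degrees agree and the last nonzero entry of `v - u`
is negative. -/
theorem degRevLex_lt_iff {n : ℕ} (u v : Fin n →₀ ℕ) :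
    u ≺[degRevLex n] v ↔ u.degree < v.degree ∨
      (u.degree = v.degree ∧ ∃ i, (∀ j, i < j → u j = v j) ∧ v i < u i) :=
  revKey_lt_iff u v

attribute [local instance] MvPolynomial.gradedAlgebra

variable {K : Type*} [Field K] {n : ℕ}

/-! ### Graded pieces, monomial ideals, initial ideals -/

/-- The graded component `I_d` of the ideal `I`, a `K`-vector space. -/
def gradedPiece (I : Ideal (MvPolynomial (Fin n) K)) (d : ℕ) :
    Submodule K (MvPolynomial (Fin n) K) :=
  I.restrictScalars K ⊓ homogeneousSubmodule (Fin n) K d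

/-- `I` is generated by monomials. -/
def IsMonomialIdeal (I : Ideal (MvPolynomial (Fin n) K)) : Prop :=
  ∃ A : Set (Fin n →₀ ℕ), I = Ideal.span ((fun u => monomial u (1 : K)) '' A)

/-- The (exponents of the) minimal monomial generators `G(I)` of a monomial ideal `I`: the
monomials of `I` not divisible by any other monomial of `I`. -/
def minGens (I : Ideal (MvPolynomial (Fin n) K)) : Set (Fin n →₀ ℕ) :=
  {u | monomial u (1 : K) ∈ I ∧ ∀ v, v ≤ u → monomial v (1 : K) ∈ I → v = u}

/-- The initial ideal of `I`, generated by the initial monomials of the nonzero elements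
of `I`. -/
def initialIdeal (m : MonomialOrder (Fin n)) (I : Ideal (MvPolynomial (Fin n) K)) :
    Ideal (MvPolynomial (Fin n) K) :=
  Ideal.span {p | ∃ f ∈ I, f ≠ 0 ∧ p = monomial (m.degree f) 1}

/-! ### The generic initial ideal -/

/-- The linear change of coordinates `x_j ↦ ∑ i, g i j * x_i`. -/
def linSubst (g : Matrix (Fin n) (Fin n) K) :
    MvPolynomial (Fin n) K →ₐ[K] MvPolynomial (Fin n) K :=
  aeval fun j => ∑ i, C (g i j) * X i

/-- The property `p` holds for all `g` in a nonempty Zariski open subset of `GL_n(K)`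
(`K` infinite): wherever some fixed nonzero polynomial in the matrix entries does not vanish. -/
def ForGenericGL (p : GL (Fin n) K → Prop) : Prop :=
  ∃ P : MvPolynomial (Fin n × Fin n) K, P ≠ 0 ∧
    ∀ g : GL (Fin n) K, eval (fun e => (g : Matrix (Fin n) (Fin n) K) e.1 e.2) P ≠ 0 → p g

/-- The generic initial ideal `Gin(I)` for the reverse lexicographic order: the monomial ideal
whose monomials are those lying in `in(g I)` for generic `g ∈ GL_n(K)`. (If `in(g I) = J` for
generic `g`, then this ideal is `J`.) -/
def gin (I : Ideal (MvPolynomial (Fin n) K)) : Ideal (MvPolynomial (Fin n) K) :=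
  Ideal.span ((fun u => monomial u (1 : K)) '' {u | ForGenericGL fun g : GL (Fin n) K =>
    monomial u (1 : K) ∈ initialIdeal (degRevLex n) (I.map (linSubst (g : Matrix _ _ K)))})

/-- Nonempty Zariski open subsets of `GL_n(K)` meet. -/
theorem exists_GL_of_ne_zero [Infinite K] {P : MvPolynomial (Fin n × Fin n) K} (hP : P ≠ 0) :
    ∃ g : GL (Fin n) K, eval (fun e => (g : Matrix (Fin n) (Fin n) K) e.1 e.2) P ≠ 0 := by
  have hD : (Matrix.mvPolynomialX (Fin n) (Fin n) K).det ≠ 0 := Matrix.det_mvPolynomialX_ne_zero _ _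
  have hPD := mul_ne_zero hP hD
  obtain ⟨x, hx⟩ : ∃ x, eval x (P * (Matrix.mvPolynomialX (Fin n) (Fin n) K).det) ≠ 0 := by
    by_contra! h
    exact hPD (MvPolynomial.funext fun x => by rw [h x, map_zero])
  rw [map_mul] at hx
  have hdet : (Matrix.of fun i j => x (i, j)).det ≠ 0 := by
    have h2 := right_ne_zero_of_mul hx
    rw [RingHom.map_det] at h2
    convert h2 using 2
    ext i j
    simp [Matrix.mvPolynomialX]
  refine ⟨Matrix.GeneralLinearGroup.mkOfDetNeZero _ hdet, ?_⟩
  exact left_ne_zero_of_mul hx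

/-- If `in(g I) = J` for generic `g`, then `gin I = J`. -/
theorem gin_eq_of_generic [Infinite K] {I J : Ideal (MvPolynomial (Fin n) K)}
    (h : ForGenericGL fun g : GL (Fin n) K =>
      initialIdeal (degRevLex n) (I.map (linSubst (g : Matrix _ _ K))) = J) : gin I = J := by
  obtain ⟨P, hP, h⟩ := h
  apply le_antisymm
  · refine Ideal.span_le.2 ?_
    rintro _ ⟨u, ⟨Q, hQ, hu⟩, rfl⟩
    obtain ⟨g, hg⟩ := exists_GL_of_ne_zero (mul_ne_zero hP hQ)
    rw [map_mul] at hg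
    rw [← h g (left_ne_zero_of_mul hg)]
    exact hu g (right_ne_zero_of_mul hg)
  · obtain ⟨g, hg⟩ := exists_GL_of_ne_zero hP
    rw [← h g hg]
    refine Ideal.span_le.2 ?_
    rintro _ ⟨f, hf, hf0, rfl⟩
    refine Ideal.subset_span ⟨_, ⟨P, hP, fun g' hg' => ?_⟩, rfl⟩
    dsimp only
    rw [h g' hg', ← h g hg]
    exact Ideal.subset_span ⟨f, hf, hf0, rfl⟩

/-! ### Graded Betti numbers -/

/-- The differential of the Koszul complex of `x₀, …, xₙ₋₁`: a family `f` indexed by the subsets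
of the variables stands for `∑ σ, f σ • e_σ`, and
`∂ e_σ = ∑ k ∈ σ, (-1) ^ #{l ∈ σ | l < k} • x_k • e_(σ \ {k})`. -/
def koszulD (K : Type*) [Field K] (n : ℕ) :
    (Finset (Fin n) → MvPolynomial (Fin n) K) →ₗ[K] (Finset (Fin n) → MvPolynomial (Fin n) K) where
  toFun f τ := ∑ k ∈ τᶜ, (-1) ^ (τ.filter (fun l => l < k)).card * X k * f (insert k τ)
  map_add' f g := by
    funext τ
    simp [mul_add, Finset.sum_add_distrib]
  map_smul' c f := by
    funext τ
    simp [Finset.smul_sum]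

/-- The degree `j` part of the `i`-th term of the Koszul complex of `I`: sums of `f_σ e_σ` with
`|σ| = i` and `f_σ ∈ I` homogeneous of degree `j - i` (each `e_σ` has degree `|σ|`). -/
def koszulChains (I : Ideal (MvPolynomial (Fin n) K)) (i j : ℕ) :
    Submodule K (Finset (Fin n) → MvPolynomial (Fin n) K) :=
  Submodule.pi Set.univ fun σ => if σ.card = i ∧ i ≤ j then gradedPiece I (j - i) else ⊥

/-- The degree `j` part of the `i`-cycles of the Koszul complex of `I`. -/
def koszulCycles (I : Ideal (MvPolynomial (Fin n) K)) (i j : ℕ) :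
    Submodule K (Finset (Fin n) → MvPolynomial (Fin n) K) :=
  koszulChains I i j ⊓ LinearMap.ker (koszulD K n)

/-- The degree `j` part of the `i`-boundaries of the Koszul complex of `I`. -/
def koszulBoundaries (I : Ideal (MvPolynomial (Fin n) K)) (i j : ℕ) :
    Submodule K (Finset (Fin n) → MvPolynomial (Fin n) K) :=
  (koszulChains I (i + 1) j).map (koszulD K n)

/-- The graded Betti number `β_{ij}(I) = dim_K Tor_i^S(K, I)_j`, where the graded vector space
`Tor_i^S(K, I)` is the `i`-th homology of `I` tensored with the Koszul complex, the minimal graded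
free resolution of `K` over `S`. -/
def betti (I : Ideal (MvPolynomial (Fin n) K)) (i j : ℕ) : ℕ :=
  Module.finrank K (koszulCycles I i j ⧸ (koszulBoundaries I i j).submoduleOf (koszulCycles I i j))

/-- The total Betti number `β_i(I) = ∑ j, β_{ij}(I)`. -/
def totalBetti (I : Ideal (MvPolynomial (Fin n) K)) (i : ℕ) : ℕ∞ :=
  ∑' j, (betti I i j : ℕ∞)

/-! ### Componentwise linear ideals and Gotzmann ideals -/

/-- The ideal `I_⟨d⟩` generated by the homogeneous elements of degree `d` of `I`. -/
def componentIdeal (I : Ideal (MvPolynomial (Fin n) K)) (d : ℕ) : Ideal (MvPolynomial (Fin n) K) :=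
  Ideal.span (gradedPiece I d : Set (MvPolynomial (Fin n) K))

/-- `I` has a `d`-linear resolution: `β_{ij}(I) = 0` for `j ≠ i + d`. -/
def HasLinearResolution (I : Ideal (MvPolynomial (Fin n) K)) (d : ℕ) : Prop :=
  ∀ i j, j ≠ i + d → betti I i j = 0

/-- A homogeneous ideal `I` is componentwise linear if each `I_⟨d⟩` has a `d`-linear
resolution. -/
def IsComponentwiseLinear (I : Ideal (MvPolynomial (Fin n) K)) : Prop :=
  I.IsHomogeneous (homogeneousSubmodule (Fin n) K) ∧ ∀ d, HasLinearResolution (componentIdeal I d) d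

/-- A monomial ideal `L` is lexsegment if a monomial lies in `L` whenever it is lexicographically
larger than some monomial of `L` of the same degree. -/
def IsLexsegment (L : Ideal (MvPolynomial (Fin n) K)) : Prop :=
  IsMonomialIdeal L ∧ ∀ u v : Fin n →₀ ℕ, u.degree = v.degree → toLex u < toLex v →
    monomial u (1 : K) ∈ L → monomial v (1 : K) ∈ L

/-- `I` and `J` have the same Hilbert function. -/
def SameHilbertFunction (I J : Ideal (MvPolynomial (Fin n) K)) : Prop :=
  ∀ d, Module.finrank K (gradedPiece I d) = Module.finrank K (gradedPiece J d)

/-- A homogeneous ideal `I` is Gotzmann if its graded Betti numbers are those of the (unique)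
lexsegment ideal `I^lex` with the same Hilbert function as `I`. -/
def IsGotzmann (I : Ideal (MvPolynomial (Fin n) K)) : Prop :=
  I.IsHomogeneous (homogeneousSubmodule (Fin n) K) ∧
    ∃ L, IsLexsegment L ∧ SameHilbertFunction L I ∧ ∀ i j, betti I i j = betti L i j

end CompLinear

end

/-!
The proof compares `I` with its generic initial ideal `J = gin I`, shows that `J` is a stable
monomial ideal with the Betti numbers of `I`, and reads off from the formula of Eliahou and Kervaire
that the assumed extremal Betti number forces `J` to be lexsegment.

*From `I` to `J`.* Let `A = I_⟨d⟩`. That `A` has a `d`-linear resolution implies that the Koszul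
homology of `S/A` vanishes in degrees `≥ d` (`KoszulAcyclic`,
`HasLinearResolution.koszulAcyclic`). This condition does not depend on the coordinates
(`KoszulAcyclic.map_linSubst`) and, following Bayer and Stillman, it can be tested one variable at a
time: it holds if, for every `k`, multiplication by `x_k` is injective on
`S/(A + (x_{k+1}, …, x_{n-1}))` in degrees `≥ d` (`koszulAcyclic_of_injAt`), and conversely it
implies this in suitable coordinates, which can be chosen in any given nonempty open subset of
`GL_n` (`KoszulAcyclic.exists_generic`; the vanishing of the top Koszul homology says that there is
no socle in degrees `≥ d`, so a general linear form is injective there). For the reverse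
lexicographic order the conditions on the variables pass to the initial ideal `B` of `g A`
(`injAt_initialIdeal`), and they say that a monomial of `B` of degree `> d` can be divided by its
last variable within `B` (`IsLead.sub_single`); as `B_d = J_d`, this makes `J` stable. Finally, for
ideals whose Koszul homology vanishes in degrees `≥ d` the dimensions of the spaces of Koszul cycles
on and above the linear strand are determined by the Hilbert function
(`finrank_koszulCycles_eq`), and the cycles `Z_i(I)_j` only depend on `I_⟨j - i⟩`; hence `I` and `J`
have the same Betti numbers (`IsComponentwiseLinear.betti_gin`). Working with one degree at a time
avoids the need for a generic initial ideal that is the initial ideal of a single `g I`: in a fixed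
degree it is one, as finitely many ranks are generically constant (`exists_generic_gin`).

*The extremal Betti number.* For a stable ideal `J` with minimal generators `G`,
`β_i(J) = ∑ u ∈ G, (m(u) choose i)`, where `x_{m(u)}` is the last variable dividing `u`, numbered
from `0` (`IsStable.totalBetti_eq`; the dimensions of the spaces of cycles are found by adding one
variable at a time). Exchanging the last variable of a generator for earlier ones shows that the
values of `m` on `G` form an initial segment of `ℕ` (`IsStable.exists_minGens_lastVar`).
So `∑ u ∈ G, (m(u) choose i)` is at most `∑ k < s, (k choose i) = (s choose i + 1)`, and for
`1 ≤ i < s` equality forces `m` to be a bijection onto `{0, …, s - 1}`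
(`bijective_of_sum_choose_eq`). All Betti numbers are then as claimed, and the generators of `J` are
`x_0^(b_0) ⋯ x_{k-1}^(b_{k-1}) x_k^(b_k + 1)` for suitable exponents `b`
(`IsStable.apply_add_one_of_injOn`), which makes `J` lexsegment.
-/

open MvPolynomial

noncomputable section

namespace CompLinear

attribute [local instance] MvPolynomial.gradedAlgebra

variable {K : Type*} [Field K] {n : ℕ}

/-! ### Contraction and exterior multiplication on Koszul chains -/

/-- The sign of moving `k` past the elements of `τ` smaller than `k`. -/
def koszulSign (τ : Finset (Fin n)) (k : Fin n) : MvPolynomial (Fin n) K :=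
  (-1) ^ (τ.filter (fun l => l < k)).card

theorem koszulSign_mul_self (τ : Finset (Fin n)) (k : Fin n) :
    koszulSign τ k * koszulSign τ k = (1 : MvPolynomial (Fin n) K) := by
  rw [koszulSign, ← mul_pow]; simp

theorem koszulSign_insert {τ : Finset (Fin n)} {a : Fin n} (ha : a ∉ τ) (b : Fin n) :
    (koszulSign (insert a τ) b : MvPolynomial (Fin n) K) =
      if a < b then -koszulSign τ b else koszulSign τ b := by
  unfold koszulSign
  rw [Finset.filter_insert]
  split_ifs with h
  · rw [Finset.card_insert_of_notMem (by simp [ha]), pow_succ]; ring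
  · rfl

theorem koszulSign_erase {τ : Finset (Fin n)} {a : Fin n} (ha : a ∈ τ) (b : Fin n) :
    (koszulSign (τ.erase a) b : MvPolynomial (Fin n) K) =
      if a < b then -koszulSign τ b else koszulSign τ b := by
  have := koszulSign_insert (K := K) (Finset.notMem_erase a τ) b
  rw [Finset.insert_erase ha] at this
  rw [this]
  split_ifs <;> simp

/-- Contraction of Koszul chains by the `k`-th dual basis vector. -/
def contr (k : Fin n) : (Finset (Fin n) → MvPolynomial (Fin n) K) →ₗ[MvPolynomial (Fin n) K]
    (Finset (Fin n) → MvPolynomial (Fin n) K) where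
  toFun f τ := if k ∈ τ then 0 else koszulSign τ k * f (insert k τ)
  map_add' f g := by
    funext τ; dsimp only [Pi.add_apply]; split_ifs <;> simp [mul_add]
  map_smul' c f := by
    funext τ
    dsimp only [Pi.smul_apply, smul_eq_mul, RingHom.id_apply]
    split_ifs
    · simp
    · ring

/-- Exterior multiplication of Koszul chains by the `k`-th basis vector. -/
def wedge (k : Fin n) : (Finset (Fin n) → MvPolynomial (Fin n) K) →ₗ[MvPolynomial (Fin n) K]
    (Finset (Fin n) → MvPolynomial (Fin n) K) where
  toFun f τ := if k ∈ τ then koszulSign τ k * f (τ.erase k) else 0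
  map_add' f g := by
    funext τ; dsimp only [Pi.add_apply]; split_ifs <;> simp [mul_add]
  map_smul' c f := by
    funext τ
    dsimp only [Pi.smul_apply, smul_eq_mul, RingHom.id_apply]
    split_ifs
    · ring
    · simp

theorem contr_apply (k : Fin n) (f : Finset (Fin n) → MvPolynomial (Fin n) K) (τ) :
    contr k f τ = if k ∈ τ then 0 else koszulSign τ k * f (insert k τ) := rfl

theorem wedge_apply (k : Fin n) (f : Finset (Fin n) → MvPolynomial (Fin n) K) (τ) :
    wedge k f τ = if k ∈ τ then koszulSign τ k * f (τ.erase k) else 0 := rfl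

section

variable (f : Finset (Fin n) → MvPolynomial (Fin n) K)

theorem contr_contr_self (k : Fin n) : contr k (contr k f) = 0 := by
  funext τ
  rw [contr_apply]
  split_ifs
  · rfl
  · rw [contr_apply, if_pos (Finset.mem_insert_self _ _), mul_zero]; rfl

theorem wedge_wedge_self (k : Fin n) : wedge k (wedge k f) = 0 := by
  funext τ
  rw [wedge_apply]
  split_ifs
  · rw [wedge_apply, if_neg (Finset.notMem_erase _ _), mul_zero]; rfl
  · rfl

theorem contr_contr (a b : Fin n) : contr a (contr b f) = -contr b (contr a f) := by
  rcases eq_or_ne a b with rfl | hab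
  · simp [contr_contr_self]
  funext τ
  rw [Pi.neg_apply]
  simp only [contr_apply, Finset.mem_insert, hab, hab.symm, false_or]
  by_cases ha : a ∈ τ
  · simp [ha]
  by_cases hb : b ∈ τ
  · simp [hb]
  simp only [ha, hb, if_false, koszulSign_insert ha, koszulSign_insert hb, Finset.insert_comm a b]
  rcases lt_or_gt_of_ne hab with h | h
  · rw [if_pos h, if_neg h.not_gt]; ring
  · rw [if_pos h, if_neg h.not_gt]; ring

theorem wedge_contr_self (k : Fin n) : wedge k (contr k f) + contr k (wedge k f) = f := by
  funext τ
  rw [Pi.add_apply, wedge_apply, contr_apply k (wedge k f)]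
  by_cases h : k ∈ τ
  · rw [if_pos h, if_pos h, contr_apply, if_neg (Finset.notMem_erase _ _), Finset.insert_erase h,
      koszulSign_erase h, if_neg (lt_irrefl _), ← mul_assoc, koszulSign_mul_self, one_mul, add_zero]
  · rw [if_neg h, if_neg h, wedge_apply, if_pos (Finset.mem_insert_self _ _),
      Finset.erase_insert h, koszulSign_insert h, if_neg (lt_irrefl _), ← mul_assoc,
      koszulSign_mul_self, one_mul, zero_add]

theorem contr_wedge_of_ne {a b : Fin n} (hab : a ≠ b) :
    contr a (wedge b f) = -wedge b (contr a f) := by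
  funext τ
  rw [Pi.neg_apply]
  simp only [contr_apply, wedge_apply, Finset.mem_insert, hab.symm, false_or, Finset.mem_erase, hab,
    ne_eq, not_false_eq_true, true_and]
  by_cases ha : a ∈ τ
  · simp [ha]
  by_cases hb : b ∈ τ
  · simp only [ha, hb, if_false, if_true, koszulSign_insert ha, koszulSign_erase hb,
      Finset.erase_insert_of_ne hab]
    rcases lt_or_gt_of_ne hab with h | h
    · rw [if_pos h, if_neg h.not_gt]; ring
    · rw [if_pos h, if_neg h.not_gt]; ring
  · simp [hb]

theorem contr_wedge (a b : Fin n) :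
    contr a (wedge b f) = (if a = b then f else 0) - wedge b (contr a f) := by
  split_ifs with h
  · subst h
    rw [eq_sub_iff_add_eq, add_comm, wedge_contr_self]
  · rw [contr_wedge_of_ne f h, zero_sub]

/-! ### Koszul differentials of arbitrary sequences -/

/-- The Koszul differential of the sequence `y`. -/
def seqD (y : Fin n → MvPolynomial (Fin n) K) :
    (Finset (Fin n) → MvPolynomial (Fin n) K) →ₗ[MvPolynomial (Fin n) K]
    (Finset (Fin n) → MvPolynomial (Fin n) K) :=
  ∑ k, y k • contr k

theorem seqD_apply (y : Fin n → MvPolynomial (Fin n) K) : seqD y f = ∑ k, y k • contr k f := by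
  simp [seqD]

theorem koszulD_eq : koszulD K n f = seqD X f := by
  funext τ
  rw [seqD_apply, Finset.sum_apply]
  change ∑ k ∈ τᶜ, _ = _
  rw [← Finset.sum_subset (Finset.subset_univ τᶜ)]
  · refine Finset.sum_congr rfl fun k hk => ?_
    rw [Pi.smul_apply, contr_apply, if_neg (Finset.mem_compl.1 hk), koszulSign, smul_eq_mul]
    ring
  · intro k _ hk
    rw [Pi.smul_apply, contr_apply, if_pos (by simpa using hk), smul_zero]

variable (y : Fin n → MvPolynomial (Fin n) K)

theorem seqD_contr (k : Fin n) : seqD y (contr k f) = -contr k (seqD y f) := by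
  simp only [seqD_apply, map_sum, map_smul, ← Finset.sum_neg_distrib, ← smul_neg]
  exact Finset.sum_congr rfl fun a _ => by rw [contr_contr]

/-- Exterior multiplication by `e_k` is a homotopy from multiplication by `y k` to zero. -/
theorem seqD_wedge (k : Fin n) : seqD y (wedge k f) = y k • f - wedge k (seqD y f) := by
  simp only [seqD_apply, map_sum, map_smul]
  simp only [contr_wedge, smul_sub, Finset.sum_sub_distrib]
  simp

theorem seqD_seqD : seqD y (seqD y f) = 0 := by
  have key : ∀ s : Finset (Fin n), ∑ a ∈ s, ∑ b ∈ s, (y a * y b) • contr b (contr a f) = 0 := by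
    intro s
    induction s using Finset.induction_on with
    | empty => simp
    | insert k s hk ih =>
      simp only [Finset.sum_insert hk, Finset.sum_add_distrib, ih, contr_contr_self, smul_zero,
        zero_add, add_zero]
      rw [← Finset.sum_add_distrib]
      refine Finset.sum_eq_zero fun b _ => ?_
      rw [contr_contr f k b, mul_comm, smul_neg, add_neg_cancel]
  rw [seqD_apply f y, map_sum]
  refine Eq.trans (Finset.sum_congr rfl fun k _ => ?_) (key Finset.univ)
  rw [map_smul, seqD_apply, Finset.smul_sum]
  exact Finset.sum_congr rfl fun b _ => smul_smul _ _ _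

/-! ### Chains with coefficients in an ideal, of given degree and support -/

theorem mem_koszulChains {A : Ideal (MvPolynomial (Fin n) K)} {i j : ℕ} :
    f ∈ koszulChains A i j ↔ (∀ σ, f σ ≠ 0 → σ.card = i ∧ i ≤ j) ∧ (∀ σ, f σ ∈ A) ∧
      ∀ σ, (f σ).IsHomogeneous (j - i) := by
  rw [koszulChains, Submodule.mem_pi]
  constructor
  · intro h
    have h' : ∀ σ, (f σ ≠ 0 → σ.card = i ∧ i ≤ j) ∧ f σ ∈ A ∧ (f σ).IsHomogeneous (j - i) := by
      intro σ
      have := h σ trivial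
      split_ifs at this with hc
      · exact ⟨fun _ => hc, this.1, this.2⟩
      · rw [Submodule.mem_bot] at this
        rw [this]
        exact ⟨fun h => absurd rfl h, A.zero_mem, isHomogeneous_zero _ _ _⟩
    exact ⟨fun σ => (h' σ).1, fun σ => (h' σ).2.1, fun σ => (h' σ).2.2⟩
  · rintro ⟨h1, h2, h3⟩ σ -
    split_ifs with hc
    · exact ⟨h2 σ, h3 σ⟩
    · by_contra h
      exact hc (h1 σ h)

/-- The chains with all coefficients in `A`. -/
def coeffIn (A : Ideal (MvPolynomial (Fin n) K)) :
    Submodule (MvPolynomial (Fin n) K) (Finset (Fin n) → MvPolynomial (Fin n) K) :=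
  Submodule.pi Set.univ fun _ => A

variable {f y}

theorem mem_coeffIn {A : Ideal (MvPolynomial (Fin n) K)} : f ∈ coeffIn A ↔ ∀ σ, f σ ∈ A := by
  simp [coeffIn]

theorem coeffIn_mono {A B : Ideal (MvPolynomial (Fin n) K)} (h : A ≤ B) (hf : f ∈ coeffIn A) :
    f ∈ coeffIn B :=
  mem_coeffIn.2 fun σ => h (mem_coeffIn.1 hf σ)

theorem contr_mem_coeffIn {A : Ideal (MvPolynomial (Fin n) K)} (k : Fin n) (hf : f ∈ coeffIn A) :
    contr k f ∈ coeffIn A := by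
  refine mem_coeffIn.2 fun σ => ?_
  rw [contr_apply]
  split_ifs
  · exact A.zero_mem
  · exact A.mul_mem_left _ (mem_coeffIn.1 hf _)

theorem wedge_mem_coeffIn {A : Ideal (MvPolynomial (Fin n) K)} (k : Fin n) (hf : f ∈ coeffIn A) :
    wedge k f ∈ coeffIn A := by
  refine mem_coeffIn.2 fun σ => ?_
  rw [wedge_apply]
  split_ifs
  · exact A.mul_mem_left _ (mem_coeffIn.1 hf _)
  · exact A.zero_mem

theorem seqD_mem_coeffIn {A : Ideal (MvPolynomial (Fin n) K)} (hf : f ∈ coeffIn A) :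
    seqD y f ∈ coeffIn A := by
  rw [seqD_apply]
  exact Submodule.sum_mem _ fun k _ => Submodule.smul_mem _ _ (contr_mem_coeffIn k hf)

theorem mem_koszulChains_iff_coeffIn {A : Ideal (MvPolynomial (Fin n) K)} {i j : ℕ} :
    f ∈ koszulChains A i j ↔ f ∈ koszulChains ⊤ i j ∧ f ∈ coeffIn A := by
  simp only [mem_koszulChains, mem_coeffIn, Submodule.mem_top]
  tauto

/-- Multiplication by a homogeneous polynomial of degree `1` raises the degree by `1`. -/
theorem smul_mem_koszulChains {A : Ideal (MvPolynomial (Fin n) K)} {i j : ℕ}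
    (hf : f ∈ koszulChains A i j) {p : MvPolynomial (Fin n) K} (hp : p.IsHomogeneous 1) :
    p • f ∈ koszulChains A i (j + 1) := by
  obtain ⟨h1, h2, h3⟩ := (mem_koszulChains f).1 hf
  refine (mem_koszulChains _).2 ⟨fun σ hσ => ?_, fun σ => A.mul_mem_left _ (h2 σ), fun σ => ?_⟩
  · have := h1 σ (fun h => hσ (by simp [h]))
    omega
  · by_cases h0 : f σ = 0
    · simp [h0, isHomogeneous_zero]
    · have := hp.mul (h3 σ)
      rwa [show 1 + (j - i) = j + 1 - i by have := h1 σ h0; omega] at this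

theorem koszulSign_isHomogeneous (τ : Finset (Fin n)) (k : Fin n) :
    (koszulSign τ k : MvPolynomial (Fin n) K).IsHomogeneous 0 := by
  have := ((isHomogeneous_one (Fin n) K).neg).pow (τ.filter (fun l => l < k)).card
  simpa [koszulSign] using this

theorem contr_mem_koszulChains {A : Ideal (MvPolynomial (Fin n) K)} {i j : ℕ} (k : Fin n)
    (hf : f ∈ koszulChains A (i + 1) (j + 1)) : contr k f ∈ koszulChains A i j := by
  obtain ⟨h1, h2, h3⟩ := (mem_koszulChains f).1 hf
  refine (mem_koszulChains _).2 ⟨fun σ hσ => ?_,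
    mem_coeffIn.1 (contr_mem_coeffIn k (mem_coeffIn.2 h2)), fun σ => ?_⟩
  · rw [contr_apply] at hσ
    split_ifs at hσ with hk
    · exact absurd rfl hσ
    · have := h1 _ (right_ne_zero_of_mul hσ)
      rw [Finset.card_insert_of_notMem hk] at this
      omega
  · rw [contr_apply]
    split_ifs with hk
    · exact isHomogeneous_zero _ _ _
    · have := (koszulSign_isHomogeneous σ k).mul (h3 (insert k σ))
      rwa [show 0 + (j + 1 - (i + 1)) = j - i by omega] at this

theorem contr_eq_zero_of_mem_koszulChains_zero {A : Ideal (MvPolynomial (Fin n) K)} {j : ℕ}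
    (k : Fin n) (hf : f ∈ koszulChains A 0 j) : contr k f = 0 := by
  obtain ⟨h1, -, -⟩ := (mem_koszulChains f).1 hf
  funext σ
  rw [contr_apply]
  split_ifs with hk
  · rfl
  · by_contra h
    have := (h1 _ (right_ne_zero_of_mul h)).1
    rw [Finset.card_insert_of_notMem hk] at this
    omega

theorem wedge_mem_koszulChains {A : Ideal (MvPolynomial (Fin n) K)} {i j : ℕ} (k : Fin n)
    (hf : f ∈ koszulChains A i j) : wedge k f ∈ koszulChains A (i + 1) (j + 1) := by
  obtain ⟨h1, h2, h3⟩ := (mem_koszulChains f).1 hf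
  refine (mem_koszulChains _).2 ⟨fun σ hσ => ?_,
    mem_coeffIn.1 (wedge_mem_coeffIn k (mem_coeffIn.2 h2)), fun σ => ?_⟩
  · rw [wedge_apply] at hσ
    split_ifs at hσ with hk
    · have := h1 _ (right_ne_zero_of_mul hσ)
      rw [Finset.card_erase_of_mem hk] at this
      have := Finset.card_pos.2 ⟨k, hk⟩
      omega
    · exact absurd rfl hσ
  · rw [wedge_apply]
    split_ifs with hk
    · have := (koszulSign_isHomogeneous σ k).mul (h3 (σ.erase k))
      rwa [show 0 + (j - i) = j + 1 - (i + 1) by omega] at this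
    · exact isHomogeneous_zero _ _ _

theorem koszulChains_zero_of_lt {A : Ideal (MvPolynomial (Fin n) K)} {i j : ℕ} (hij : j < i)
    (hf : f ∈ koszulChains A i j) : f = 0 := by
  funext σ
  by_contra h
  have := ((mem_koszulChains f).1 hf).1 σ h
  omega

theorem seqD_mem_koszulChains {A : Ideal (MvPolynomial (Fin n) K)} {i j : ℕ}
    (hy : ∀ k, (y k).IsHomogeneous 1) (hf : f ∈ koszulChains A (i + 1) j) :
    seqD y f ∈ koszulChains A i j := by
  rcases j with _ | j
  · rw [koszulChains_zero_of_lt (by omega) hf, map_zero]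
    exact Submodule.zero_mem _
  · rw [seqD_apply]
    exact Submodule.sum_mem _ fun k _ =>
      smul_mem_koszulChains (contr_mem_koszulChains k hf) (hy k)

theorem seqD_eq_zero_of_mem_koszulChains_zero {A : Ideal (MvPolynomial (Fin n) K)} {j : ℕ}
    (hf : f ∈ koszulChains A 0 j) : seqD y f = 0 := by
  rw [seqD_apply]
  exact Finset.sum_eq_zero fun k _ => by
    rw [contr_eq_zero_of_mem_koszulChains_zero k hf, smul_zero]

/-- The chain `f` only involves the first `k` variables: it lives on subsets of `{0, …, k - 1}`. -/
def SuppBelow (k : ℕ) (f : Finset (Fin n) → MvPolynomial (Fin n) K) : Prop :=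
  ∀ l : Fin n, k ≤ l → contr l f = 0

theorem SuppBelow.mono {k k' : ℕ} (h : k ≤ k') (hf : SuppBelow k f) : SuppBelow k' f :=
  fun l hl => hf l (h.trans hl)

theorem suppBelow_iff {k : ℕ} : SuppBelow k f ↔ ∀ σ, ∀ l : Fin n, l ∈ σ → k ≤ l → f σ = 0 := by
  constructor
  · intro h σ l hl hk
    have := congrFun (h l hk) (σ.erase l)
    rw [contr_apply, if_neg (Finset.notMem_erase _ _), Finset.insert_erase hl,
      Pi.zero_apply] at this
    have h2 := congrArg (koszulSign (σ.erase l) l * ·) this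
    simpa [← mul_assoc, koszulSign_mul_self] using h2
  · intro h l hl
    funext σ
    rw [contr_apply]
    split_ifs
    · rfl
    · rw [h _ l (Finset.mem_insert_self _ _) hl, mul_zero]; rfl

theorem SuppBelow.add {k : ℕ} {g : Finset (Fin n) → MvPolynomial (Fin n) K} (hf : SuppBelow k f)
    (hg : SuppBelow k g) : SuppBelow k (f + g) := fun l hl => by
  rw [map_add, hf l hl, hg l hl, add_zero]

theorem SuppBelow.sub {k : ℕ} {g : Finset (Fin n) → MvPolynomial (Fin n) K} (hf : SuppBelow k f)
    (hg : SuppBelow k g) : SuppBelow k (f - g) := fun l hl => by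
  rw [map_sub, hf l hl, hg l hl, sub_zero]

theorem SuppBelow.wedge {k : ℕ} {a : Fin n} (hf : SuppBelow k f) (ha : (a : ℕ) < k) :
    SuppBelow k (wedge a f) := fun l hl => by
  rw [contr_wedge_of_ne f (by rintro rfl; omega), hf l hl, map_zero, neg_zero]

theorem SuppBelow.seqD {k : ℕ} (hf : SuppBelow k f) : SuppBelow k (seqD y f) :=
  fun l hl => by rw [← neg_eq_zero, ← seqD_contr, hf l hl, map_zero]

theorem suppBelow_top : SuppBelow n f := fun l hl => absurd l.isLt (by omega)

/-- `contr k ∘ wedge k` is the projection to the chains not involving the index `k`. -/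
theorem SuppBelow.contr_wedge {k : Fin n} (hf : SuppBelow (k + 1) f) :
    SuppBelow k (CompLinear.contr k (CompLinear.wedge k f)) := fun l hl => by
  rcases eq_or_ne l k with rfl | h
  · exact contr_contr_self _ _
  · rw [contr_contr, contr_wedge_of_ne f h, hf l, map_zero, neg_zero, map_zero, neg_zero]
    have : (l : ℕ) ≠ k := fun h' => h (Fin.ext h')
    omega

end

/-! ### Homogeneous ideals and the ideals generated by the last variables -/

theorem homogeneousComponent_mem {A : Ideal (MvPolynomial (Fin n) K)}
    (hA : A.IsHomogeneous (homogeneousSubmodule (Fin n) K)) {f : MvPolynomial (Fin n) K}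
    (hf : f ∈ A) (e : ℕ) : homogeneousComponent e f ∈ A := by
  have := hA e hf
  rwa [← decomposition.decompose'_apply]

theorem isHomogeneous_of_components {A : Ideal (MvPolynomial (Fin n) K)}
    (h : ∀ f ∈ A, ∀ e, homogeneousComponent e f ∈ A) :
    A.IsHomogeneous (homogeneousSubmodule (Fin n) K) := by
  intro e f hf
  have := h f hf e
  rwa [← decomposition.decompose'_apply] at this

theorem homogeneousComponent_self {f : MvPolynomial (Fin n) K} {e : ℕ} (hf : f.IsHomogeneous e) :
    homogeneousComponent e f = f := by
  rw [homogeneousComponent_of_mem hf, if_pos rfl]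

/-- The ideal generated by the variables of index at least `k`. -/
def varsFrom (K : Type*) [Field K] (n k : ℕ) : Ideal (MvPolynomial (Fin n) K) :=
  Ideal.span (X '' {l : Fin n | k ≤ l})

theorem mem_varsFrom {k : ℕ} {f : MvPolynomial (Fin n) K} :
    f ∈ varsFrom K n k ↔ ∀ v ∈ f.support, ∃ l : Fin n, k ≤ l ∧ v l ≠ 0 :=
  mem_ideal_span_X_image

theorem X_mem_varsFrom {k : ℕ} {l : Fin n} (h : k ≤ l) : (X l : MvPolynomial (Fin n) K) ∈
    varsFrom K n k :=
  Ideal.subset_span ⟨l, h, rfl⟩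

theorem varsFrom_top : varsFrom K n n = ⊥ := by
  rw [varsFrom, show {l : Fin n | n ≤ l} = ∅ from by
    ext l; simp, Set.image_empty, Ideal.span_empty]

theorem varsFrom_succ (k : Fin n) :
    varsFrom K n k = varsFrom K n (k + 1) ⊔ Ideal.span {X k} := by
  rw [varsFrom, varsFrom, ← Ideal.span_union, ← Set.image_singleton, ← Set.image_union]
  congr 2
  ext l
  simp only [Set.mem_ofPred_eq, Set.mem_union, Set.mem_singleton_iff, Fin.ext_iff]
  omega

theorem isHomogeneous_varsFrom (k : ℕ) :
    (varsFrom K n k).IsHomogeneous (homogeneousSubmodule (Fin n) K) := by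
  refine Ideal.homogeneous_span _ _ ?_
  rintro _ ⟨l, -, rfl⟩
  exact ⟨1, isHomogeneous_X K l⟩

theorem isHomogeneous_sup_varsFrom {A : Ideal (MvPolynomial (Fin n) K)}
    (hA : A.IsHomogeneous (homogeneousSubmodule (Fin n) K)) (k : ℕ) :
    (A ⊔ varsFrom K n k).IsHomogeneous (homogeneousSubmodule (Fin n) K) :=
  hA.sup (isHomogeneous_varsFrom k)

theorem homogeneousComponent_X_mul (k : Fin n) (q : MvPolynomial (Fin n) K) (e : ℕ) :
    homogeneousComponent (e + 1) (X k * q) = X k * homogeneousComponent e q := by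
  ext v
  rw [coeff_homogeneousComponent, mul_comm (X k), mul_comm (X k), coeff_mul_X', coeff_mul_X',
    coeff_homogeneousComponent]
  by_cases hk : k ∈ v.support
  · simp only [if_pos hk]
    have h1 : (v - Finsupp.single k 1) + Finsupp.single k 1 = v := by
      refine tsub_add_cancel_of_le ?_
      rw [Finsupp.single_le_iff]
      exact Nat.one_le_iff_ne_zero.2 (Finsupp.mem_support_iff.1 hk)
    have h2 : v.degree = (v - Finsupp.single k 1).degree + 1 := by
      conv_lhs => rw [← h1]
      simp
    rw [h2]
    simp
  · simp [hk]

theorem homogeneousComponent_zero_X_mul (k : Fin n) (q : MvPolynomial (Fin n) K) :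
    homogeneousComponent 0 (X k * q) = 0 := by
  rw [homogeneousComponent_zero, mul_comm, coeff_mul_X', if_neg (by simp), C_0]

/-- A homogeneous element of `A + (x_k)` is of the form `a + x_k q` with `a`, `q` homogeneous. -/
theorem exists_homogeneous_sub_mem {A : Ideal (MvPolynomial (Fin n) K)}
    (hA : A.IsHomogeneous (homogeneousSubmodule (Fin n) K)) {k : Fin n} {e : ℕ}
    {p : MvPolynomial (Fin n) K} (hp : p.IsHomogeneous e) (hpA : p ∈ A ⊔ Ideal.span {X k}) :
    ∃ q : MvPolynomial (Fin n) K, p - X k * q ∈ A ∧ q.IsHomogeneous (e - 1) ∧ (e = 0 → q = 0) := by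
  obtain ⟨a, ha, b, hb, rfl⟩ := Submodule.mem_sup.1 hpA
  obtain ⟨c, rfl⟩ := Ideal.mem_span_singleton'.1 hb
  have h1 := homogeneousComponent_self hp
  rw [map_add, mul_comm] at h1
  rcases e with _ | e
  · refine ⟨0, ?_, isHomogeneous_zero _ _ _, fun _ => rfl⟩
    rw [mul_comm c, ← h1, homogeneousComponent_zero_X_mul, add_zero, mul_zero, sub_zero]
    exact homogeneousComponent_mem hA ha 0
  · refine ⟨homogeneousComponent e c, ?_, homogeneousComponent_isHomogeneous _ _, by omega⟩
    rw [mul_comm c, ← h1, homogeneousComponent_X_mul, add_sub_cancel_right]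
    exact homogeneousComponent_mem hA ha _

open Classical in
/-- The version of `exists_homogeneous_sub_mem` for chains. -/
theorem exists_chain_sub_mem {A : Ideal (MvPolynomial (Fin n) K)}
    (hA : A.IsHomogeneous (homogeneousSubmodule (Fin n) K)) {k : Fin n} {i j m : ℕ}
    {f : Finset (Fin n) → MvPolynomial (Fin n) K} (hf : f ∈ koszulChains ⊤ i (j + 1))
    (hfA : f ∈ coeffIn (A ⊔ Ideal.span {X k})) (hm : SuppBelow m f) :
    ∃ q ∈ koszulChains (⊤ : Ideal (MvPolynomial (Fin n) K)) i j, SuppBelow m q ∧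
      f - (X k : MvPolynomial (Fin n) K) • q ∈ coeffIn A := by
  obtain ⟨h1, -, h3⟩ := (mem_koszulChains f).1 hf
  choose q hq1 hq2 hq3 using fun σ => exists_homogeneous_sub_mem hA (h3 σ) (mem_coeffIn.1 hfA σ)
  refine ⟨fun σ => if f σ = 0 then 0 else q σ, ?_, ?_, ?_⟩
  · refine (mem_koszulChains _).2 ⟨fun σ hσ => ?_, fun _ => trivial, fun σ => ?_⟩
    · split_ifs at hσ with h
      · exact absurd rfl hσ
      · have := h1 σ h
        refine ⟨this.1, ?_⟩
        by_contra hij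
        exact hσ (hq3 σ (by omega))
    · split_ifs with h
      · exact isHomogeneous_zero _ _ _
      · have := hq2 σ
        rwa [show j + 1 - i - 1 = j - i by omega] at this
  · rw [suppBelow_iff] at hm ⊢
    intro σ l hl hml
    simp [hm σ l hl hml]
  · refine mem_coeffIn.2 fun σ => ?_
    change f σ - X k * (if f σ = 0 then 0 else q σ) ∈ A
    split_ifs with h
    · simp [h]
    · exact hq1 σ

/-! ### Regularity through Koszul homology -/

/-- The Koszul homology `H_i(y₀, …, y_{k-1}; S/A)` vanishes in coefficient degrees `≥ d` (apart
from `H_0` in degree `0`). For `y = x` and `x_k, …, x_{n-1} ∈ A` this says that the regularity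
of `S/A` is less than `d`, if `d ≥ 1`. -/
def KoszulAcyclic (y : Fin n → MvPolynomial (Fin n) K) (A : Ideal (MvPolynomial (Fin n) K))
    (k d : ℕ) : Prop :=
  ∀ i j, i + d ≤ j → 1 ≤ j → ∀ f ∈ koszulChains (⊤ : Ideal (MvPolynomial (Fin n) K)) i j,
    SuppBelow k f → seqD y f ∈ coeffIn A →
      ∃ h ∈ koszulChains (⊤ : Ideal (MvPolynomial (Fin n) K)) (i + 1) j,
        SuppBelow k h ∧ f - seqD y h ∈ coeffIn A

/-- Multiplication by `x_k` on `S/A` is injective in degrees `≥ d`. -/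
def InjAt (A : Ideal (MvPolynomial (Fin n) K)) (k : Fin n) (d : ℕ) : Prop :=
  ∀ e, d ≤ e → ∀ h : MvPolynomial (Fin n) K, h.IsHomogeneous e → X k * h ∈ A → h ∈ A

theorem contr_wedge_of_contr_eq_zero {f : Finset (Fin n) → MvPolynomial (Fin n) K} {k : Fin n}
    (hf : contr k f = 0) : contr k (wedge k f) = f := by
  have := wedge_contr_self f k
  rwa [hf, map_zero, zero_add] at this

theorem contr_wedge_seqD (f : Finset (Fin n) → MvPolynomial (Fin n) K)
    (y : Fin n → MvPolynomial (Fin n) K) (k : Fin n) :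
    contr k (wedge k (seqD y f)) = y k • contr k f + seqD y (contr k (wedge k f)) := by
  have h1 : wedge k (seqD y f) = y k • f - seqD y (wedge k f) := by
    rw [seqD_wedge, sub_sub_cancel]
  rw [h1, map_sub, map_smul, seqD_contr, sub_eq_add_neg]

theorem InjAt.mem_coeffIn {A : Ideal (MvPolynomial (Fin n) K)} {k : Fin n} {d i j : ℕ}
    (hA : InjAt A k d) (hij : i + d ≤ j) {f : Finset (Fin n) → MvPolynomial (Fin n) K}
    (hf : f ∈ koszulChains ⊤ i j) (h : (X k : MvPolynomial (Fin n) K) • f ∈ coeffIn A) :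
    f ∈ coeffIn A :=
  CompLinear.mem_coeffIn.2 fun σ => hA (j - i) (by omega) _ (((mem_koszulChains f).1 hf).2.2 σ)
    (CompLinear.mem_coeffIn.1 h σ)

theorem isHomogeneous_X_one (k : Fin n) : (X k : MvPolynomial (Fin n) K).IsHomogeneous 1 :=
  isHomogeneous_X K k

theorem sub_seqD_mem_koszulChains {A : Ideal (MvPolynomial (Fin n) K)} {i j : ℕ}
    {f h : Finset (Fin n) → MvPolynomial (Fin n) K}
    (hf : f ∈ koszulChains A i j) (hh : h ∈ koszulChains A (i + 1) j) :
    f - seqD X h ∈ koszulChains A i j :=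
  Submodule.sub_mem _ hf (seqD_mem_koszulChains isHomogeneous_X_one hh)

/-- Acyclicity passes to the quotient by the last variable, if this variable acts injectively in
the relevant degrees. -/
theorem KoszulAcyclic.restrict {A : Ideal (MvPolynomial (Fin n) K)}
    (hA : A.IsHomogeneous (homogeneousSubmodule (Fin n) K)) {k : Fin n} {d : ℕ}
    (hac : KoszulAcyclic X A (k + 1) d) (hinj : InjAt A k d) :
    KoszulAcyclic X (A ⊔ Ideal.span {X k}) k d := by
  rintro i j hij hj f hf hfk hDf
  -- Modulo `A`, `∂ f = x_k q` for a cycle `q`, so that `f - e_k ∧ q` is a cycle.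
  obtain ⟨q, hqk, hq1, hq2, hq3⟩ : ∃ q, SuppBelow k q ∧
      seqD X f - (X k : MvPolynomial (Fin n) K) • q ∈ coeffIn A ∧
      wedge k q ∈ koszulChains (⊤ : Ideal (MvPolynomial (Fin n) K)) i j ∧
      seqD X q ∈ coeffIn A := by
    rcases i with _ | i
    · refine ⟨0, fun l _ => map_zero _, ?_, ?_, ?_⟩
      · rw [seqD_eq_zero_of_mem_koszulChains_zero hf, smul_zero, sub_zero]
        exact Submodule.zero_mem _
      · rw [map_zero]; exact Submodule.zero_mem _
      · rw [map_zero]; exact Submodule.zero_mem _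
    · obtain ⟨j, rfl⟩ : ∃ j', j = j' + 1 := ⟨j - 1, by omega⟩
      obtain ⟨q, hq, hqk, hqA⟩ := exists_chain_sub_mem hA
        (seqD_mem_koszulChains isHomogeneous_X_one hf) hDf hfk.seqD
      refine ⟨q, hqk, hqA, wedge_mem_koszulChains k hq, ?_⟩
      have h1 : (X k : MvPolynomial (Fin n) K) • seqD X q ∈ coeffIn A := by
        have := seqD_mem_coeffIn (y := X) hqA
        rwa [map_sub, seqD_seqD, zero_sub, map_smul, neg_mem_iff] at this
      rcases i with _ | i
      · rw [seqD_eq_zero_of_mem_koszulChains_zero hq]; exact Submodule.zero_mem _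
      · exact hinj.mem_coeffIn (by omega) (seqD_mem_koszulChains isHomogeneous_X_one hq) h1
  obtain ⟨G, hG, hGk, hFG⟩ := hac i j hij hj (f - wedge k q) (Submodule.sub_mem _ hf hq2)
    ((hfk.mono (Nat.le_succ _)).sub ((hqk.mono (Nat.le_succ _)).wedge (Nat.lt_succ_self _))) (by
      rw [map_sub, seqD_wedge, ← sub_add]
      exact Submodule.add_mem _ hq1 (wedge_mem_coeffIn k hq3))
  obtain ⟨j, rfl⟩ : ∃ j', j = j' + 1 := ⟨j - 1, by omega⟩
  -- The part of `G` not involving `e_k` has the boundary `f` modulo `A + (x_k)`.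
  refine ⟨contr k (wedge k G), contr_mem_koszulChains k (wedge_mem_koszulChains k hG),
    hGk.contr_wedge, ?_⟩
  have h1 := contr_mem_coeffIn k (wedge_mem_coeffIn k hFG)
  rw [map_sub, map_sub, map_sub, map_sub, wedge_wedge_self, map_zero, sub_zero,
    contr_wedge_of_contr_eq_zero (hfk k le_rfl), contr_wedge_seqD] at h1
  have h2 : f - seqD X (contr k (wedge k G)) =
      (f - ((X k : MvPolynomial (Fin n) K) • contr k G + seqD X (contr k (wedge k G)))) +
        (X k : MvPolynomial (Fin n) K) • contr k G := by abel
  rw [h2]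
  refine Submodule.add_mem _ (coeffIn_mono le_sup_left h1) (mem_coeffIn.2 fun σ => ?_)
  exact Ideal.mul_mem_right _ _ (Ideal.mem_sup_right (Ideal.mem_span_singleton_self _))

/-- The converse of `KoszulAcyclic.restrict`. -/
theorem KoszulAcyclic.extend {A : Ideal (MvPolynomial (Fin n) K)}
    (hA : A.IsHomogeneous (homogeneousSubmodule (Fin n) K)) {k : Fin n} {d : ℕ}
    (hac : KoszulAcyclic X (A ⊔ Ideal.span {X k}) k d) (hinj : InjAt A k d) :
    KoszulAcyclic X A (k + 1) d := by
  rintro i j hij hj f hf hfk hDf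
  obtain ⟨j, rfl⟩ : ∃ j', j = j' + 1 := ⟨j - 1, by omega⟩
  have hXA : ∀ g : Finset (Fin n) → MvPolynomial (Fin n) K,
      (X k : MvPolynomial (Fin n) K) • g ∈ coeffIn (A ⊔ Ideal.span {X k}) := fun g =>
    mem_coeffIn.2 fun σ =>
      Ideal.mul_mem_right _ _ (Ideal.mem_sup_right (Ideal.mem_span_singleton_self _))
  -- The part of `f` not involving `e_k` is `∂ G + x_k q` modulo `A`.
  have hpf := contr_mem_koszulChains k (wedge_mem_koszulChains k hf)
  obtain ⟨G, hG, hGk, hr⟩ := hac i (j + 1) hij hj (contr k (wedge k f)) hpf hfk.contr_wedge (by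
    rw [← add_sub_cancel_left ((X k : MvPolynomial (Fin n) K) • contr k f) (seqD X _),
      ← contr_wedge_seqD]
    exact Submodule.sub_mem _ (coeffIn_mono le_sup_left
      (contr_mem_coeffIn k (wedge_mem_coeffIn k hDf))) (hXA _))
  obtain ⟨q, hq, hqk, hqA⟩ := exists_chain_sub_mem hA (sub_seqD_mem_koszulChains hpf hG) hr
    (hfk.contr_wedge.sub hGk.seqD)
  have hH : G + wedge k q ∈ koszulChains (⊤ : Ideal (MvPolynomial (Fin n) K)) (i + 1) (j + 1) :=
    Submodule.add_mem _ hG (wedge_mem_koszulChains k hq)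
  refine ⟨G + wedge k q, hH, (hGk.mono (Nat.le_succ _)).add
    ((hqk.mono (Nat.le_succ _)).wedge (Nat.lt_succ_self _)), ?_⟩
  -- Modulo `A`, the corrected cycle has no part free of `e_k`, so `x_k` annihilates the rest of it.
  set f' := f - seqD X (G + wedge k q) with hf'
  have h1 : contr k (wedge k f') ∈ coeffIn A := by
    rw [hf', map_add, seqD_wedge, map_sub, map_sub, map_add, map_add, contr_wedge_seqD,
      hGk k le_rfl, smul_zero, zero_add, contr_wedge_of_contr_eq_zero (hGk k le_rfl),
      map_sub, map_sub, wedge_wedge_self, map_zero, sub_zero, map_smul, map_smul,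
      contr_wedge_of_contr_eq_zero (hqk k le_rfl), ← sub_sub]
    exact hqA
  have h2 : seqD X f' ∈ coeffIn A := by
    rw [hf', map_sub, seqD_seqD, sub_zero]
    exact hDf
  have h3 : contr k f' ∈ coeffIn A := by
    have hf'' := sub_seqD_mem_koszulChains hf hH
    rcases i with _ | i
    · rw [contr_eq_zero_of_mem_koszulChains_zero k hf'']
      exact Submodule.zero_mem _
    · refine hinj.mem_coeffIn (by omega) (contr_mem_koszulChains k hf'') ?_
      have := contr_wedge_seqD f' X k
      rw [eq_comm, ← eq_sub_iff_add_eq] at this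
      rw [this]
      exact Submodule.sub_mem _ (contr_mem_coeffIn k (wedge_mem_coeffIn k h2))
        (seqD_mem_coeffIn h1)
  rw [← wedge_contr_self f' k]
  exact Submodule.add_mem _ (wedge_mem_coeffIn k h3) h1

/-- With no variable left, the only homology is `H_0` in degree `0`. -/
theorem koszulAcyclic_zero {A : Ideal (MvPolynomial (Fin n) K)} (hA : varsFrom K n 0 ≤ A) (d : ℕ) :
    KoszulAcyclic X A 0 d := by
  rintro i j hij hj f hf hf0 -
  refine ⟨0, Submodule.zero_mem _, fun l _ => map_zero _, ?_⟩
  rw [map_zero, sub_zero]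
  refine mem_coeffIn.2 fun σ => hA ?_
  rcases σ.eq_empty_or_nonempty with rfl | ⟨l, hl⟩
  · obtain ⟨h1, -, h3⟩ := (mem_koszulChains f).1 hf
    refine mem_varsFrom.2 fun v hv => ?_
    by_contra! h
    have hv0 : v = 0 := by ext l; exact h l (Nat.zero_le _)
    have := h3 ∅ (mem_support_iff.1 hv)
    have h4 := h1 ∅ (by rintro h0; simp [h0] at hv)
    simp [hv0, Finsupp.weight_apply] at this h4
    omega
  · rw [suppBelow_iff.1 hf0 σ l hl (Nat.zero_le _)]
    exact Ideal.zero_mem _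

/-- If each variable `x_k` acts injectively on `S/(A + (x_{k+1}, …, x_{n-1}))` in degrees `≥ d`,
then the Koszul homology of `S/A` vanishes in degrees `≥ d`. -/
theorem koszulAcyclic_of_injAt {A : Ideal (MvPolynomial (Fin n) K)}
    (hA : A.IsHomogeneous (homogeneousSubmodule (Fin n) K)) {d : ℕ}
    (hinj : ∀ k : Fin n, InjAt (A ⊔ varsFrom K n (k + 1)) k d) : KoszulAcyclic X A n d := by
  have key : ∀ k ≤ n, KoszulAcyclic X (A ⊔ varsFrom K n k) k d := by
    intro k
    induction k with
    | zero => exact fun _ => koszulAcyclic_zero le_sup_right d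
    | succ k ih =>
      intro hk
      have h1 := ih (by omega)
      have h2 := varsFrom_succ (K := K) (⟨k, hk⟩ : Fin n)
      simp only at h2
      rw [h2, ← sup_assoc] at h1
      exact h1.extend (k := ⟨k, hk⟩) (isHomogeneous_sup_varsFrom hA _) (hinj ⟨k, hk⟩)
  have := key n le_rfl
  rwa [varsFrom_top, sup_bot_eq] at this

/-- The converse of `koszulAcyclic_of_injAt`, one variable at a time: as long as the variables from
the last one down to `x_m` act injectively, acyclicity passes to the quotient by them. -/
theorem KoszulAcyclic.restrict_of_injAt {A : Ideal (MvPolynomial (Fin n) K)}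
    (hA : A.IsHomogeneous (homogeneousSubmodule (Fin n) K)) {d m : ℕ} (hm : m ≤ n)
    (hac : KoszulAcyclic X A n d)
    (hinj : ∀ k : Fin n, m ≤ k → InjAt (A ⊔ varsFrom K n (k + 1)) k d) :
    KoszulAcyclic X (A ⊔ varsFrom K n m) m d := by
  induction hm using Nat.decreasingInduction with
  | self => rwa [varsFrom_top, sup_bot_eq]
  | of_succ m hm ih =>
    have h1 := ih fun k hk => hinj k (by omega)
    have h2 := varsFrom_succ (K := K) (⟨m, hm⟩ : Fin n)
    simp only at h2
    rw [h2, ← sup_assoc]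
    exact KoszulAcyclic.restrict (k := ⟨m, hm⟩) (isHomogeneous_sup_varsFrom hA _) h1
      (hinj ⟨m, hm⟩ le_rfl)

theorem coeff_X_mul_add (k : Fin n) (h : MvPolynomial (Fin n) K) (v : Fin n →₀ ℕ) :
    coeff (v + Finsupp.single k 1) (X k * h) = coeff v h := by
  rw [mul_comm, coeff_mul_X]

/-- The Koszul complex of the variables is exact in positive degrees. -/
theorem koszulAcyclic_bot : KoszulAcyclic X (⊥ : Ideal (MvPolynomial (Fin n) K)) n 0 := by
  refine koszulAcyclic_of_injAt (Ideal.IsHomogeneous.bot _) fun k e _ h _ hk => ?_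
  rw [bot_sup_eq] at hk ⊢
  refine mem_varsFrom.2 fun v hv => ?_
  obtain ⟨l, hl, hvl⟩ := mem_varsFrom.1 hk (v + Finsupp.single k 1) (by
    rwa [mem_support_iff, coeff_X_mul_add, ← mem_support_iff])
  refine ⟨l, hl, ?_⟩
  have : k ≠ l := by rintro rfl; omega
  simpa [Finsupp.single_apply, this] using hvl

/-! ### Linear changes of coordinates -/

theorem linSubst_X (g : Matrix (Fin n) (Fin n) K) (j : Fin n) :
    linSubst g (X j) = ∑ i, C (g i j) * X i := by
  simp [linSubst]

theorem linSubst_mul (g h : Matrix (Fin n) (Fin n) K) :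
    linSubst (g * h) = (linSubst g).comp (linSubst h) := by
  refine MvPolynomial.algHom_ext fun j => ?_
  rw [AlgHom.comp_apply, linSubst_X, linSubst_X, map_sum]
  simp only [map_mul, linSubst_X, Matrix.mul_apply, map_sum, Finset.sum_mul, Finset.mul_sum,
    ← algebraMap_eq, AlgHom.commutes]
  rw [Finset.sum_comm]
  exact Finset.sum_congr rfl fun i _ => Finset.sum_congr rfl fun l _ => by ring

theorem linSubst_one : linSubst (1 : Matrix (Fin n) (Fin n) K) = AlgHom.id K _ := by
  refine MvPolynomial.algHom_ext fun j => ?_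
  rw [linSubst_X, Finset.sum_eq_single j]
  · simp
  · intro i _ hi; simp [hi]
  · simp

theorem linSubst_linSubst {g h : Matrix (Fin n) (Fin n) K} (hgh : g * h = 1)
    (f : MvPolynomial (Fin n) K) : linSubst g (linSubst h f) = f := by
  rw [← AlgHom.comp_apply, ← linSubst_mul, hgh, linSubst_one, AlgHom.id_apply]

theorem IsHomogeneous.linSubst {f : MvPolynomial (Fin n) K} {e : ℕ} (hf : f.IsHomogeneous e)
    (g : Matrix (Fin n) (Fin n) K) : (linSubst g f).IsHomogeneous e := by
  have := hf.aeval (fun j => ∑ i, C (g i j) * X i) (n := 1) fun j =>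
    IsHomogeneous.sum _ _ _ fun i _ => by
      simpa using (isHomogeneous_C (Fin n) (g i j)).mul (isHomogeneous_X K i)
  rwa [one_mul] at this

theorem homogeneousComponent_linSubst (f : MvPolynomial (Fin n) K) (e : ℕ)
    (g : Matrix (Fin n) (Fin n) K) :
    homogeneousComponent e (linSubst g f) = linSubst g (homogeneousComponent e f) := by
  conv_lhs => rw [← sum_homogeneousComponent f, map_sum, map_sum]
  have h : ∀ i, homogeneousComponent e (linSubst g (homogeneousComponent i f)) =
      if i = e then linSubst g (homogeneousComponent i f) else 0 := fun i => by
    rw [homogeneousComponent_of_mem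
      (IsHomogeneous.linSubst (homogeneousComponent_isHomogeneous i f) g)]
    simp [eq_comm]
  simp only [h, Finset.sum_ite_eq', Finset.mem_range]
  split_ifs with he
  · rfl
  · rw [homogeneousComponent_eq_zero _ _ (by omega), map_zero]

theorem mem_map_linSubst {g h : Matrix (Fin n) (Fin n) K} (hgh : g * h = 1)
    {A : Ideal (MvPolynomial (Fin n) K)} {f : MvPolynomial (Fin n) K} :
    f ∈ A.map (linSubst g) ↔ linSubst h f ∈ A := by
  constructor
  · intro hf
    have h2 : (A.map (linSubst g)) ≤ A.comap (linSubst h) := by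
      refine Ideal.map_le_iff_le_comap.2 fun a ha => ?_
      rw [Ideal.mem_comap, Ideal.mem_comap, linSubst_linSubst (mul_eq_one_comm.1 hgh)]
      exact ha
    exact h2 hf
  · intro hf
    rw [← linSubst_linSubst hgh f]
    exact Ideal.mem_map_of_mem _ hf

theorem map_linSubst_mul (g h : Matrix (Fin n) (Fin n) K) (A : Ideal (MvPolynomial (Fin n) K)) :
    A.map (linSubst (g * h)) = (A.map (linSubst h)).map (linSubst g) := by
  rw [linSubst_mul, Ideal.map_mapₐ]

theorem isHomogeneous_map_linSubst {A : Ideal (MvPolynomial (Fin n) K)}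
    (hA : A.IsHomogeneous (homogeneousSubmodule (Fin n) K)) {g h : Matrix (Fin n) (Fin n) K}
    (hgh : g * h = 1) :
    (A.map (linSubst g)).IsHomogeneous (homogeneousSubmodule (Fin n) K) := by
  refine isHomogeneous_of_components fun f hf e => ?_
  rw [mem_map_linSubst hgh] at hf ⊢
  rw [← homogeneousComponent_linSubst]
  exact homogeneousComponent_mem hA hf e

/-! ### Invariance of Koszul acyclicity under linear changes of coordinates -/

/-- Coordinatewise application of a linear substitution to a chain. -/
def mapChain (g : Matrix (Fin n) (Fin n) K) (f : Finset (Fin n) → MvPolynomial (Fin n) K) :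
    Finset (Fin n) → MvPolynomial (Fin n) K :=
  fun σ => linSubst g (f σ)

theorem mapChain_contr (g : Matrix (Fin n) (Fin n) K) (k : Fin n)
    (f : Finset (Fin n) → MvPolynomial (Fin n) K) :
    mapChain g (contr k f) = contr k (mapChain g f) := by
  funext σ
  rw [mapChain, contr_apply, contr_apply]
  split_ifs
  · simp
  · simp [koszulSign, mapChain]

theorem mapChain_seqD (g : Matrix (Fin n) (Fin n) K) (y : Fin n → MvPolynomial (Fin n) K)
    (f : Finset (Fin n) → MvPolynomial (Fin n) K) :
    mapChain g (seqD y f) = seqD (fun k => linSubst g (y k)) (mapChain g f) := by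
  rw [seqD_apply, seqD_apply]
  simp only [← mapChain_contr]
  funext σ
  simp [mapChain, Finset.sum_apply]

theorem mapChain_mem_koszulChains (g : Matrix (Fin n) (Fin n) K)
    {f : Finset (Fin n) → MvPolynomial (Fin n) K} {i j : ℕ} (hf : f ∈ koszulChains ⊤ i j) :
    mapChain g f ∈ koszulChains (⊤ : Ideal (MvPolynomial (Fin n) K)) i j := by
  obtain ⟨h1, -, h3⟩ := (mem_koszulChains f).1 hf
  exact (mem_koszulChains _).2 ⟨fun σ hσ => h1 σ fun h => hσ (by rw [mapChain, h, map_zero]),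
    fun _ => trivial, fun σ => IsHomogeneous.linSubst (h3 σ) g⟩

/-- `T` takes chains to chains of the same degree, with coefficients in the same ideals. -/
def PreservesChains (T : (Finset (Fin n) → MvPolynomial (Fin n) K) →ₗ[MvPolynomial (Fin n) K]
    (Finset (Fin n) → MvPolynomial (Fin n) K)) : Prop :=
  (∀ i j, ∀ f ∈ koszulChains (⊤ : Ideal (MvPolynomial (Fin n) K)) i j, T f ∈ koszulChains ⊤ i j) ∧
    ∀ A : Ideal (MvPolynomial (Fin n) K), ∀ f ∈ coeffIn A, T f ∈ coeffIn A

/-- If the Koszul complexes of the variables and of their images under `g` are isomorphic through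
`T` and `T'`, then Koszul acyclicity passes from `A` to `g A`. -/
theorem koszulAcyclic_map_of_intertwine {g h : Matrix (Fin n) (Fin n) K} (hgh : g * h = 1)
    {T T' : (Finset (Fin n) → MvPolynomial (Fin n) K) →ₗ[MvPolynomial (Fin n) K]
      (Finset (Fin n) → MvPolynomial (Fin n) K)} (hP : PreservesChains T)
    (hP' : PreservesChains T') (hTT' : ∀ f, T (T' f) = f)
    (hT : ∀ f, seqD X (T f) = T (seqD (fun k => linSubst g (X k)) f))
    (hT' : ∀ f, seqD (fun k => linSubst g (X k)) (T' f) = T' (seqD X f))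
    {A : Ideal (MvPolynomial (Fin n) K)} {d : ℕ} (hac : KoszulAcyclic X A n d) :
    KoszulAcyclic X (A.map (linSubst g)) n d := by
  rintro i j hij hj f hf - hDf
  have hhg := mul_eq_one_comm.1 hgh
  have hinv : ∀ f, mapChain g (mapChain h f) = f := fun f => by
    funext σ; exact linSubst_linSubst hgh _
  obtain ⟨H, hH, -, hfH⟩ := hac i j hij hj (mapChain h (T' f))
    (mapChain_mem_koszulChains h (hP'.1 i j f hf)) suppBelow_top (by
      refine mem_coeffIn.2 fun σ => ?_
      have h1 := mem_coeffIn.1 (hP'.2 _ _ hDf) σ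
      rw [← hT', mem_map_linSubst hgh] at h1
      have h2 : mapChain h (seqD (fun k => linSubst g (X k)) (T' f)) =
          seqD X (mapChain h (T' f)) := by
        rw [mapChain_seqD]
        simp only [linSubst_linSubst hhg]
      rw [← h2]
      exact h1)
  refine ⟨T (mapChain g H), hP.1 _ _ _ (mapChain_mem_koszulChains g hH), suppBelow_top, ?_⟩
  have h3 : f - seqD X (T (mapChain g H)) =
      T (mapChain g (mapChain h (T' f) - seqD X H)) := by
    have h4 : mapChain g (mapChain h (T' f) - seqD X H) =
        mapChain g (mapChain h (T' f)) - mapChain g (seqD X H) := by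
      funext σ; simp [mapChain]
    rw [h4, hinv, map_sub, hTT', hT, mapChain_seqD]
  rw [h3]
  exact hP.2 _ _ (mem_coeffIn.2 fun σ => Ideal.mem_map_of_mem _ (mem_coeffIn.1 hfH σ))

theorem C_smul_chain (c : K) (f : Finset (Fin n) → MvPolynomial (Fin n) K) :
    (C c : MvPolynomial (Fin n) K) • f = c • f := by
  funext σ
  simp [smul_eq_C_mul]

/-- The chain automorphism `e_b ↦ e_b + c e_a`. -/
def transvChain (a b : Fin n) (c : K) :
    (Finset (Fin n) → MvPolynomial (Fin n) K) →ₗ[MvPolynomial (Fin n) K]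
      (Finset (Fin n) → MvPolynomial (Fin n) K) :=
  LinearMap.id + (C c : MvPolynomial (Fin n) K) • (wedge a ∘ₗ contr b)

theorem transvChain_apply (a b : Fin n) (c : K) (f : Finset (Fin n) → MvPolynomial (Fin n) K) :
    transvChain a b c f = f + (C c : MvPolynomial (Fin n) K) • wedge a (contr b f) := rfl

theorem preservesChains_transvChain (a b : Fin n) (c : K) :
    PreservesChains (transvChain a b c) := by
  refine ⟨fun i j f hf => ?_, fun A f hf => ?_⟩
  · refine Submodule.add_mem _ hf ?_
    change (C c : MvPolynomial (Fin n) K) • wedge a (contr b f) ∈ _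
    rw [C_smul_chain]
    refine Submodule.smul_mem _ _ ?_
    rcases i with _ | i
    · rw [contr_eq_zero_of_mem_koszulChains_zero b hf, map_zero]; exact Submodule.zero_mem _
    · rcases j with _ | j
      · rw [koszulChains_zero_of_lt (by omega) hf, map_zero, map_zero]; exact Submodule.zero_mem _
      · exact wedge_mem_koszulChains a (contr_mem_koszulChains b hf)
  · exact Submodule.add_mem _ hf
      (Submodule.smul_mem _ _ (wedge_mem_coeffIn a (contr_mem_coeffIn b hf)))

theorem transvChain_neg {a b : Fin n} (hab : a ≠ b) (c : K)
    (f : Finset (Fin n) → MvPolynomial (Fin n) K) :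
    transvChain a b c (transvChain a b (-c) f) = f := by
  simp only [transvChain_apply, map_add, map_smul]
  rw [contr_wedge_of_ne (contr b f) hab.symm, contr_contr_self]
  simp

theorem seqD_transvChain (a b : Fin n) (c : K) (z : Fin n → MvPolynomial (Fin n) K)
    (f : Finset (Fin n) → MvPolynomial (Fin n) K) :
    seqD z (transvChain a b c f) =
      transvChain a b c (seqD z f + (C c * z a) • contr b f) := by
  simp only [transvChain_apply, map_add, map_smul, contr_contr_self]
  rw [seqD_wedge, seqD_contr, map_neg, mul_smul]
  simp only [map_zero, smul_zero, add_zero, smul_sub, smul_neg]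
  abel

theorem seqD_eq_add_of_ne (y z : Fin n → MvPolynomial (Fin n) K) (b : Fin n)
    (h : ∀ k, k ≠ b → y k = z k) (f : Finset (Fin n) → MvPolynomial (Fin n) K) :
    seqD y f = seqD z f + (y b - z b) • contr b f := by
  rw [seqD_apply, seqD_apply, ← sub_eq_iff_eq_add', ← Finset.sum_sub_distrib,
    Finset.sum_eq_single b]
  · rw [sub_smul]
  · intro k _ hk; rw [h k hk, sub_self]
  · simp

theorem linSubst_transvection_X (a b : Fin n) (c : K) (k : Fin n) :
    linSubst (Matrix.transvection a b c) (X k) = X k + if k = b then C c * X a else 0 := by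
  rw [linSubst_X]
  simp only [Matrix.transvection, Matrix.add_apply, C_add, add_mul, Finset.sum_add_distrib]
  congr 1
  · have := linSubst_X (1 : Matrix (Fin n) (Fin n) K) k
    rw [linSubst_one] at this
    exact this.symm
  · rw [Finset.sum_eq_single a]
    · simp only [Matrix.single_apply, true_and, eq_comm (a := b)]
      split_ifs <;> simp
    · intro i _ hi
      simp [hi.symm]
    · simp

theorem koszulAcyclic_map_transvection {a b : Fin n} (hab : a ≠ b) (c : K)
    {A : Ideal (MvPolynomial (Fin n) K)} {d : ℕ} (hac : KoszulAcyclic X A n d) :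
    KoszulAcyclic X (A.map (linSubst (Matrix.transvection a b c))) n d := by
  have h1 : ∀ f, seqD (fun k => linSubst (Matrix.transvection a b c) (X k)) f =
      seqD X f + (C c * X a) • contr b f := fun f => by
    rw [seqD_eq_add_of_ne _ X b]
    · simp [linSubst_transvection_X]
    · intro k hk; simp [linSubst_transvection_X, hk]
  refine koszulAcyclic_map_of_intertwine (h := Matrix.transvection a b (-c))
    (by rw [Matrix.transvection_mul_transvection_same _ _ hab]; simp)
    (preservesChains_transvChain a b c) (preservesChains_transvChain a b (-c))
    (transvChain_neg hab c) (fun f => ?_) (fun f => ?_) hac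
  · rw [seqD_transvChain, h1]
  · rw [seqD_transvChain, h1, linSubst_transvection_X, if_neg hab]
    simp [add_assoc]

/-- The chain automorphism `e_k ↦ D k e_k`. -/
def diagChain (D : Fin n → K) :
    (Finset (Fin n) → MvPolynomial (Fin n) K) →ₗ[MvPolynomial (Fin n) K]
      (Finset (Fin n) → MvPolynomial (Fin n) K) where
  toFun f σ := C (∏ k ∈ σ, D k) * f σ
  map_add' f g := by funext σ; simp [mul_add]
  map_smul' c f := by funext σ; simp; ring

theorem diagChain_apply (D : Fin n → K) (f : Finset (Fin n) → MvPolynomial (Fin n) K)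
    (σ : Finset (Fin n)) : diagChain D f σ = C (∏ k ∈ σ, D k) * f σ := rfl

theorem preservesChains_diagChain (D : Fin n → K) : PreservesChains (diagChain D) := by
  refine ⟨fun i j f hf => ?_, fun A f hf => mem_coeffIn.2 fun σ =>
    A.mul_mem_left _ (mem_coeffIn.1 hf σ)⟩
  obtain ⟨h1, -, h3⟩ := (mem_koszulChains f).1 hf
  refine (mem_koszulChains _).2
    ⟨fun σ hσ => h1 σ fun h => hσ (by rw [diagChain_apply, h, mul_zero]),
      fun _ => trivial, fun σ => ?_⟩
  rw [diagChain_apply, ← zero_add (j - i)]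
  exact (isHomogeneous_C (Fin n) (∏ k ∈ σ, D k)).mul (h3 σ)

theorem contr_diagChain (D : Fin n → K) (k : Fin n)
    (f : Finset (Fin n) → MvPolynomial (Fin n) K) :
    contr k (diagChain D f) = diagChain D ((C (D k) : MvPolynomial (Fin n) K) • contr k f) := by
  funext σ
  rw [contr_apply, diagChain_apply, diagChain_apply, Pi.smul_apply, contr_apply]
  split_ifs with hk
  · simp
  · rw [Finset.prod_insert hk, C_mul, smul_eq_mul]; ring

theorem linSubst_diagonal_X (D : Fin n → K) (k : Fin n) :
    linSubst (Matrix.diagonal D) (X k) = C (D k) * X k := by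
  rw [linSubst_X, Finset.sum_eq_single k]
  · simp
  · intro i _ hi; simp [hi]
  · simp

theorem koszulAcyclic_map_diagonal {D : Fin n → K} (hD : ∀ k, D k ≠ 0)
    {A : Ideal (MvPolynomial (Fin n) K)} {d : ℕ} (hac : KoszulAcyclic X A n d) :
    KoszulAcyclic X (A.map (linSubst (Matrix.diagonal D))) n d := by
  refine koszulAcyclic_map_of_intertwine (h := Matrix.diagonal fun k => (D k)⁻¹)
    (T := diagChain D) (T' := diagChain fun k => (D k)⁻¹) ?_
    (preservesChains_diagChain _) (preservesChains_diagChain _) (fun f => ?_) (fun f => ?_)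
    (fun f => ?_) hac
  · rw [Matrix.diagonal_mul_diagonal]
    simp [hD]
  · funext σ
    rw [diagChain_apply, diagChain_apply, ← mul_assoc, ← C_mul, ← Finset.prod_mul_distrib]
    simp [hD]
  · rw [seqD_apply, seqD_apply, map_sum]
    refine Finset.sum_congr rfl fun k _ => ?_
    rw [contr_diagChain, ← map_smul, linSubst_diagonal_X, smul_smul, mul_comm]
  · rw [seqD_apply, seqD_apply, map_sum]
    refine Finset.sum_congr rfl fun k _ => ?_
    rw [contr_diagChain, ← map_smul, linSubst_diagonal_X, smul_smul, mul_right_comm, ← C_mul,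
      mul_inv_cancel₀ (hD k), C_1, one_mul]

/-- Vanishing of the Koszul homology in a range does not depend on the choice of coordinates:
an invertible matrix is a product of transvections and a diagonal matrix, and for these the
Koszul complexes of the old and the new variables are explicitly isomorphic. -/
theorem KoszulAcyclic.map_linSubst {A : Ideal (MvPolynomial (Fin n) K)} {d : ℕ}
    (hac : KoszulAcyclic X A n d) {g : Matrix (Fin n) (Fin n) K} (hg : g.det ≠ 0) :
    KoszulAcyclic X (A.map (linSubst g)) n d := by
  refine Matrix.diagonal_transvection_induction_of_det_ne_zero
    (fun g => ∀ A : Ideal (MvPolynomial (Fin n) K), KoszulAcyclic X A n d →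
      KoszulAcyclic X (A.map (linSubst g)) n d) g hg ?_ ?_ ?_ A hac
  · intro D hD A hac
    rw [Matrix.det_diagonal, Finset.prod_ne_zero_iff] at hD
    exact koszulAcyclic_map_diagonal (fun k => hD k (Finset.mem_univ k)) hac
  · intro t A hac
    exact koszulAcyclic_map_transvection t.hij t.c hac
  · intro g h _ _ hg hh A hac
    rw [map_linSubst_mul]
    exact hg _ (hh _ hac)

/-! ### Dimensions of the graded pieces of the Koszul complex -/

/-- The exponents of the monomials of degree `e`. -/
def degExps (n e : ℕ) : Finset (Fin n →₀ ℕ) := Finset.finsuppAntidiag Finset.univ e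

theorem mem_degExps {e : ℕ} {v : Fin n →₀ ℕ} : v ∈ degExps n e ↔ v.degree = e := by
  rw [degExps, Finset.mem_finsuppAntidiag, Finsupp.degree_eq_sum]
  simp

theorem degree_of_mem_support {f : MvPolynomial (Fin n) K} {e : ℕ} (hf : f.IsHomogeneous e)
    {v : Fin n →₀ ℕ} (hv : v ∈ f.support) : v.degree = e := by
  rw [Finsupp.degree_eq_weight_one]
  exact hf (mem_support_iff.1 hv)

theorem finite_homogeneousSubmodule (e : ℕ) :
    Module.Finite K (homogeneousSubmodule (Fin n) K e) := by
  refine Module.Finite.of_injective ((LinearMap.pi fun v : degExps n e => lcoeff K v.1) ∘ₗ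
    (homogeneousSubmodule (Fin n) K e).subtype) ?_
  rw [← LinearMap.ker_eq_bot, LinearMap.ker_eq_bot']
  rintro ⟨f, hf⟩ h
  refine Subtype.ext ?_
  ext v
  by_contra hv
  exact hv (congrFun h ⟨v, mem_degExps.2 (degree_of_mem_support hf (mem_support_iff.2 hv))⟩)

instance finite_gradedPiece (A : Ideal (MvPolynomial (Fin n) K)) (e : ℕ) :
    Module.Finite K (gradedPiece A e) := by
  have := finite_homogeneousSubmodule (K := K) (n := n) e
  exact Submodule.finiteDimensional_of_le inf_le_right

/-- A submodule of a product that is a product of submodules, as a product of modules. -/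
def piEquiv {ι R : Type*} [Ring R] {M : ι → Type*} [∀ i, AddCommGroup (M i)] [∀ i, Module R (M i)]
    (p : ∀ i, Submodule R (M i)) : Submodule.pi Set.univ p ≃ₗ[R] ∀ i, p i where
  toFun f i := ⟨f.1 i, f.2 i trivial⟩
  invFun f := ⟨fun i => f i, fun i _ => (f i).2⟩
  map_add' _ _ := rfl
  map_smul' _ _ := rfl
  left_inv _ := rfl
  right_inv _ := rfl

theorem finite_ite (c : Prop) [Decidable c] (p q : Submodule K (MvPolynomial (Fin n) K))
    [Module.Finite K p] [Module.Finite K q] :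
    Module.Finite K ((if c then p else q : Submodule K (MvPolynomial (Fin n) K))) := by
  by_cases h : c
  · rw [if_pos h]; infer_instance
  · rw [if_neg h]; infer_instance

instance finite_koszulChains (A : Ideal (MvPolynomial (Fin n) K)) (i j : ℕ) :
    Module.Finite K (koszulChains A i j) := by
  have : ∀ σ : Finset (Fin n), Module.Finite K
      ((if σ.card = i ∧ i ≤ j then gradedPiece A (j - i) else ⊥ :
        Submodule K (MvPolynomial (Fin n) K))) := fun σ => finite_ite _ _ _
  exact Module.Finite.equiv (piEquiv _).symm

instance finite_koszulCycles (A : Ideal (MvPolynomial (Fin n) K)) (i j : ℕ) :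
    Module.Finite K (koszulCycles A i j) :=
  Submodule.finiteDimensional_of_le inf_le_left

theorem finrank_koszulChains (A : Ideal (MvPolynomial (Fin n) K)) (i j : ℕ) :
    Module.finrank K (koszulChains A i j) =
      if i ≤ j then n.choose i * Module.finrank K (gradedPiece A (j - i)) else 0 := by
  have : ∀ σ : Finset (Fin n), Module.Finite K
      ((if σ.card = i ∧ i ≤ j then gradedPiece A (j - i) else ⊥ :
        Submodule K (MvPolynomial (Fin n) K))) := fun σ => finite_ite _ _ _
  rw [koszulChains, (piEquiv _).finrank_eq, Module.finrank_pi_fintype]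
  split_ifs with h
  · have h1 : ∀ σ : Finset (Fin n), Module.finrank K
        ((if σ.card = i ∧ i ≤ j then gradedPiece A (j - i) else ⊥ :
          Submodule K (MvPolynomial (Fin n) K))) =
        if σ.card = i then Module.finrank K (gradedPiece A (j - i)) else 0 := fun σ => by
      by_cases hσ : σ.card = i
      · rw [if_pos ⟨hσ, h⟩, if_pos hσ]
      · rw [if_neg (fun h' => hσ h'.1), if_neg hσ, finrank_bot]
    simp only [h1]
    rw [← Finset.sum_filter, Finset.sum_const, smul_eq_mul, ← Finset.powerset_univ,
      ← Finset.powersetCard_eq_filter, Finset.card_powersetCard, Finset.card_univ,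
      Fintype.card_fin]
  · refine Finset.sum_eq_zero fun σ _ => ?_
    rw [if_neg (fun h' => h h'.2), finrank_bot]

theorem mem_koszulCycles {A : Ideal (MvPolynomial (Fin n) K)} {i j : ℕ}
    {f : Finset (Fin n) → MvPolynomial (Fin n) K} :
    f ∈ koszulCycles A i j ↔ f ∈ koszulChains A i j ∧ seqD X f = 0 := by
  rw [koszulCycles, Submodule.mem_inf, LinearMap.mem_ker, koszulD_eq]

theorem koszulBoundaries_le (A : Ideal (MvPolynomial (Fin n) K)) (i j : ℕ) :
    koszulBoundaries A i j ≤ koszulCycles A i j := by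
  rintro _ ⟨f, hf, rfl⟩
  rw [mem_koszulCycles, koszulD_eq, seqD_seqD]
  exact ⟨seqD_mem_koszulChains isHomogeneous_X_one hf, rfl⟩

/-- Rank-nullity for the Koszul differential. -/
theorem finrank_koszulBoundaries (A : Ideal (MvPolynomial (Fin n) K)) (i j : ℕ) :
    Module.finrank K (koszulBoundaries A i j) + Module.finrank K (koszulCycles A (i + 1) j) =
      Module.finrank K (koszulChains A (i + 1) j) := by
  rw [← LinearMap.finrank_range_add_finrank_ker
    ((koszulD K n).domRestrict (koszulChains A (i + 1) j))]
  congr 1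
  · rw [koszulBoundaries, LinearMap.range_domRestrict]
  · rw [LinearMap.ker_domRestrict, koszulCycles]
    rw [(Submodule.equivSubtypeMap _ _).finrank_eq, Submodule.map_comap_subtype]

theorem betti_add (A : Ideal (MvPolynomial (Fin n) K)) (i j : ℕ) :
    betti A i j + Module.finrank K (koszulBoundaries A i j) =
      Module.finrank K (koszulCycles A i j) := by
  rw [betti, ← Submodule.finrank_quotient_add_finrank
    ((koszulBoundaries A i j).submoduleOf (koszulCycles A i j)),
    (Submodule.submoduleOfEquivOfLe (koszulBoundaries_le A i j)).finrank_eq]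

/-- The Betti numbers in terms of the dimensions of the spaces of cycles and chains. -/
theorem betti_add_finrank_koszulChains (A : Ideal (MvPolynomial (Fin n) K)) (i j : ℕ) :
    betti A i j + Module.finrank K (koszulChains A (i + 1) j) =
      Module.finrank K (koszulCycles A i j) + Module.finrank K (koszulCycles A (i + 1) j) := by
  rw [← betti_add, ← finrank_koszulBoundaries]
  ring

/-! ### Linear resolutions and Koszul acyclicity -/

theorem koszulCycles_le_boundaries_of_betti_eq_zero {A : Ideal (MvPolynomial (Fin n) K)} {i j : ℕ}
    (h : betti A i j = 0) : koszulCycles A i j ≤ koszulBoundaries A i j := by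
  rw [betti, Module.finrank_zero_iff, Submodule.Quotient.subsingleton_iff,
    Submodule.submoduleOf, Submodule.comap_subtype_eq_top] at h
  exact h

/-- A chain with boundary in `A` is, up to a chain over `A` and by the linearity of the resolution,
a cycle over `S`, hence a boundary. -/
theorem HasLinearResolution.koszulAcyclic {A : Ideal (MvPolynomial (Fin n) K)} {d : ℕ}
    (hA : HasLinearResolution A d) : KoszulAcyclic X A n d := by
  rintro i j hij hj f hf - hDf
  obtain ⟨g, hg, hgD⟩ : ∃ g ∈ koszulChains A i j, seqD X g = seqD X f := by
    rcases i with _ | i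
    · exact ⟨0, Submodule.zero_mem _, by
        rw [seqD_eq_zero_of_mem_koszulChains_zero hf, map_zero]⟩
    · have h1 : seqD X f ∈ koszulCycles A i j := by
        rw [mem_koszulCycles, mem_koszulChains_iff_coeffIn, seqD_seqD]
        exact ⟨⟨seqD_mem_koszulChains isHomogeneous_X_one hf, hDf⟩, rfl⟩
      obtain ⟨g, hg, hgf⟩ := koszulCycles_le_boundaries_of_betti_eq_zero
        (hA i j (by omega)) h1
      exact ⟨g, hg, by rw [← koszulD_eq, hgf]⟩
  obtain ⟨hg1, hg2⟩ := mem_koszulChains_iff_coeffIn.1 hg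
  obtain ⟨G, hG, -, hGf⟩ := koszulAcyclic_bot i j (by omega) hj (f - g)
    (Submodule.sub_mem _ hf hg1) suppBelow_top (by
      rw [map_sub, hgD, sub_self]; exact Submodule.zero_mem _)
  refine ⟨G, hG, suppBelow_top, ?_⟩
  rw [show f - seqD X G = (f - g - seqD X G) + g by abel]
  exact Submodule.add_mem _ (coeffIn_mono bot_le hGf) hg2

/-- The long exact sequence of `0 → A → S → S/A → 0`, in elementary terms: `H_i(A)` is
`H_{i+1}(S/A)`. -/
theorem KoszulAcyclic.koszulCycles_eq {A : Ideal (MvPolynomial (Fin n) K)} {d : ℕ}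
    (hA : KoszulAcyclic X A n d) {i j : ℕ} (hij : i + d < j) :
    koszulBoundaries A i j = koszulCycles A i j := by
  refine le_antisymm (koszulBoundaries_le A i j) fun f hf => ?_
  obtain ⟨hf1, hDf⟩ := mem_koszulCycles.1 hf
  obtain ⟨hf1, hf2⟩ := mem_koszulChains_iff_coeffIn.1 hf1
  obtain ⟨G, hG, -, hGf⟩ := koszulAcyclic_bot i j (by omega) (by omega) f hf1 suppBelow_top
    (by rw [hDf]; exact Submodule.zero_mem _)
  have hGf' : f = seqD X G := by
    funext σ
    have := mem_coeffIn.1 hGf σ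
    rwa [Pi.sub_apply, Ideal.mem_bot, sub_eq_zero] at this
  obtain ⟨H, hH, -, hHG⟩ := hA (i + 1) j (by omega) (by omega) G hG suppBelow_top
    (by rwa [← hGf'])
  refine ⟨G - seqD X H, mem_koszulChains_iff_coeffIn.2 ⟨sub_seqD_mem_koszulChains hG hH, hHG⟩, ?_⟩
  rw [koszulD_eq, map_sub, seqD_seqD, sub_zero, hGf']

/-- For two ideals with the same Hilbert function whose Koszul homology vanishes above the linear
strand, the cycles have the same dimensions on and above the linear strand. -/
theorem finrank_koszulCycles_eq {A B : Ideal (MvPolynomial (Fin n) K)} {d : ℕ}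
    (hA : KoszulAcyclic X A n d) (hB : KoszulAcyclic X B n d) (hAB : SameHilbertFunction A B)
    {i j : ℕ} (hij : i + d ≤ j) :
    Module.finrank K (koszulCycles A i j) = Module.finrank K (koszulCycles B i j) := by
  have hc : ∀ i, Module.finrank K (koszulChains A i j) = Module.finrank K (koszulChains B i j) :=
    fun i => by rw [finrank_koszulChains, finrank_koszulChains, hAB]
  have h0 : ∀ A : Ideal (MvPolynomial (Fin n) K), koszulCycles A 0 j = koszulChains A 0 j :=
    fun A => le_antisymm inf_le_left fun f hf =>
      mem_koszulCycles.2 ⟨hf, seqD_eq_zero_of_mem_koszulChains_zero hf⟩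
  induction i with
  | zero => rw [h0, h0, hc]
  | succ i ih =>
    have h1 := finrank_koszulBoundaries A i j
    have h2 := finrank_koszulBoundaries B i j
    rw [hA.koszulCycles_eq (by omega)] at h1
    rw [hB.koszulCycles_eq (by omega), ← ih (by omega), ← hc, ← h1] at h2
    omega

theorem koszulCycles_congr {A B : Ideal (MvPolynomial (Fin n) K)} {i j : ℕ}
    (h : gradedPiece A (j - i) = gradedPiece B (j - i)) :
    koszulCycles A i j = koszulCycles B i j := by
  rw [koszulCycles, koszulCycles, koszulChains, koszulChains, h]

theorem gradedPiece_componentIdeal (A : Ideal (MvPolynomial (Fin n) K)) (d : ℕ) :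
    gradedPiece (componentIdeal A d) d = gradedPiece A d := by
  refine le_antisymm (fun f hf => ⟨?_, hf.2⟩) fun f hf => ⟨Ideal.subset_span hf, hf.2⟩
  exact Ideal.span_le.2 (fun p hp => hp.1) hf.1

/-! ### Generic coordinates for an ideal with a linear resolution -/

open Classical in
/-- The socle of `S/A` vanishes in degrees `≥ d`: it is the top Koszul homology. -/
theorem KoszulAcyclic.mem_of_forall_X_mul_mem {A : Ideal (MvPolynomial (Fin n) K)} {k : Fin n}
    {d : ℕ} (hac : KoszulAcyclic X A (k + 1) d) {e : ℕ} (he : d ≤ e) {f : MvPolynomial (Fin n) K}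
    (hf : f.IsHomogeneous e) (hfA : ∀ i, X i * f ∈ A) : f ∈ A := by
  -- The cycle `f e_0 ∧ ⋯ ∧ e_k` has the highest possible degree, so it is a boundary only if it is
  -- zero modulo `A`.
  set F : Finset (Fin n) → MvPolynomial (Fin n) K := fun σ => if σ = Finset.Iic k then f else 0
    with hF
  obtain ⟨h, hh, hhk, hFh⟩ := hac (k + 1) (k + 1 + e) (by omega) (by omega) F (by
    refine (mem_koszulChains _).2 ⟨fun σ hσ => ?_, fun _ => trivial, fun σ => ?_⟩
    · have h1 : σ = Finset.Iic k := by
        by_contra h1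
        exact hσ (if_neg h1)
      rw [h1, Fin.card_Iic]
      omega
    · rw [hF]
      dsimp only
      split_ifs
      · rwa [Nat.add_sub_cancel_left]
      · exact isHomogeneous_zero _ _ _) (by
    rw [suppBelow_iff]
    intro σ l hl hkl
    refine if_neg ?_
    rintro rfl
    rw [Finset.mem_Iic, Fin.le_def] at hl
    omega) (by
    rw [seqD_apply]
    refine Submodule.sum_mem _ fun i _ => ?_
    rw [← map_smul]
    refine contr_mem_coeffIn i (mem_coeffIn.2 fun σ => ?_)
    rw [Pi.smul_apply, smul_eq_mul, hF]
    dsimp only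
    split_ifs
    · exact hfA i
    · rw [mul_zero]; exact A.zero_mem)
  have h0 : h = 0 := by
    funext σ
    by_contra h0
    have h1 := (((mem_koszulChains h).1 hh).1 σ h0).1
    have h2 : σ ⊆ Finset.Iic k := fun l hl => by
      rw [Finset.mem_Iic, Fin.le_def]
      by_contra h2
      exact h0 (suppBelow_iff.1 hhk σ l hl (by omega))
    have h3 := Finset.card_le_card h2
    rw [Fin.card_Iic] at h3
    omega
  have h1 := mem_coeffIn.1 hFh (Finset.Iic k)
  rw [h0, map_zero, sub_zero] at h1
  simpa [hF] using h1

/-- The colon ideal of `A` by the ideal of all variables. -/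
def colonVars (A : Ideal (MvPolynomial (Fin n) K)) : Ideal (MvPolynomial (Fin n) K) where
  carrier := {f | ∀ i, X i * f ∈ A}
  add_mem' hf hg i := by rw [mul_add]; exact A.add_mem (hf i) (hg i)
  zero_mem' i := by rw [mul_zero]; exact A.zero_mem
  smul_mem' c f hf i := by
    rw [smul_eq_mul, mul_left_comm]
    exact A.mul_mem_left _ (hf i)

/-- The saturation of `A` agrees with `A` in degrees `≥ d`. -/
theorem KoszulAcyclic.exists_saturated {A : Ideal (MvPolynomial (Fin n) K)} {k : Fin n}
    {d : ℕ} (hac : KoszulAcyclic X A (k + 1) d) :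
    ∃ B, A ≤ B ∧ colonVars B ≤ B ∧ ∀ e, d ≤ e → ∀ f : MvPolynomial (Fin n) K,
      f.IsHomogeneous e → f ∈ B → f ∈ A := by
  have hle : ∀ A : Ideal (MvPolynomial (Fin n) K), A ≤ colonVars A := fun A f hf i =>
    A.mul_mem_left _ hf
  have hmono : Monotone fun N : ℕ => colonVars^[N] A := by
    refine monotone_nat_of_le_succ fun N => ?_
    rw [Function.iterate_succ_apply']
    exact hle _
  obtain ⟨N, hN⟩ := monotone_stabilizes_iff_noetherian.2
    (inferInstance : IsNoetherian (MvPolynomial (Fin n) K) (MvPolynomial (Fin n) K))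
    ⟨_, hmono⟩
  refine ⟨colonVars^[N] A, hmono (Nat.zero_le N), ?_, ?_⟩
  · have := hN (N + 1) (Nat.le_succ N)
    change colonVars^[N] A = colonVars^[N + 1] A at this
    rw [← Function.iterate_succ_apply' colonVars, ← this]
  · clear hN
    induction N with
    | zero => exact fun e _ f _ hf => hf
    | succ N ih =>
      intro e he f hf hfB
      rw [Function.iterate_succ_apply'] at hfB
      refine hac.mem_of_forall_X_mul_mem he hf fun i => ?_
      exact ih (e + 1) (by omega) _ (by
        rw [add_comm]; exact (isHomogeneous_X_one i).mul hf) (hfB i)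

/-- The matrix whose linear substitution is `x_k ↦ x_k + ∑ i < k, c i * x_i`. -/
def shear (k : Fin n) (c : Fin n → K) : Matrix (Fin n) (Fin n) K :=
  1 + Matrix.of fun i j => if j = k ∧ i < k then c i else 0

theorem shear_mul_shear_neg (k : Fin n) (c : Fin n → K) : shear k c * shear k (-c) = 1 := by
  have h1 : (Matrix.of fun i j => if j = k ∧ i < k then (-c) i else 0 : Matrix (Fin n) (Fin n) K) =
      -(Matrix.of fun i j => if j = k ∧ i < k then c i else 0) := by
    ext i j
    simp only [Matrix.of_apply, Matrix.neg_apply, Pi.neg_apply]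
    split_ifs <;> simp
  have h2 : (Matrix.of fun i j => if j = k ∧ i < k then c i else 0 : Matrix (Fin n) (Fin n) K) *
      (Matrix.of fun i j => if j = k ∧ i < k then c i else 0) = 0 := by
    ext i j
    rw [Matrix.mul_apply]
    refine Finset.sum_eq_zero fun l _ => ?_
    by_cases hl : l = k
    · subst hl; simp
    · simp [hl]
  rw [shear, shear, h1, mul_add, add_mul, add_mul, mul_neg, mul_neg, h2]
  rw [mul_one, one_mul, mul_one, neg_zero, add_zero, add_assoc, add_neg_cancel, add_zero]

theorem shear_neg_mul_shear (k : Fin n) (c : Fin n → K) : shear k (-c) * shear k c = 1 := by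
  simpa using shear_mul_shear_neg k (-c)

theorem linSubst_shear_X (k : Fin n) (c : Fin n → K) (j : Fin n) :
    linSubst (shear k c) (X j) =
      X j + if j = k then ∑ i ∈ Finset.Iio k, C (c i) * X i else 0 := by
  rw [linSubst_X]
  simp only [shear, Matrix.add_apply, C_add, add_mul, Finset.sum_add_distrib, Matrix.of_apply]
  congr 1
  · have := linSubst_X (1 : Matrix (Fin n) (Fin n) K) j
    rw [linSubst_one] at this
    exact this.symm
  · split_ifs with h
    · have : Finset.Iio k = Finset.univ.filter (· < k) := by ext; simp
      rw [this, Finset.sum_filter]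
      refine Finset.sum_congr rfl fun i _ => ?_
      by_cases hi : i < k <;> simp [h, hi]
    · simp [h]

theorem exists_eval_ne_zero [Infinite K] {σ : Type*} {P : MvPolynomial σ K} (hP : P ≠ 0) :
    ∃ c, eval c P ≠ 0 := by
  by_contra! h
  exact hP (MvPolynomial.funext fun c => by rw [h c, map_zero])

open Classical in
/-- Over an infinite field, a general linear form `x_k + ∑ i < k, c i * x_i` acts injectively
on `S/A` in degrees `≥ d`: it avoids the associated primes of the saturation of `A`. -/
theorem KoszulAcyclic.exists_linear_form [Infinite K] {A : Ideal (MvPolynomial (Fin n) K)}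
    {k : Fin n} {d : ℕ} (hac : KoszulAcyclic X A (k + 1) d) (hA : varsFrom K n (k + 1) ≤ A)
    {P : MvPolynomial (Fin n) K} (hP : P ≠ 0) :
    ∃ c : Fin n → K, eval c P ≠ 0 ∧ ∀ e, d ≤ e → ∀ h : MvPolynomial (Fin n) K,
      h.IsHomogeneous e → linSubst (shear k c) (X k) * h ∈ A → h ∈ A := by
  obtain ⟨B, hAB, hB, hBA⟩ := hac.exists_saturated
  set M := MvPolynomial (Fin n) K ⧸ B
  have hfin := associatedPrimes.finite (MvPolynomial (Fin n) K) M
  -- Each associated prime is missed by some linear form of the given shape.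
  have hprime : ∀ p ∈ associatedPrimes (MvPolynomial (Fin n) K) M, ∃ L : MvPolynomial (Fin n) K,
      L ≠ 0 ∧ ∀ c, eval c L ≠ 0 → linSubst (shear k c) (X k) ∉ p := by
    intro p hp
    obtain ⟨c₀, hc₀⟩ : ∃ c₀ : Fin n → K, linSubst (shear k c₀) (X k) ∉ p := by
      by_contra! h
      have hk : X k ∈ p := by simpa [linSubst_shear_X] using h 0
      have hi : ∀ i : Fin n, i < k → X i ∈ p := by
        intro i hik
        have := p.sub_mem (h (Pi.single i 1)) hk
        rw [linSubst_shear_X, if_pos rfl, add_sub_cancel_left, Finset.sum_eq_single i] at this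
        · simpa using this
        · intro j _ hj; simp [hj]
        · simp [hik]
      obtain ⟨hp1, x, hx⟩ := Submodule.isAssociatedPrime_iff.1 hp
      obtain ⟨a, rfl⟩ := Ideal.Quotient.mk_surjective x
      have hmem : ∀ r, r ∈ p ↔ r * a ∈ B := by
        intro r
        rw [hx, Submodule.mem_colon_singleton, Submodule.mem_bot]
        exact Ideal.Quotient.eq_zero_iff_mem (a := r * a)
      have haB : a ∈ B := by
        refine hB fun i => ?_
        rcases lt_trichotomy i k with h1 | rfl | h1
        · exact (hmem _).1 (hi i h1)
        · exact (hmem _).1 hk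
        · exact B.mul_mem_right _ (hAB (hA (X_mem_varsFrom h1)))
      exact hp1.ne_top (p.eq_top_of_isUnit_mem ((hmem 1).2 (by rwa [one_mul])) isUnit_one)
    obtain ⟨φ, hφ1, hφ2⟩ := Submodule.exists_le_ker_of_notMem (p := p.restrictScalars K) hc₀
    have heval : ∀ c : Fin n → K, φ (linSubst (shear k c) (X k)) =
        eval c (C (φ (X k)) + ∑ i ∈ Finset.Iio k, C (φ (X i)) * X i) := by
      intro c
      rw [linSubst_shear_X, if_pos rfl]
      simp only [map_add, map_sum, eval_C, map_mul, eval_X]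
      congr 1
      refine Finset.sum_congr rfl fun i _ => ?_
      rw [← smul_eq_C_mul, map_smul, smul_eq_mul, mul_comm]
    refine ⟨C (φ (X k)) + ∑ i ∈ Finset.Iio k, C (φ (X i)) * X i, fun h => ?_, fun c hc hcp => ?_⟩
    · exact hφ1 (by rw [heval, h, map_zero])
    · exact hc (by rw [← heval]; exact hφ2 hcp)
  choose! L hL0 hL using hprime
  obtain ⟨c, hc⟩ := exists_eval_ne_zero (mul_ne_zero hP
    (Finset.prod_ne_zero_iff.2 fun p hp => hL0 p (hfin.mem_toFinset.1 hp)))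
  rw [map_mul, map_prod] at hc
  refine ⟨c, left_ne_zero_of_mul hc, fun e he h hh hhA => hBA e he h hh ?_⟩
  by_contra hhB
  have h1 : linSubst (shear k c) (X k) ∈
      ⋃ p ∈ associatedPrimes (MvPolynomial (Fin n) K) M, (p : Set (MvPolynomial (Fin n) K)) := by
    rw [biUnion_associatedPrimes_eq_zero_divisors]
    refine ⟨Ideal.Quotient.mk B h, fun h0 => hhB (Ideal.Quotient.eq_zero_iff_mem.1 h0), ?_⟩
    exact Ideal.Quotient.eq_zero_iff_mem.2 (hAB hhA)
  rw [Set.mem_iUnion₂] at h1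
  obtain ⟨p, hp, hpc⟩ := h1
  exact hL p hp c (Finset.prod_ne_zero_iff.1 (right_ne_zero_of_mul hc) p
    (hfin.mem_toFinset.2 hp)) hpc

theorem map_varsFrom_shear {k : Fin n} {m : ℕ} (hm : (k : ℕ) < m) (c : Fin n → K) :
    (varsFrom K n m).map (linSubst (shear k c)) = varsFrom K n m := by
  rw [varsFrom, Ideal.map_span, ← Set.image_comp]
  congr 1
  refine Set.image_congr fun l hl => ?_
  rw [Function.comp_apply, linSubst_shear_X, if_neg, add_zero]
  rintro rfl
  exact absurd hl (not_le.2 hm)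

/-- Among the coordinate changes where a given nonzero polynomial does not vanish, there is one
after which every variable `x_k` acts injectively in degrees `≥ d` modulo the ideal and the
variables `x_{k+1}, …, x_{n-1}`. The coordinates are adjusted one at a time, starting from the
last one. -/
theorem KoszulAcyclic.exists_generic [Infinite K] {A : Ideal (MvPolynomial (Fin n) K)} {d : ℕ}
    (hA : A.IsHomogeneous (homogeneousSubmodule (Fin n) K)) (hac : KoszulAcyclic X A n d)
    {P : MvPolynomial (Fin n × Fin n) K} (hP : P ≠ 0) :
    ∃ g : GL (Fin n) K, eval (fun e => (g : Matrix (Fin n) (Fin n) K) e.1 e.2) P ≠ 0 ∧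
      ∀ k : Fin n, InjAt (A.map (linSubst (g : Matrix _ _ K)) ⊔ varsFrom K n (k + 1)) k d := by
  have key : ∀ j ≤ n, ∃ g : GL (Fin n) K,
      eval (fun e => (g : Matrix (Fin n) (Fin n) K) e.1 e.2) P ≠ 0 ∧ ∀ k : Fin n, j ≤ k →
        InjAt (A.map (linSubst (g : Matrix _ _ K)) ⊔ varsFrom K n (k + 1)) k d := by
    intro j hj
    induction hj using Nat.decreasingInduction with
    | self =>
      obtain ⟨g, hg⟩ := exists_GL_of_ne_zero hP
      exact ⟨g, hg, fun k hk => absurd k.isLt (by omega)⟩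
    | of_succ j hj ih =>
      obtain ⟨g, hg, hinj⟩ := ih
      set k : Fin n := ⟨j, hj⟩
      set A' := A.map (linSubst (g : Matrix _ _ K)) with hA'
      have hginv : (g : Matrix (Fin n) (Fin n) K) * (g⁻¹ : GL (Fin n) K) = 1 := by
        rw [← Units.val_mul, mul_inv_cancel, Units.val_one]
      have hA'h := isHomogeneous_map_linSubst hA hginv
      have hac' := (hac.map_linSubst (g := g)
        ((Matrix.isUnit_iff_isUnit_det _).1 g.isUnit).ne_zero).restrict_of_injAt hA'h
          (m := k + 1) hj hinj
      -- `Q` expresses `P` at the matrix `shear k (-c) * g` as a polynomial in `c`.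
      set Q : MvPolynomial (Fin n) K := aeval (fun e : Fin n × Fin n =>
        C (g.1 e.1 e.2) + if e.1 < k then -X e.1 * C (g.1 k e.2) else 0) P with hQ
      have hQe : ∀ c, eval c Q = eval (fun e => (shear k (-c) * g.1) e.1 e.2) P := by
        intro c
        have h1 : (eval c).comp (aeval (R := K) (fun e : Fin n × Fin n =>
            C (g.1 e.1 e.2) + if e.1 < k then -X e.1 * C (g.1 k e.2) else 0)).toRingHom =
            eval (fun e => (shear k (-c) * g.1) e.1 e.2) := by
          refine MvPolynomial.ringHom_ext (fun a => by simp) fun e => ?_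
          simp only [AlgHom.toRingHom_eq_coe, RingHom.comp_apply, RingHom.coe_coe, aeval_X, eval_X]
          rw [shear, add_mul, one_mul, Matrix.add_apply, map_add, eval_C, Matrix.mul_apply,
            Finset.sum_eq_single k]
          · simp only [Matrix.of_apply, true_and]
            split_ifs <;> simp
          · intro l _ hl; simp [hl]
          · simp
        exact RingHom.congr_fun h1 P
      have hQ0 : Q ≠ 0 := by
        intro h
        have := hQe 0
        rw [h, map_zero, neg_zero] at this
        refine hg (Eq.trans ?_ this.symm)
        have h1 : shear k (0 : Fin n → K) = 1 := by
          ext a b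
          simp [shear]
        rw [h1, one_mul]
      obtain ⟨c, hc, hcinj⟩ := hac'.exists_linear_form le_sup_right hQ0
      -- `τ` takes the linear form `x_k + ∑ i < k, c i * x_i` to `x_k`, and fixes the variables
      -- already dealt with.
      set τ : GL (Fin n) K := ⟨shear k (-c), shear k c, shear_neg_mul_shear k c,
        shear_mul_shear_neg k c⟩
      refine ⟨τ * g, ?_, fun l hl => ?_⟩
      · rw [hQe] at hc
        exact hc
      · have hmap : A.map (linSubst ((τ * g : GL (Fin n) K) : Matrix _ _ K)) ⊔
            varsFrom K n (l + 1) =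
            (A' ⊔ varsFrom K n (l + 1)).map (linSubst (shear k (-c))) := by
          rw [Ideal.map_sup, map_varsFrom_shear (by change j < _; omega), hA', ← map_linSubst_mul]
          rfl
        rw [hmap]
        intro e he h hh hX
        rw [mem_map_linSubst (shear_neg_mul_shear k c)] at hX ⊢
        rw [map_mul] at hX
        by_cases hlk : l = k
        · subst hlk
          exact hcinj e he _ (IsHomogeneous.linSubst hh _) hX
        · rw [linSubst_shear_X, if_neg hlk, add_zero] at hX
          have : (l : ℕ) ≠ j := fun h => hlk (Fin.ext h)
          exact hinj l (by omega) e he _ (IsHomogeneous.linSubst hh _) hX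
  obtain ⟨g, hg, hinj⟩ := key 0 (Nat.zero_le n)
  exact ⟨g, hg, fun k => hinj k (Nat.zero_le _)⟩

open scoped MonomialOrder

/-! ### Monomial ideals and initial ideals -/

theorem IsMonomialIdeal.mem_iff {B : Ideal (MvPolynomial (Fin n) K)} (hB : IsMonomialIdeal B)
    {f : MvPolynomial (Fin n) K} : f ∈ B ↔ ∀ v ∈ f.support, monomial v (1 : K) ∈ B := by
  obtain ⟨S, rfl⟩ := hB
  simp [mem_ideal_span_monomial_image]

theorem monomial_mem_of_le {B : Ideal (MvPolynomial (Fin n) K)} {u v : Fin n →₀ ℕ} (huv : u ≤ v)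
    (hu : monomial u (1 : K) ∈ B) : monomial v (1 : K) ∈ B :=
  B.mem_of_dvd (monomial_dvd_monomial.2 ⟨Or.inr huv, dvd_rfl⟩) hu

theorem initialIdeal_eq_span (m : MonomialOrder (Fin n)) (A : Ideal (MvPolynomial (Fin n) K)) :
    initialIdeal m A = Ideal.span ((fun u => monomial u (1 : K)) ''
      {u | ∃ f ∈ A, f ≠ 0 ∧ u = m.degree f}) := by
  rw [initialIdeal]
  congr 1
  ext p
  constructor
  · rintro ⟨f, hf, hf0, rfl⟩
    exact ⟨_, ⟨f, hf, hf0, rfl⟩, rfl⟩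
  · rintro ⟨_, ⟨f, hf, hf0, rfl⟩, rfl⟩
    exact ⟨f, hf, hf0, rfl⟩

theorem isMonomialIdeal_initialIdeal (m : MonomialOrder (Fin n))
    (A : Ideal (MvPolynomial (Fin n) K)) : IsMonomialIdeal (initialIdeal m A) :=
  ⟨_, initialIdeal_eq_span m A⟩

theorem IsMonomialIdeal.isHomogeneous {B : Ideal (MvPolynomial (Fin n) K)}
    (hB : IsMonomialIdeal B) : B.IsHomogeneous (homogeneousSubmodule (Fin n) K) := by
  refine isHomogeneous_of_components fun f hf e => ?_
  rw [hB.mem_iff] at hf ⊢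
  intro v hv
  refine hf v ?_
  rw [mem_support_iff, coeff_homogeneousComponent] at hv
  rw [mem_support_iff]
  split_ifs at hv with h
  · exact hv
  · exact absurd rfl hv

/-- `x^u` is the initial monomial of a homogeneous element of `A`. Only the monomials of the degree
of `u` are compared, so that the condition depends on the graded piece `A_e`, `e = deg u`, alone. -/
def IsLead (m : MonomialOrder (Fin n)) (A : Ideal (MvPolynomial (Fin n) K)) (u : Fin n →₀ ℕ) :
    Prop :=
  ∃ f ∈ gradedPiece A u.degree, coeff u f ≠ 0 ∧
    ∀ v : Fin n →₀ ℕ, v.degree = u.degree → u ≺[m] v → coeff v f = 0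

theorem monomial_mem_initialIdeal {m : MonomialOrder (Fin n)} {A : Ideal (MvPolynomial (Fin n) K)}
    (hA : A.IsHomogeneous (homogeneousSubmodule (Fin n) K)) {u : Fin n →₀ ℕ} :
    monomial u (1 : K) ∈ initialIdeal m A ↔ IsLead m A u := by
  constructor
  · intro hu
    rw [initialIdeal_eq_span, mem_ideal_span_monomial_image] at hu
    obtain ⟨_, ⟨f, hf, hf0, rfl⟩, hle⟩ := hu u (by simp)
    set f' := monomial (u - m.degree f) (1 : K) * f with hf'
    have hm0 : monomial (u - m.degree f) (1 : K) ≠ 0 := by simp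
    have hdeg : m.degree f' = u := by
      classical
      rw [hf', MonomialOrder.degree_mul hm0 hf0, MonomialOrder.degree_monomial,
        if_neg one_ne_zero, tsub_add_cancel_of_le hle]
    refine ⟨homogeneousComponent u.degree f', ⟨homogeneousComponent_mem hA
      (A.mul_mem_left _ hf) _, homogeneousComponent_isHomogeneous _ _⟩, ?_, fun v hv huv => ?_⟩
    · rw [coeff_homogeneousComponent, if_pos rfl, ← hdeg]
      exact MonomialOrder.leadingCoeff_ne_zero_iff.2 (mul_ne_zero hm0 hf0)
    · rw [coeff_homogeneousComponent, if_pos hv]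
      exact MonomialOrder.coeff_eq_zero_of_lt (by rwa [hdeg])
  · rintro ⟨f, ⟨hfA, hfh⟩, hu, hv⟩
    have hf0 : f ≠ 0 := by rintro rfl; simp at hu
    refine Ideal.subset_span ⟨f, hfA, hf0, ?_⟩
    congr 1
    have h1 := MonomialOrder.degree_mem_support (m := m) hf0
    rcases (MonomialOrder.le_degree (m := m) (mem_support_iff.2 hu)).lt_or_eq with h2 | h2
    · exact absurd (hv _ (degree_of_mem_support hfh h1) h2) (mem_support_iff.1 h1)
    · exact congrArg _ (m.toSyn.injective h2)

open Classical in
/-- The dimension of `A_e` is the number of initial monomials of degree `e`. -/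
theorem finrank_gradedPiece_eq_card (m : MonomialOrder (Fin n))
    (A : Ideal (MvPolynomial (Fin n) K)) (e : ℕ) :
    Module.finrank K (gradedPiece A e) = ((degExps n e).filter (IsLead m A)).card := by
  set W := (degExps n e).filter (IsLead m A) with hW
  have hWe : ∀ w : W, w.1.degree = e ∧ IsLead m A w := fun w => by
    have := Finset.mem_filter.1 w.2
    exact ⟨mem_degExps.1 this.1, this.2⟩
  apply le_antisymm
  · set T : gradedPiece A e →ₗ[K] (W → K) :=
      (LinearMap.pi fun v : W => lcoeff K v.1) ∘ₗ (gradedPiece A e).subtype with hT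
    have hinj : Function.Injective T := by
      rw [← LinearMap.ker_eq_bot, LinearMap.ker_eq_bot']
      rintro ⟨f, hf⟩ h
      by_contra hf0
      have hf0' : f ≠ 0 := fun h => hf0 (Subtype.ext h)
      have h1 := MonomialOrder.degree_mem_support (m := m) hf0'
      have h2 := degree_of_mem_support hf.2 h1
      have h3 : m.degree f ∈ W := by
        refine Finset.mem_filter.2 ⟨mem_degExps.2 h2, f, by rwa [h2], mem_support_iff.1 h1, ?_⟩
        exact fun v _ hv => MonomialOrder.coeff_eq_zero_of_lt hv
      exact mem_support_iff.1 h1 (congrFun h ⟨_, h3⟩)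
    simpa using LinearMap.finrank_le_finrank_of_injective hinj
  · have h1 : ∀ w : W, ∃ f : gradedPiece A e, coeff w.1 f.1 ≠ 0 ∧
        ∀ v : Fin n →₀ ℕ, v.degree = e → w.1 ≺[m] v → coeff v f.1 = 0 := fun w => by
      obtain ⟨h, f, hf, hf2⟩ := hWe w
      rw [h] at hf hf2
      exact ⟨⟨f, hf⟩, hf2⟩
    choose f hf1 hf2 using h1
    have hli : LinearIndependent K f := by
      rw [Fintype.linearIndependent_iff]
      intro c hc
      by_contra! hne
      obtain ⟨w, hw, hmax⟩ := Finset.exists_max_image (Finset.univ.filter fun w => c w ≠ 0)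
        (fun w => m.toSyn w.1) (by
          obtain ⟨w, hw⟩ := hne
          exact ⟨w, by simpa using hw⟩)
      have h2 := congrArg (fun p : gradedPiece A e => coeff w.1 p.1) hc
      simp only [AddSubmonoidClass.coe_finsetSum, Submodule.coe_smul, coeff_sum, coeff_smul,
        ZeroMemClass.coe_zero, coeff_zero, smul_eq_mul] at h2
      rw [Finset.sum_eq_single w] at h2
      · exact (mul_ne_zero (by simpa using hw) (hf1 w)) h2
      · intro w' _ hne
        by_cases hcw : c w' = 0
        · rw [hcw, zero_mul]
        · rw [hf2 w' _ (hWe w).1, mul_zero]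
          refine lt_of_le_of_ne (hmax w' (by simpa using hcw)) fun h => hne ?_
          exact Subtype.ext (m.toSyn.injective h)
      · simp
    simpa using hli.fintype_card_le_finrank

theorem IsMonomialIdeal.isLead_iff {B : Ideal (MvPolynomial (Fin n) K)} (hB : IsMonomialIdeal B)
    (m : MonomialOrder (Fin n)) {u : Fin n →₀ ℕ} : IsLead m B u ↔ monomial u (1 : K) ∈ B := by
  classical
  constructor
  · rintro ⟨f, hf, hu, -⟩
    exact hB.mem_iff.1 hf.1 u (mem_support_iff.2 hu)
  · intro hu
    refine ⟨monomial u 1, ⟨hu, isHomogeneous_monomial _ rfl⟩, by simp, fun v _ huv => ?_⟩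
    rw [coeff_monomial, if_neg]
    rintro rfl
    exact lt_irrefl _ huv

open Classical in
theorem IsMonomialIdeal.finrank_gradedPiece {B : Ideal (MvPolynomial (Fin n) K)}
    (hB : IsMonomialIdeal B) (e : ℕ) : Module.finrank K (gradedPiece B e) =
      ((degExps n e).filter fun u => monomial u (1 : K) ∈ B).card := by
  rw [finrank_gradedPiece_eq_card (degRevLex n)]
  simp only [hB.isLead_iff]

theorem sameHilbertFunction_initialIdeal (m : MonomialOrder (Fin n))
    {A : Ideal (MvPolynomial (Fin n) K)}
    (hA : A.IsHomogeneous (homogeneousSubmodule (Fin n) K)) :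
    SameHilbertFunction (initialIdeal m A) A := by
  classical
  intro e
  rw [(isMonomialIdeal_initialIdeal m A).finrank_gradedPiece, finrank_gradedPiece_eq_card m]
  simp only [monomial_mem_initialIdeal hA]

/-- Two monomial ideals with the same monomials of degree `e` have the same graded piece. -/
theorem IsMonomialIdeal.gradedPiece_congr {B B' : Ideal (MvPolynomial (Fin n) K)}
    (hB : IsMonomialIdeal B) (hB' : IsMonomialIdeal B') {e : ℕ}
    (h : ∀ u : Fin n →₀ ℕ, u.degree = e → (monomial u (1 : K) ∈ B ↔ monomial u (1 : K) ∈ B')) :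
    gradedPiece B e = gradedPiece B' e := by
  ext f
  constructor
  · rintro ⟨h1, h2⟩
    exact ⟨hB'.mem_iff.2 fun v hv => (h v (degree_of_mem_support h2 hv)).1 (hB.mem_iff.1 h1 v hv),
      h2⟩
  · rintro ⟨h1, h2⟩
    exact ⟨hB.mem_iff.2 fun v hv => (h v (degree_of_mem_support h2 hv)).2 (hB'.mem_iff.1 h1 v hv),
      h2⟩

/-! ### The reverse lexicographic order and the last variables -/

/-- If `x^v ≤ x^u` have the same degree and `x^u` involves only `x_0, …, x_k`, then either `x^v`
involves a later variable, or the exponent of `x_k` in `x^v` is at least that in `x^u`. -/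
theorem le_of_degRevLex_le {u v : Fin n →₀ ℕ} {k : Fin n} (hdeg : v.degree = u.degree)
    (huk : ∀ l, k < l → u l = 0) (hle : ¬ u ≺[degRevLex n] v) (hvk : ∀ l, k < l → v l = 0) :
    u k ≤ v k := by
  have h1 := not_lt.1 hle
  rcases h1.lt_or_eq with h2 | h2
  · rcases (degRevLex_lt_iff v u).1 h2 with h3 | ⟨-, i, hi, hlt⟩
    · omega
    · rcases lt_trichotomy i k with h | rfl | h
      · rw [hi k h]
      · exact hlt.le
      · rw [hvk i h] at hlt; omega
  · rw [(degRevLex n).toSyn.injective h2]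

/-- If `x_k` acts injectively modulo `A + (x_{k+1}, …, x_{n-1})` in degrees `≥ d`, then initial
monomials of `A` of degree `> d` with last variable `x_k` remain initial after division by `x_k`. -/
theorem IsLead.sub_single {A : Ideal (MvPolynomial (Fin n) K)}
    (hA : A.IsHomogeneous (homogeneousSubmodule (Fin n) K)) {k : Fin n} {d : ℕ}
    (hinj : InjAt (A ⊔ varsFrom K n (k + 1)) k d) {w : Fin n →₀ ℕ} (hd : d ≤ w.degree)
    (hwk : ∀ l, k < l → w l = 0) (hlead : IsLead (degRevLex n) A (Finsupp.single k 1 + w)) :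
    IsLead (degRevLex n) A w := by
  obtain ⟨f, ⟨hfA, hfh⟩, hu, hv⟩ := hlead
  set s : Fin n →₀ ℕ := Finsupp.single k 1 with hs
  have hdeg : ∀ w : Fin n →₀ ℕ, (s + w).degree = 1 + w.degree := fun w => by simp [hs]
  rw [hdeg] at hfh
  have hsk : ∀ l, k < l → s l = 0 := fun l hl => by simp [hs, hl.ne]
  -- Modulo the later variables, `f = x_k h`: this is where the reverse lexicographic order enters.
  set h := f.divMonomial s with hh
  have hhh : h.IsHomogeneous w.degree := by
    rw [IsHomogeneous, IsWeightedHomogeneous]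
    intro v hv
    rw [hh, coeff_divMonomial] at hv
    have := degree_of_mem_support hfh (mem_support_iff.2 hv)
    rw [hdeg] at this
    have h2 : Finsupp.weight 1 v = v.degree := by
      rw [Finsupp.degree_eq_weight_one]; rfl
    rw [h2]
    omega
  have hmem : h ∈ A ⊔ varsFrom K n (k + 1) := by
    refine hinj _ hd h hhh ?_
    have h1 : X k * h = f - f.modMonomial s := by
      rw [eq_sub_iff_add_eq]
      exact divMonomial_add_modMonomial f s
    rw [h1]
    refine Ideal.sub_mem _ (Ideal.mem_sup_left hfA) (Ideal.mem_sup_right (mem_varsFrom.2 ?_))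
    intro v hvs
    by_contra! hvk
    rw [mem_support_iff] at hvs
    by_cases hsv : s ≤ v
    · exact hvs (coeff_modMonomial_of_le _ hsv)
    · rw [coeff_modMonomial_of_not_le _ hsv] at hvs
      have h2 := degree_of_mem_support hfh (mem_support_iff.2 hvs)
      have h3 := le_of_degRevLex_le (u := s + w) (v := v) (k := k) (by rw [h2, hdeg])
        (fun l hl => by simp [hsk l hl, hwk l hl])
        (fun hlt => hvs (hv v (by rw [h2, hdeg]) hlt)) (fun l hl => hvk l (by
          rw [Fin.lt_def] at hl; omega))
      refine hsv ?_
      rw [hs, Finsupp.single_le_iff]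
      simp only [Finsupp.add_apply, hs, Finsupp.single_eq_same] at h3
      omega
  obtain ⟨a, ha, b, hb, hab⟩ := Submodule.mem_sup.1 hmem
  have hbk : ∀ v : Fin n →₀ ℕ, (∀ l, k < l → v l = 0) → coeff v b = 0 := by
    intro v hvk
    by_contra hvb
    obtain ⟨l, hl, hvl⟩ := mem_varsFrom.1 hb v (mem_support_iff.2 hvb)
    exact hvl (hvk l (by rw [Fin.lt_def]; omega))
  have hcoeff : ∀ v : Fin n →₀ ℕ, (∀ l, k < l → v l = 0) → coeff v a = coeff (s + v) f := by
    intro v hvk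
    rw [← coeff_divMonomial, ← hh, ← hab, coeff_add, hbk v hvk, add_zero]
  refine ⟨homogeneousComponent w.degree a, ⟨homogeneousComponent_mem hA ha _,
    homogeneousComponent_isHomogeneous _ _⟩, ?_, fun v hvd hwv => ?_⟩
  · rwa [coeff_homogeneousComponent, if_pos rfl, hcoeff w hwk]
  · rw [coeff_homogeneousComponent, if_pos hvd, hcoeff v]
    · refine hv _ (by rw [hdeg, hdeg, hvd]) ?_
      rw [map_add, map_add]
      exact add_lt_add_right hwv _
    · rcases (degRevLex_lt_iff w v).1 hwv with h1 | ⟨-, i, hi, hlt⟩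
      · omega
      · intro l hl
        have hik : ¬ k < i := fun h => by rw [hwk i h] at hlt; omega
        rw [← hi l (lt_of_le_of_lt (not_lt.1 hik) hl), hwk l hl]

/-- The conditions on `A` in generic coordinates pass to the initial ideal. -/
theorem injAt_initialIdeal {A : Ideal (MvPolynomial (Fin n) K)}
    (hA : A.IsHomogeneous (homogeneousSubmodule (Fin n) K)) {k : Fin n} {d : ℕ}
    (hinj : InjAt (A ⊔ varsFrom K n (k + 1)) k d) :
    InjAt (initialIdeal (degRevLex n) A ⊔ varsFrom K n (k + 1)) k d := by
  set B := initialIdeal (degRevLex n) A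
  have hB : IsMonomialIdeal B := isMonomialIdeal_initialIdeal _ _
  have hmono : IsMonomialIdeal (B ⊔ varsFrom K n (k + 1)) := by
    obtain ⟨S, hS⟩ := hB
    refine ⟨S ∪ (fun l => Finsupp.single l 1) '' {l : Fin n | k + 1 ≤ (l : ℕ)}, ?_⟩
    rw [Set.image_union, Ideal.span_union, ← hS, ← Set.image_comp]
    rfl
  have hmem : ∀ v : Fin n →₀ ℕ, (∀ l, k < l → v l = 0) →
      monomial v (1 : K) ∈ B ⊔ varsFrom K n (k + 1) → monomial v (1 : K) ∈ B := by
    intro v hvk hv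
    obtain ⟨a, ha, b, hb, hab⟩ := Submodule.mem_sup.1 hv
    refine hB.mem_iff.1 ha v ?_
    rw [mem_support_iff, ← sub_eq_of_eq_add hab.symm, coeff_sub]
    have : coeff v b = 0 := by
      by_contra hvb
      obtain ⟨l, hl, hvl⟩ := mem_varsFrom.1 hb v (mem_support_iff.2 hvb)
      exact hvl (hvk l (by rw [Fin.lt_def]; omega))
    simp [this]
  intro e he h hh hX
  rw [hmono.mem_iff] at hX ⊢
  intro v hv
  have h1 := hX (v + Finsupp.single k 1) (by
    rwa [mem_support_iff, coeff_X_mul_add, ← mem_support_iff])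
  by_cases hvk : ∀ l, k < l → v l = 0
  · have h2 := hmem _ (fun l hl => by simp [hvk l hl, hl.ne]) h1
    rw [monomial_mem_initialIdeal hA, add_comm] at h2
    refine Ideal.mem_sup_left ((monomial_mem_initialIdeal hA).2 (h2.sub_single hA hinj ?_ hvk))
    rwa [degree_of_mem_support hh hv]
  · push Not at hvk
    obtain ⟨l, hl, hvl⟩ := hvk
    refine Ideal.mem_sup_right (mem_varsFrom.2 fun v' hv' => ?_)
    have : v' = v := by
      have := support_monomial_subset hv'
      simpa using this
    rw [this]
    exact ⟨l, by rw [Fin.lt_def] at hl; omega, hvl⟩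

/-! ### The generic initial ideal in a fixed degree -/

/-- The coefficients of `g f` are polynomials in the entries of `g`. -/
theorem exists_coeff_linSubst (f : MvPolynomial (Fin n) K) (v : Fin n →₀ ℕ) :
    ∃ F : MvPolynomial (Fin n × Fin n) K, ∀ g : Matrix (Fin n) (Fin n) K,
      eval (fun e => g e.1 e.2) F = coeff v (linSubst g f) := by
  refine ⟨coeff v (aeval (fun j : Fin n => ∑ i : Fin n,
    C (X (i, j) : MvPolynomial (Fin n × Fin n) K) * X i) f :
      MvPolynomial (Fin n) (MvPolynomial (Fin n × Fin n) K)), fun g => ?_⟩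
  rw [← coeff_map]
  congr 1
  have h1 : (map (eval fun e : Fin n × Fin n => g e.1 e.2)).comp
      (aeval (R := K) (fun j : Fin n => ∑ i : Fin n,
        C (X (i, j) : MvPolynomial (Fin n × Fin n) K) * X i)).toRingHom =
      (linSubst g).toRingHom := by
    refine MvPolynomial.ringHom_ext (fun a => ?_) fun j => ?_
    · simp [algebraMap_eq, linSubst, MvPolynomial.algebraMap_apply]
    · simp [linSubst]
  exact RingHom.congr_fun h1 f

/-- The map taking `f ∈ V` to the coefficients of `g f` at the monomials in `D`. -/
def coeffMap (V : Submodule K (MvPolynomial (Fin n) K)) (D : Finset (Fin n →₀ ℕ))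
    (g : Matrix (Fin n) (Fin n) K) : V →ₗ[K] (D → K) :=
  (LinearMap.pi fun v : D => lcoeff K v.1) ∘ₗ (linSubst g).toLinearMap ∘ₗ V.subtype

theorem coeffMap_apply (V : Submodule K (MvPolynomial (Fin n) K)) (D : Finset (Fin n →₀ ℕ))
    (g : Matrix (Fin n) (Fin n) K) (f : V) (v : D) :
    coeffMap V D g f v = coeff v.1 (linSubst g f) := rfl

/-- The rank of `coeffMap` is constant on a nonempty Zariski open set. -/
theorem exists_generic_rank (V : Submodule K (MvPolynomial (Fin n) K))
    (D : Finset (Fin n →₀ ℕ)) :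
    ∃ P : MvPolynomial (Fin n × Fin n) K, P ≠ 0 ∧ ∃ r, ∀ g : GL (Fin n) K,
      eval (fun e => (g : Matrix (Fin n) (Fin n) K) e.1 e.2) P ≠ 0 →
        Module.finrank K (LinearMap.range (coeffMap V D (g : Matrix _ _ K))) = r := by
  classical
  set ρ : GL (Fin n) K → ℕ := fun g =>
    Module.finrank K (LinearMap.range (coeffMap V D (g : Matrix _ _ K))) with hρ
  have hbdd : BddAbove (Set.range ρ) := by
    refine ⟨D.card, ?_⟩
    rintro _ ⟨g, rfl⟩
    simpa using Submodule.finrank_le (LinearMap.range (coeffMap V D (g : Matrix _ _ K)))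
  obtain ⟨g₀, hg₀⟩ := Nat.sSup_mem (Set.range_nonempty ρ) hbdd
  have hmax : ∀ g, ρ g ≤ ρ g₀ := fun g => by
    rw [hg₀]; exact le_csSup hbdd ⟨g, rfl⟩
  set T := coeffMap V D (g₀ : Matrix _ _ K) with hT
  -- Elements of `V` whose images under `T` form a basis of the range, and coordinates for it.
  let b := Module.finBasis K (LinearMap.range T)
  choose v hv using fun i => (b i).2
  obtain ⟨L₀, hL₀⟩ := LinearMap.exists_leftInverse_of_injective (LinearMap.range T).subtype
    (Submodule.ker_subtype _)
  set L : (D → K) →ₗ[K] (Fin (ρ g₀) → K) := b.equivFun.toLinearMap ∘ₗ L₀ with hL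
  have hLv : ∀ i, L (T (v i)) = Pi.single i 1 := by
    intro i
    rw [hv i]
    have h1 : L₀ (b i : D → K) = b i := LinearMap.congr_fun hL₀ (b i)
    rw [hL, LinearMap.comp_apply, h1]
    change b.equivFun (b i) = _
    ext j
    rw [Module.Basis.equivFun_self, Pi.single_apply]
    simp [eq_comm]
  choose F hF using fun i : Fin (ρ g₀) => exists_coeff_linSubst (v i : MvPolynomial (Fin n) K)
  set M : Matrix (Fin (ρ g₀)) (Fin (ρ g₀)) (MvPolynomial (Fin n × Fin n) K) :=
    Matrix.of fun i j => ∑ w : D, C (L (Pi.single w 1) j) * F i w.1 with hM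
  have hMe : ∀ g : Matrix (Fin n) (Fin n) K, eval (fun e => g e.1 e.2) M.det =
      (Matrix.of fun i j => L (coeffMap V D g (v i)) j).det := by
    intro g
    rw [RingHom.map_det]
    congr 1
    ext i j
    rw [RingHom.mapMatrix_apply, Matrix.map_apply, hM, Matrix.of_apply, Matrix.of_apply, map_sum]
    have h1 : coeffMap V D g (v i) =
        ∑ w : D, coeff w.1 (linSubst g (v i : MvPolynomial (Fin n) K)) •
          (Pi.single w 1 : D → K) := by
      ext w
      simp [Finset.sum_apply, Pi.single_apply, coeffMap_apply]
    rw [h1, map_sum, Finset.sum_apply]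
    refine Finset.sum_congr rfl fun w _ => ?_
    rw [map_mul, eval_C, hF, map_smul, Pi.smul_apply, smul_eq_mul, mul_comm]
  refine ⟨M.det, fun h0 => ?_, ρ g₀, fun g hg => le_antisymm (hmax g) ?_⟩
  · have h1 := hMe (g₀ : Matrix _ _ K)
    rw [h0, map_zero] at h1
    have h2 : (Matrix.of fun i j => L (coeffMap V D (g₀ : Matrix _ _ K) (v i)) j) = 1 := by
      ext i j
      rw [Matrix.of_apply, ← hT, hLv, Matrix.one_apply, Pi.single_apply]
      simp [eq_comm]
    rw [h2, Matrix.det_one] at h1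
    exact zero_ne_one h1
  · rw [hMe] at hg
    have h1 := Matrix.linearIndependent_rows_of_det_ne_zero hg
    have h2 : LinearIndependent K fun i =>
        (⟨coeffMap V D (g : Matrix _ _ K) (v i), LinearMap.mem_range_self _ _⟩ :
          LinearMap.range (coeffMap V D (g : Matrix _ _ K))) := by
      refine LinearIndependent.of_comp (L ∘ₗ (LinearMap.range _).subtype) ?_
      exact h1
    simpa using h2.fintype_card_le_finrank

open Classical in
/-- Whether `x^u` is an initial monomial of `g A` is decided by two ranks: those of the coefficients
of `g f`, `f ∈ A`, at the monomials `≥ x^u` and at the monomials `> x^u`. -/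
theorem isLead_map_iff {A : Ideal (MvPolynomial (Fin n) K)} {g h : Matrix (Fin n) (Fin n) K}
    (hgh : g * h = 1) (m : MonomialOrder (Fin n)) (u : Fin n →₀ ℕ) :
    IsLead m (A.map (linSubst g)) u ↔
      Module.finrank K (LinearMap.range (coeffMap (gradedPiece A u.degree)
        ((degExps n u.degree).filter fun v => u ≼[m] v) g)) ≠
      Module.finrank K (LinearMap.range (coeffMap (gradedPiece A u.degree)
        ((degExps n u.degree).filter fun v => u ≺[m] v) g)) := by
  set V := gradedPiece A u.degree
  set T₁ := coeffMap V ((degExps n u.degree).filter fun v => u ≼[m] v) g with hT₁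
  set T₂ := coeffMap V ((degExps n u.degree).filter fun v => u ≺[m] v) g with hT₂
  have hker₁ : ∀ f : V, f ∈ LinearMap.ker T₁ ↔ ∀ v : Fin n →₀ ℕ, v.degree = u.degree →
      u ≼[m] v → coeff v (linSubst g f) = 0 := fun f => by
    rw [LinearMap.mem_ker, funext_iff]
    simp [hT₁, coeffMap_apply, mem_degExps]
  have hker₂ : ∀ f : V, f ∈ LinearMap.ker T₂ ↔ ∀ v : Fin n →₀ ℕ, v.degree = u.degree →
      u ≺[m] v → coeff v (linSubst g f) = 0 := fun f => by
    rw [LinearMap.mem_ker, funext_iff]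
    simp [hT₂, coeffMap_apply, mem_degExps]
  have hle : LinearMap.ker T₁ ≤ LinearMap.ker T₂ := fun f hf =>
    (hker₂ f).2 fun v hv huv => (hker₁ f).1 hf v hv (le_of_lt huv)
  have h1 := LinearMap.finrank_range_add_finrank_ker T₁
  have h2 := LinearMap.finrank_range_add_finrank_ker T₂
  have h3 : Module.finrank K (LinearMap.range T₁) ≠ Module.finrank K (LinearMap.range T₂) ↔
      ¬ LinearMap.ker T₂ ≤ LinearMap.ker T₁ := by
    rw [not_iff_not]
    constructor
    · intro h
      exact (Submodule.eq_of_le_of_finrank_eq hle (by omega)).ge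
    · intro h
      have h4 := le_antisymm hle h
      rw [h4] at h1
      omega
  rw [h3, SetLike.not_le_iff_exists]
  have hhg := mul_eq_one_comm.1 hgh
  constructor
  · rintro ⟨f, ⟨hfA, hfh⟩, hu, hv⟩
    refine ⟨⟨linSubst h f, (mem_map_linSubst hgh).1 hfA, IsHomogeneous.linSubst hfh h⟩, ?_, ?_⟩
    · rw [hker₂]
      simpa only [linSubst_linSubst hgh] using hv
    · rw [hker₁]
      simp only [linSubst_linSubst hgh]
      exact fun h => hu (h u rfl le_rfl)
  · rintro ⟨f, hf2, hf1⟩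
    rw [hker₂] at hf2
    refine ⟨linSubst g f, ⟨Ideal.mem_map_of_mem _ f.2.1, IsHomogeneous.linSubst f.2.2 g⟩,
      fun hu => hf1 ((hker₁ f).2 fun v hv huv => ?_), hf2⟩
    rcases lt_or_eq_of_le huv with h | h
    · exact hf2 v hv h
    · rwa [← m.toSyn.injective h]

theorem isMonomialIdeal_gin (A : Ideal (MvPolynomial (Fin n) K)) : IsMonomialIdeal (gin A) :=
  ⟨_, rfl⟩

theorem GL_mul_inv (g : GL (Fin n) K) :
    (g : Matrix (Fin n) (Fin n) K) * ((g⁻¹ : GL (Fin n) K) : Matrix (Fin n) (Fin n) K) = 1 := by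
  rw [← Units.val_mul, mul_inv_cancel, Units.val_one]

/-- In each degree, the generic initial ideal is the initial ideal for generic coordinates. -/
theorem exists_generic_gin [Infinite K] {A : Ideal (MvPolynomial (Fin n) K)}
    (hA : A.IsHomogeneous (homogeneousSubmodule (Fin n) K)) (e : ℕ) :
    ∃ P : MvPolynomial (Fin n × Fin n) K, P ≠ 0 ∧ ∀ g : GL (Fin n) K,
      eval (fun e => (g : Matrix (Fin n) (Fin n) K) e.1 e.2) P ≠ 0 →
        ∀ u : Fin n →₀ ℕ, u.degree = e → (monomial u (1 : K) ∈ gin A ↔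
          IsLead (degRevLex n) (A.map (linSubst (g : Matrix _ _ K))) u) := by
  classical
  choose P hP0 r hPr using exists_generic_rank (K := K) (n := n) (gradedPiece A e)
  set m := degRevLex n
  set Q : MvPolynomial (Fin n × Fin n) K := ∏ u ∈ degExps n e,
    (P ((degExps n e).filter fun v => u ≼[m] v) * P ((degExps n e).filter fun v => u ≺[m] v))
    with hQ
  have hQ0 : Q ≠ 0 := Finset.prod_ne_zero_iff.2 fun u _ => mul_ne_zero (hP0 _) (hP0 _)
  have hconst : ∀ g g' : GL (Fin n) K,
      eval (fun e => (g : Matrix (Fin n) (Fin n) K) e.1 e.2) Q ≠ 0 →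
      eval (fun e => (g' : Matrix (Fin n) (Fin n) K) e.1 e.2) Q ≠ 0 →
      ∀ u : Fin n →₀ ℕ, u.degree = e → IsLead m (A.map (linSubst (g : Matrix _ _ K))) u →
        IsLead m (A.map (linSubst (g' : Matrix _ _ K))) u := by
    intro g g' hg hg' u hu
    rw [hQ, map_prod, Finset.prod_ne_zero_iff] at hg hg'
    have h1 := hg u (mem_degExps.2 hu)
    have h2 := hg' u (mem_degExps.2 hu)
    rw [map_mul] at h1 h2
    subst hu
    rw [isLead_map_iff (GL_mul_inv g), isLead_map_iff (GL_mul_inv g'),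
      hPr _ g (left_ne_zero_of_mul h1), hPr _ g (right_ne_zero_of_mul h1),
      hPr _ g' (left_ne_zero_of_mul h2), hPr _ g' (right_ne_zero_of_mul h2)]
    exact id
  refine ⟨Q, hQ0, fun g hg u hu => ?_⟩
  have hin : ∀ g : GL (Fin n) K, ∀ u : Fin n →₀ ℕ,
      monomial u (1 : K) ∈ initialIdeal m (A.map (linSubst (g : Matrix _ _ K))) ↔
        IsLead m (A.map (linSubst (g : Matrix _ _ K))) u := fun g u =>
    monomial_mem_initialIdeal (isHomogeneous_map_linSubst hA (GL_mul_inv g))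
  constructor
  · intro hug
    rw [gin, mem_ideal_span_monomial_image] at hug
    obtain ⟨s, ⟨R, hR0, hR⟩, hsu⟩ := hug u (by simp [support_monomial])
    obtain ⟨g', hg'⟩ := exists_GL_of_ne_zero (mul_ne_zero hQ0 hR0)
    rw [map_mul] at hg'
    exact hconst g' g (left_ne_zero_of_mul hg') hg u hu
      ((hin g' u).1 (monomial_mem_of_le hsu (hR g' (right_ne_zero_of_mul hg'))))
  · intro hlead
    refine Ideal.subset_span ⟨u, ⟨Q, hQ0, fun g' hg' => ?_⟩, rfl⟩
    exact (hin g' u).2 (hconst g g' hg hg' u hu hlead)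

/-! ### The generic initial ideal of a componentwise linear ideal -/

/-- A monomial ideal is stable if replacing one factor of the last variable dividing a monomial of
the ideal by an earlier variable gives a monomial of the ideal. -/
def IsStable (J : Ideal (MvPolynomial (Fin n) K)) : Prop :=
  ∀ (w : Fin n →₀ ℕ) (k j : Fin n), j < k → (∀ l, k < l → w l = 0) →
    monomial (Finsupp.single k 1 + w) (1 : K) ∈ J → monomial (Finsupp.single j 1 + w) (1 : K) ∈ J

theorem sameHilbertFunction_map_linSubst (A : Ideal (MvPolynomial (Fin n) K))
    {g h : Matrix (Fin n) (Fin n) K} (hgh : g * h = 1) :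
    SameHilbertFunction (A.map (linSubst g)) A := by
  intro e
  have hinj : Function.Injective (linSubst g).toLinearMap := fun p q hpq => by
    rw [← linSubst_linSubst (mul_eq_one_comm.1 hgh) p,
      ← linSubst_linSubst (mul_eq_one_comm.1 hgh) q]
    exact congrArg _ hpq
  rw [((gradedPiece A e).equivMapOfInjective _ hinj).finrank_eq]
  suffices h : gradedPiece (A.map (linSubst g)) e =
      (gradedPiece A e).map (linSubst g).toLinearMap by rw [h]
  ext f
  constructor
  · rintro ⟨h1, h2⟩
    exact ⟨linSubst h f, ⟨(mem_map_linSubst hgh).1 h1, IsHomogeneous.linSubst h2 h⟩,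
      linSubst_linSubst hgh f⟩
  · rintro ⟨p, hp, rfl⟩
    exact ⟨Ideal.mem_map_of_mem _ hp.1, IsHomogeneous.linSubst hp.2 g⟩

theorem isHomogeneous_componentIdeal (I : Ideal (MvPolynomial (Fin n) K)) (d : ℕ) :
    (componentIdeal I d).IsHomogeneous (homogeneousSubmodule (Fin n) K) :=
  Ideal.homogeneous_span _ _ fun _ hp => ⟨d, hp.2⟩

theorem isLead_congr {m : MonomialOrder (Fin n)} {A B : Ideal (MvPolynomial (Fin n) K)}
    {u : Fin n →₀ ℕ} (h : gradedPiece A u.degree = gradedPiece B u.degree) :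
    IsLead m A u ↔ IsLead m B u := by
  rw [IsLead, IsLead, h]

theorem gradedPiece_map_linSubst_congr {A B : Ideal (MvPolynomial (Fin n) K)} {e : ℕ}
    (h : gradedPiece A e = gradedPiece B e) {g g' : Matrix (Fin n) (Fin n) K} (hg : g * g' = 1) :
    gradedPiece (A.map (linSubst g)) e = gradedPiece (B.map (linSubst g)) e := by
  have key : ∀ (A B : Ideal (MvPolynomial (Fin n) K)), gradedPiece A e = gradedPiece B e →
      gradedPiece (A.map (linSubst g)) e ≤ gradedPiece (B.map (linSubst g)) e := by
    rintro A B h f ⟨h1, h2⟩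
    have h3 : linSubst g' f ∈ gradedPiece A e :=
      ⟨(mem_map_linSubst hg).1 h1, IsHomogeneous.linSubst h2 g'⟩
    rw [h] at h3
    exact ⟨(mem_map_linSubst hg).2 h3.1, h2⟩
  exact le_antisymm (key A B h) (key B A h.symm)

/-- In degree `d`, the generic initial ideal of a componentwise linear ideal agrees with a
monomial ideal `B` (the initial ideal of `I_⟨d⟩` in sufficiently generic coordinates) having the
Hilbert function of `I_⟨d⟩`, whose Koszul homology vanishes above the linear strand. -/
theorem IsComponentwiseLinear.exists_initialIdeal [Infinite K]
    {I : Ideal (MvPolynomial (Fin n) K)} (hI : IsComponentwiseLinear I) (d : ℕ) :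
    ∃ B : Ideal (MvPolynomial (Fin n) K), gradedPiece B d = gradedPiece (gin I) d ∧
      SameHilbertFunction B (componentIdeal I d) ∧ KoszulAcyclic X B n d ∧
      ∀ (k : Fin n) (w : Fin n →₀ ℕ), d ≤ w.degree → (∀ l, k < l → w l = 0) →
        monomial (Finsupp.single k 1 + w) (1 : K) ∈ B → monomial w (1 : K) ∈ B := by
  set A := componentIdeal I d
  have hA : A.IsHomogeneous (homogeneousSubmodule (Fin n) K) := isHomogeneous_componentIdeal I d
  have hac : KoszulAcyclic X A n d := (hI.2 d).koszulAcyclic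
  obtain ⟨P, hP0, hP⟩ := exists_generic_gin hI.1 d
  obtain ⟨g, hg, hinj⟩ := hac.exists_generic hA hP0
  have hgi := GL_mul_inv g
  have hA' := isHomogeneous_map_linSubst hA hgi
  set A' := A.map (linSubst (g : Matrix _ _ K))
  have hB := isMonomialIdeal_initialIdeal (degRevLex n) A'
  refine ⟨initialIdeal (degRevLex n) A', ?_, fun e => ?_, ?_, fun k w hw hwk hk => ?_⟩
  · refine hB.gradedPiece_congr (isMonomialIdeal_gin I) fun u hu => ?_
    rw [hP g hg u hu, monomial_mem_initialIdeal hA']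
    subst hu
    exact isLead_congr (gradedPiece_map_linSubst_congr (gradedPiece_componentIdeal I _) hgi)
  · rw [sameHilbertFunction_initialIdeal _ hA' e, sameHilbertFunction_map_linSubst A hgi e]
  · exact koszulAcyclic_of_injAt hB.isHomogeneous fun k => injAt_initialIdeal hA' (hinj k)
  · rw [monomial_mem_initialIdeal hA'] at hk ⊢
    exact hk.sub_single hA' (hinj k) hw hwk

theorem monomial_mem_gradedPiece {J : Ideal (MvPolynomial (Fin n) K)} {u : Fin n →₀ ℕ} {e : ℕ}
    (hu : u.degree = e) : monomial u (1 : K) ∈ gradedPiece J e ↔ monomial u (1 : K) ∈ J :=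
  ⟨fun h => h.1, fun h => ⟨h, isHomogeneous_monomial _ hu⟩⟩

/-- In characteristic `p` the generic initial ideal of an arbitrary ideal need not be stable. -/
theorem IsComponentwiseLinear.isStable_gin [Infinite K]
    {I : Ideal (MvPolynomial (Fin n) K)} (hI : IsComponentwiseLinear I) : IsStable (gin I) := by
  intro w k j hjk hwk hk
  obtain ⟨B, hB, -, -, hBk⟩ := hI.exists_initialIdeal (1 + w.degree)
  have hdeg : ∀ i : Fin n, (Finsupp.single i 1 + w).degree = 1 + w.degree := fun i => by simp
  rw [← monomial_mem_gradedPiece (hdeg _), ← hB, monomial_mem_gradedPiece (hdeg _)] at hk ⊢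
  refine hBk k _ (hdeg j).ge (fun l hl => ?_) ?_
  · simp [hwk l hl, (hjk.trans hl).ne]
  · rw [add_left_comm]
    exact monomial_mem_of_le le_add_self hk

theorem IsComponentwiseLinear.sameHilbertFunction_gin [Infinite K]
    {I : Ideal (MvPolynomial (Fin n) K)} (hI : IsComponentwiseLinear I) :
    SameHilbertFunction (gin I) I := by
  intro d
  obtain ⟨B, hB, hBA, -, -⟩ := hI.exists_initialIdeal d
  rw [← hB, hBA d, gradedPiece_componentIdeal]

/-- A componentwise linear ideal has the Betti numbers of its generic initial ideal. -/
theorem IsComponentwiseLinear.betti_gin [Infinite K]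
    {I : Ideal (MvPolynomial (Fin n) K)} (hI : IsComponentwiseLinear I) (i j : ℕ) :
    betti (gin I) i j = betti I i j := by
  have hz : ∀ i, Module.finrank K (koszulCycles (gin I) i j) =
      Module.finrank K (koszulCycles I i j) := by
    intro i
    by_cases hij : i ≤ j
    · obtain ⟨B, hB, hBA, hBac, -⟩ := hI.exists_initialIdeal (j - i)
      rw [← koszulCycles_congr hB,
        ← koszulCycles_congr (gradedPiece_componentIdeal I (j - i))]
      exact finrank_koszulCycles_eq hBac (hI.2 _).koszulAcyclic hBA (by omega)
    · have h0 : ∀ A : Ideal (MvPolynomial (Fin n) K), koszulCycles A i j = ⊥ := fun A =>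
        (Submodule.eq_bot_iff _).2 fun f hf =>
          koszulChains_zero_of_lt (not_le.1 hij) (mem_koszulCycles.1 hf).1
      rw [h0, h0]
  have hc : Module.finrank K (koszulChains (gin I) (i + 1) j) =
      Module.finrank K (koszulChains I (i + 1) j) := by
    rw [finrank_koszulChains, finrank_koszulChains, hI.sameHilbertFunction_gin]
  have h1 := betti_add_finrank_koszulChains (gin I) i j
  have h2 := betti_add_finrank_koszulChains I i j
  rw [hz, hz, hc] at h1
  omega

/-! ### Betti numbers of stable ideals -/

/-- The index of the last variable dividing `x^u` (and `0` for `u = 0`). -/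
def lastVar (u : Fin n →₀ ℕ) : ℕ := u.support.sup Fin.val

theorem lastVar_eq {u : Fin n →₀ ℕ} {k : Fin n} (hk : u k ≠ 0) (h : ∀ l, k < l → u l = 0) :
    lastVar u = k := by
  refine le_antisymm (Finset.sup_le fun l hl => ?_)
    (Finset.le_sup (f := Fin.val) (Finsupp.mem_support_iff.2 hk))
  by_contra hlk
  exact Finsupp.mem_support_iff.1 hl (h l (not_le.1 hlk))

theorem exists_lastVar {u : Fin n →₀ ℕ} (hu : u ≠ 0) :
    ∃ k : Fin n, lastVar u = k ∧ u k ≠ 0 ∧ ∀ l, k < l → u l = 0 := by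
  have hne : u.support.Nonempty := Finsupp.support_nonempty_iff.2 hu
  refine ⟨u.support.max' hne, ?_, Finsupp.mem_support_iff.1 (u.support.max'_mem hne), ?_⟩
  · refine lastVar_eq (Finsupp.mem_support_iff.1 (u.support.max'_mem hne)) fun l hl => ?_
    by_contra h
    exact absurd (u.support.le_max' l (Finsupp.mem_support_iff.2 h)) (not_le.2 hl)
  · intro l hl
    by_contra h
    exact absurd (u.support.le_max' l (Finsupp.mem_support_iff.2 h)) (not_le.2 hl)

theorem eq_zero_of_lastVar_lt {u : Fin n →₀ ℕ} {l : Fin n} (h : lastVar u < l) : u l = 0 := by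
  by_contra hl
  exact absurd (Finset.le_sup (f := Fin.val) (Finsupp.mem_support_iff.2 hl)) (not_le.2 h)

theorem lastVar_single_add {u : Fin n →₀ ℕ} {l : Fin n} (h : lastVar u ≤ l) :
    lastVar (Finsupp.single l 1 + u) = l := by
  refine lastVar_eq (by simp) fun l' hl' => ?_
  rw [Finsupp.add_apply, eq_zero_of_lastVar_lt (lt_of_le_of_lt h hl')]
  simp [hl'.ne]

/-- The polynomials not involving `x_k`. -/
def freeOf (K : Type*) [Field K] (k : Fin n) : Submodule K (MvPolynomial (Fin n) K) where
  carrier := {p | ∀ v : Fin n →₀ ℕ, v k ≠ 0 → coeff v p = 0}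
  add_mem' hp hq v hv := by rw [coeff_add, hp v hv, hq v hv, add_zero]
  zero_mem' v _ := coeff_zero v
  smul_mem' c p hp v hv := by rw [coeff_smul, hp v hv, smul_zero]

theorem X_mul_mem_freeOf {k l : Fin n} (hl : l ≠ k) {p : MvPolynomial (Fin n) K}
    (hp : p ∈ freeOf K k) : X l * p ∈ freeOf K k := by
  intro v hv
  rw [mul_comm, coeff_mul_X']
  split_ifs
  · refine hp _ ?_
    simpa [Finsupp.single_apply, hl] using hv
  · rfl

theorem koszulSign_mul_mem {V : Submodule K (MvPolynomial (Fin n) K)}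
    {p : MvPolynomial (Fin n) K} (hp : p ∈ V) (τ : Finset (Fin n)) (k : Fin n) :
    koszulSign τ k * p ∈ V := by
  rw [koszulSign]
  rcases neg_one_pow_eq_or (MvPolynomial (Fin n) K) (τ.filter (fun l => l < k)).card with h | h
  · rwa [h, one_mul]
  · rw [h, neg_one_mul]; exact V.neg_mem hp

/-- The chains over the first `m` variables: both the indexing subsets and the coefficients only
involve these variables. -/
def chainsBelow (K : Type*) [Field K] (n m : ℕ) :
    Submodule K (Finset (Fin n) → MvPolynomial (Fin n) K) where
  carrier := {f | SuppBelow m f ∧ ∀ l : Fin n, m ≤ l → ∀ σ, f σ ∈ freeOf K l}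
  add_mem' hf hg := ⟨hf.1.add hg.1, fun l hl σ => Submodule.add_mem _ (hf.2 l hl σ) (hg.2 l hl σ)⟩
  zero_mem' := ⟨fun _ _ => map_zero _, fun _ _ _ => Submodule.zero_mem _⟩
  smul_mem' c f hf := ⟨fun l hl => by
    rw [← C_smul_chain, map_smul, hf.1 l hl, smul_zero], fun l hl σ =>
      Submodule.smul_mem _ _ (hf.2 l hl σ)⟩

theorem seqD_freeOf {m : ℕ} {l : Fin n} (hl : m ≤ l)
    {f : Finset (Fin n) → MvPolynomial (Fin n) K} (hf : SuppBelow m f)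
    (hfl : ∀ σ, f σ ∈ freeOf K l) (σ : Finset (Fin n)) : seqD X f σ ∈ freeOf K l := by
  rw [seqD_apply, Finset.sum_apply]
  refine Submodule.sum_mem _ fun a _ => ?_
  by_cases ha : m ≤ a
  · rw [hf a ha, smul_zero]; exact Submodule.zero_mem _
  · rw [Pi.smul_apply, smul_eq_mul]
    refine X_mul_mem_freeOf (by rintro rfl; exact ha hl) ?_
    rw [contr_apply]
    split_ifs
    · exact Submodule.zero_mem _
    · exact koszulSign_mul_mem (hfl _) _ _

open Classical in
/-- The chain `x^w e_σ`. -/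
def monoChain (K : Type*) [Field K] (w : Fin n →₀ ℕ) (σ : Finset (Fin n)) :
    Finset (Fin n) → MvPolynomial (Fin n) K :=
  fun τ => if τ = σ then monomial w 1 else 0

theorem monoChain_apply_self (w : Fin n →₀ ℕ) (σ : Finset (Fin n)) :
    monoChain K w σ σ = monomial w 1 := if_pos rfl

theorem monoChain_apply_ne (w : Fin n →₀ ℕ) {σ τ : Finset (Fin n)} (h : τ ≠ σ) :
    monoChain K w σ τ = 0 := if_neg h

theorem monoChain_mem (w : Fin n →₀ ℕ) (σ : Finset (Fin n)) :
    monoChain K w σ ∈ koszulChains (⊤ : Ideal (MvPolynomial (Fin n) K)) σ.card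
      (σ.card + w.degree) := by
  refine (mem_koszulChains _).2 ⟨fun τ hτ => ?_, fun _ => trivial, fun τ => ?_⟩
  · have : τ = σ := by
      by_contra h
      exact hτ (monoChain_apply_ne w h)
    rw [this]
    omega
  · by_cases h : τ = σ
    · rw [h, monoChain_apply_self, Nat.add_sub_cancel_left]
      exact isHomogeneous_monomial _ rfl
    · rw [monoChain_apply_ne w h]
      exact isHomogeneous_zero _ _ _

/-- For a monomial `x_k x^w` of a stable ideal with last variable `x_k` and a set `σ` of earlier
variables, the cycle `∂ (x^w e_σ ∧ e_k)` has coefficients in the ideal. -/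
theorem IsStable.seqD_wedge_mem {J : Ideal (MvPolynomial (Fin n) K)} (hJ : IsStable J)
    {k : Fin n} {w : Fin n →₀ ℕ} (hwk : ∀ l, k < l → w l = 0)
    (hk : monomial (Finsupp.single k 1 + w) (1 : K) ∈ J) {σ : Finset (Fin n)}
    (hσ : σ ⊆ Finset.Iio k) :
    seqD X (wedge k (monoChain K w σ)) ∈
      koszulCycles J σ.card (σ.card + (1 + w.degree)) ⊓ chainsBelow K n (k + 1) := by
  have hsupp : SuppBelow k (monoChain K w σ) := by
    rw [suppBelow_iff]
    intro τ l hl hkl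
    refine monoChain_apply_ne w ?_
    rintro rfl
    have := Finset.mem_Iio.1 (hσ hl)
    exact absurd this (not_lt.2 hkl)
  have hX : ∀ (i : Fin n), monomial (Finsupp.single i 1 + w) (1 : K) ∈ J →
      (X i : MvPolynomial (Fin n) K) • monoChain K w σ ∈ coeffIn J := by
    intro i hi
    refine mem_coeffIn.2 fun τ => ?_
    rw [Pi.smul_apply, smul_eq_mul]
    by_cases h : τ = σ
    · rw [h, monoChain_apply_self, X, monomial_mul, one_mul]
      exact hi
    · rw [monoChain_apply_ne w h, mul_zero]
      exact J.zero_mem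
  have hw := wedge_mem_koszulChains k (monoChain_mem (K := K) w σ)
  rw [show σ.card + w.degree + 1 = σ.card + (1 + w.degree) by ring] at hw
  refine ⟨mem_koszulCycles.2 ⟨mem_koszulChains_iff_coeffIn.2
    ⟨seqD_mem_koszulChains isHomogeneous_X_one hw, ?_⟩, seqD_seqD _ _⟩, ?_, ?_⟩
  · rw [seqD_wedge]
    refine Submodule.sub_mem _ (hX k hk) (wedge_mem_coeffIn k ?_)
    rw [seqD_apply]
    refine Submodule.sum_mem _ fun i _ => ?_
    rw [← map_smul]
    by_cases hik : i < k
    · exact contr_mem_coeffIn i (hX i (hJ w k i hik hwk hk))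
    · rw [map_smul, hsupp i (by exact not_lt.1 hik), smul_zero]
      exact Submodule.zero_mem _
  · exact ((hsupp.mono (Nat.le_succ _)).wedge (Nat.lt_succ_self _)).seqD
  · intro l hl
    refine seqD_freeOf hl ((hsupp.mono (Nat.le_succ _)).wedge (Nat.lt_succ_self _)) fun τ => ?_
    rw [wedge_apply]
    split_ifs
    · refine koszulSign_mul_mem ?_ _ _
      by_cases h : τ.erase k = σ
      · rw [h, monoChain_apply_self]
        intro v hv
        classical
        rw [coeff_monomial, if_neg]
        rintro rfl
        exact hv (hwk l hl)
      · rw [monoChain_apply_ne w h]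
        exact Submodule.zero_mem _
    · exact Submodule.zero_mem _

open Classical in
/-- The monomials of degree `d` in `J`. -/
def monosIn (J : Ideal (MvPolynomial (Fin n) K)) (d : ℕ) : Finset (Fin n →₀ ℕ) :=
  (degExps n d).filter fun u => monomial u (1 : K) ∈ J

open Classical in
theorem mem_monosIn {J : Ideal (MvPolynomial (Fin n) K)} {d : ℕ} {u : Fin n →₀ ℕ} :
    u ∈ monosIn J d ↔ u.degree = d ∧ monomial u (1 : K) ∈ J := by
  rw [monosIn, Finset.mem_filter, mem_degExps]

instance finite_koszulCycles_inf (A : Ideal (MvPolynomial (Fin n) K)) (i j : ℕ)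
    (V : Submodule K (Finset (Fin n) → MvPolynomial (Fin n) K)) :
    Module.Finite K (koszulCycles A i j ⊓ V : Submodule K _) :=
  Submodule.finiteDimensional_of_le inf_le_left

open Classical in
/-- Passing from the first `k` to the first `k + 1` variables adds one cycle for each monomial
of the stable ideal with last variable `x_k` and each set of variables before `x_k`. -/
theorem IsStable.finrank_succ {J : Ideal (MvPolynomial (Fin n) K)} (hJ : IsStable J)
    (hmono : IsMonomialIdeal J) (h1 : monomial (0 : Fin n →₀ ℕ) (1 : K) ∉ J) (i d : ℕ)
    (k : Fin n) :
    Module.finrank K (koszulCycles J i (i + d) ⊓ chainsBelow K n (k + 1) : Submodule K _) =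
      Module.finrank K (koszulCycles J i (i + d) ⊓ chainsBelow K n k : Submodule K _) +
        (k : ℕ).choose i * ((monosIn J d).filter fun u => lastVar u = k).card := by
  set Z := koszulCycles J i (i + d) ⊓ chainsBelow K n (k + 1) with hZ
  set U := (monosIn J d).filter fun u => lastVar u = k with hU
  set R := U ×ˢ Finset.powersetCard i (Finset.Iio k) with hR
  -- `T₀` takes the coefficients at the chains `x^u e_σ` with last variable `x_k` of `x^u` and `σ`
  -- consisting of earlier variables.
  set T₀ : (Finset (Fin n) → MvPolynomial (Fin n) K) →ₗ[K] (R → K) :=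
    LinearMap.pi fun r : R => lcoeff K r.1.1 ∘ₗ LinearMap.proj r.1.2 with hT₀
  have hT₀a : ∀ f (r : R), T₀ f r = coeff r.1.1 (f r.1.2) := fun _ _ => rfl
  have hUmem : ∀ u ∈ U, u.degree = d ∧ monomial u (1 : K) ∈ J ∧ u k ≠ 0 ∧
      ∀ l, k < l → u l = 0 := by
    intro u hu
    obtain ⟨hu1, hu2⟩ := Finset.mem_filter.1 hu
    obtain ⟨hd, huJ⟩ := mem_monosIn.1 hu1
    have hu0 : u ≠ 0 := by rintro rfl; exact h1 huJ
    obtain ⟨k', hk', h⟩ := exists_lastVar hu0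
    have : k' = k := Fin.ext (by rw [← hk', hu2])
    rw [this] at h
    exact ⟨hd, huJ, h⟩
  have hker : Z ⊓ LinearMap.ker T₀ = koszulCycles J i (i + d) ⊓ chainsBelow K n k := by
    apply le_antisymm
    · rintro f ⟨⟨hfc, hfs, hff⟩, hfT⟩
      refine ⟨hfc, ?_⟩
      obtain ⟨hfch, hDf⟩ := mem_koszulCycles.1 hfc
      obtain ⟨hf1, hf2, hf3⟩ := (mem_koszulChains f).1 hfch
      have hfree : ∀ σ, k ∉ σ → f σ ∈ freeOf K k := by
        intro σ hkσ v hvk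
        by_contra hv
        have hvs := mem_support_iff.2 hv
        have hvl : ∀ l, k < l → v l = 0 := fun l hl => by
          by_contra hvl
          exact hv (hff l hl σ v hvl)
        have hσ0 : f σ ≠ 0 := by rintro h; simp [h] at hv
        have hvd := degree_of_mem_support (hf3 σ) hvs
        rw [Nat.add_sub_cancel_left] at hvd
        have hvU : v ∈ U := Finset.mem_filter.2 ⟨mem_monosIn.2 ⟨hvd, hmono.mem_iff.1 (hf2 σ) v hvs⟩,
          lastVar_eq hvk hvl⟩
        have hσR : σ ∈ Finset.powersetCard i (Finset.Iio k) := by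
          refine Finset.mem_powersetCard.2 ⟨fun l hl => ?_, (hf1 σ hσ0).1⟩
          rw [Finset.mem_Iio]
          refine lt_of_le_of_ne ?_ (by rintro rfl; exact hkσ hl)
          by_contra hlk
          exact hσ0 (suppBelow_iff.1 hfs σ l hl (not_le.1 hlk))
        exact hv (congrFun (LinearMap.mem_ker.1 hfT) ⟨(v, σ), Finset.mk_mem_product hvU hσR⟩)
      have hπ : ∀ σ, contr k (wedge k f) σ ∈ freeOf K k := by
        intro σ
        by_cases hkσ : k ∈ σ
        · rw [contr_apply, if_pos hkσ]; exact Submodule.zero_mem _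
        · have h2 := congrFun (wedge_contr_self f k) σ
          rw [Pi.add_apply, wedge_apply, if_neg hkσ, zero_add] at h2
          rw [h2]
          exact hfree σ hkσ
      -- The part of `f` involving `e_k` vanishes: `x_k` times it is a boundary free of `x_k`.
      have hck : contr k f = 0 := by
        have h2 := contr_wedge_seqD f X k
        rw [hDf, map_zero, map_zero] at h2
        funext τ
        ext v
        have h3 := congrArg (coeff (v + Finsupp.single k 1)) (congrFun h2 τ)
        rw [Pi.add_apply, coeff_add, Pi.smul_apply, smul_eq_mul, coeff_X_mul_add,
          seqD_freeOf (le_refl (k : ℕ)) hfs.contr_wedge hπ τ _ (by simp), add_zero] at h3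
        exact h3.symm
      refine ⟨fun l hl => ?_, fun l hl σ => ?_⟩
      · rcases eq_or_ne l k with rfl | h
        · exact hck
        · exact hfs l (by have : (l : ℕ) ≠ k := fun h' => h (Fin.ext h')
                          omega)
      · rcases eq_or_ne l k with rfl | h
        · have := hπ σ
          rwa [contr_wedge_of_contr_eq_zero hck] at this
        · exact hff l (by have : (l : ℕ) ≠ k := fun h' => h (Fin.ext h')
                          omega) σ
    · rintro f ⟨hfc, hfs, hff⟩
      refine ⟨⟨hfc, hfs.mono (Nat.le_succ _), fun l hl σ => hff l (by omega) σ⟩, ?_⟩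
      change T₀ f = 0
      funext r
      exact hff k le_rfl _ _ (hUmem _ (Finset.mem_product.1 r.2).1).2.2.1
  -- The cycles `∂ (x^w e_σ ∧ e_k)` are mapped to the standard basis.
  have hsurj : LinearMap.range (T₀.domRestrict Z) = ⊤ := by
    rw [eq_top_iff, ← (Pi.basisFun K R).span_eq, Submodule.span_le]
    rintro _ ⟨r, rfl⟩
    obtain ⟨hu, hσ⟩ := Finset.mem_product.1 r.2
    obtain ⟨hd, huJ, huk, hul⟩ := hUmem _ hu
    obtain ⟨hσk, hσi⟩ := Finset.mem_powersetCard.1 hσ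
    obtain ⟨w, hw⟩ : ∃ w, r.1.1 = Finsupp.single k 1 + w := by
      refine ⟨r.1.1 - Finsupp.single k 1, (add_tsub_cancel_of_le ?_).symm⟩
      rw [Finsupp.single_le_iff]
      omega
    have hwk : ∀ l, k < l → w l = 0 := fun l hl => by
      have := hul l hl
      rw [hw, Finsupp.add_apply] at this
      omega
    have hmem := hJ.seqD_wedge_mem hwk (hw ▸ huJ) hσk
    rw [hσi, show 1 + w.degree = d by rw [← hd, hw]; simp] at hmem
    refine ⟨⟨_, hmem⟩, ?_⟩
    rw [LinearMap.domRestrict_apply, Pi.basisFun_apply]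
    funext r'
    obtain ⟨-, hσ'⟩ := Finset.mem_product.1 r'.2
    obtain ⟨hσk', -⟩ := Finset.mem_powersetCard.1 hσ'
    have hk' : k ∉ r'.1.2 := fun h => lt_irrefl _ (Finset.mem_Iio.1 (hσk' h))
    rw [hT₀a]
    change coeff r'.1.1 (seqD X (wedge k (monoChain K w r.1.2)) r'.1.2) = _
    rw [seqD_wedge, Pi.sub_apply, wedge_apply, if_neg hk', sub_zero, Pi.smul_apply,
      smul_eq_mul, Pi.single_apply]
    by_cases hσσ : r'.1.2 = r.1.2
    · rw [hσσ, monoChain_apply_self, X, monomial_mul, one_mul, ← hw, coeff_monomial]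
      have : r' = r ↔ r.1.1 = r'.1.1 := by
        rw [Subtype.ext_iff, Prod.ext_iff]
        simp [hσσ, eq_comm]
      simp only [this]
    · rw [monoChain_apply_ne _ hσσ, mul_zero, coeff_zero, if_neg]
      rintro rfl
      exact hσσ rfl
  rw [← LinearMap.finrank_range_add_finrank_ker (T₀.domRestrict Z), hsurj, finrank_top,
    LinearMap.ker_domRestrict, (Submodule.equivSubtypeMap _ _).finrank_eq,
    Submodule.map_comap_subtype, hker, add_comm]
  congr 1
  rw [Module.finrank_fintype_fun_eq_card, Fintype.card_coe, hR, Finset.card_product,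
    Finset.card_powersetCard, Fin.card_Iio, mul_comm]

/-- The dimensions of the spaces of cycles in the linear strand of a stable ideal. -/
theorem IsStable.finrank_koszulCycles {J : Ideal (MvPolynomial (Fin n) K)} (hJ : IsStable J)
    (hmono : IsMonomialIdeal J) (h1 : monomial (0 : Fin n →₀ ℕ) (1 : K) ∉ J) (i d : ℕ) :
    Module.finrank K (koszulCycles J i (i + d)) =
      ∑ u ∈ monosIn J d, (lastVar u).choose i := by
  have key : ∀ m ≤ n, Module.finrank K (koszulCycles J i (i + d) ⊓ chainsBelow K n m :
      Submodule K _) = ∑ u ∈ (monosIn J d).filter (fun u => lastVar u < m),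
        (lastVar u).choose i := by
    intro m
    induction m with
    | zero =>
      intro _
      rw [Finset.filter_false_of_mem (by simp), Finset.sum_empty, Submodule.finrank_eq_zero,
        Submodule.eq_bot_iff]
      rintro f ⟨hfc, hfs, hff⟩
      funext σ
      ext v
      rw [Pi.zero_apply, coeff_zero]
      by_contra hv
      have hv0 : v = 0 := by
        ext l
        by_contra hvl
        exact hv (hff l (Nat.zero_le _) σ v hvl)
      rw [hv0] at hv
      have h2 := ((mem_koszulChains f).1 (mem_koszulCycles.1 hfc).1).2.1 σ
      exact h1 (hmono.mem_iff.1 h2 0 (mem_support_iff.2 hv))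
    | succ m ih =>
      intro hm
      have h2 := hJ.finrank_succ hmono h1 i d ⟨m, hm⟩
      simp only at h2
      have h3 : (monosIn J d).filter (fun u => lastVar u < m + 1) =
          (monosIn J d).filter (fun u => lastVar u < m) ∪
          (monosIn J d).filter (fun u => lastVar u = m) := by
        rw [← Finset.filter_or]
        refine Finset.filter_congr fun u _ => ?_
        omega
      rw [h2, ih (by omega), h3, Finset.sum_union]
      · congr 1
        rw [Finset.sum_congr rfl (g := fun _ => m.choose i), Finset.sum_const, smul_eq_mul,
          mul_comm]
        intro u hu
        rw [(Finset.mem_filter.1 hu).2]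
      · rw [Finset.disjoint_filter]
        intro u _ h
        omega
  have h2 := key n le_rfl
  have h3 : koszulCycles J i (i + d) ⊓ chainsBelow K n n = koszulCycles J i (i + d) :=
    inf_eq_left.2 fun f _ => ⟨suppBelow_top, fun l hl => absurd l.isLt (not_lt.2 hl)⟩
  rw [h3] at h2
  rw [h2, Finset.filter_true_of_mem]
  intro u hu
  have hu0 : u ≠ 0 := by
    rintro rfl
    exact h1 (mem_monosIn.1 hu).2
  obtain ⟨k, hk, -⟩ := exists_lastVar hu0
  rw [hk]
  exact k.isLt

/-- Every monomial of a stable ideal that is not a minimal generator is the product of a monomial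
of the ideal and a variable that is not earlier than its last variable. -/
theorem IsStable.exists_eq_single_add {J : Ideal (MvPolynomial (Fin n) K)} (hJ : IsStable J)
    {v : Fin n →₀ ℕ} (hv : monomial v (1 : K) ∈ J) (hvG : v ∉ minGens J) :
    ∃ (u : Fin n →₀ ℕ) (l : Fin n), monomial u (1 : K) ∈ J ∧ lastVar u ≤ l ∧
      v = Finsupp.single l 1 + u := by
  obtain ⟨v', hle, hv', hne⟩ : ∃ v', v' ≤ v ∧ monomial v' (1 : K) ∈ J ∧ v' ≠ v := by
    by_contra! h
    exact hvG ⟨hv, h⟩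
  have hv0 : v ≠ 0 := by
    rintro rfl
    exact hne (le_antisymm hle zero_le)
  obtain ⟨k, -, hvk, hvl⟩ := exists_lastVar hv0
  obtain ⟨l, hl⟩ : ∃ l, v' l < v l := by
    by_contra! h
    exact hne (le_antisymm hle h)
  obtain ⟨w, rfl⟩ : ∃ w, v = Finsupp.single l 1 + w := by
    refine ⟨v - Finsupp.single l 1, (add_tsub_cancel_of_le ?_).symm⟩
    rw [Finsupp.single_le_iff]
    omega
  have hw : monomial w (1 : K) ∈ J := by
    refine monomial_mem_of_le (fun a => ?_) hv'
    have h2 := hle a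
    rcases eq_or_ne a l with rfl | h
    · simp only [Finsupp.add_apply, Finsupp.single_eq_same] at hl
      omega
    · simpa [h] using h2
  have hlast : ∀ u : Fin n →₀ ℕ, u ≤ Finsupp.single l 1 + w → lastVar u ≤ k := by
    intro u hu
    refine Finset.sup_le fun a ha => ?_
    by_contra hak
    have h2 := hu a
    rw [hvl a (not_le.1 hak)] at h2
    exact Finsupp.mem_support_iff.1 ha (Nat.le_zero.1 h2)
  have hlk : l ≤ k := by
    by_contra h
    have := hvl l (not_le.1 h)
    simp at this
  rcases hlk.lt_or_eq with hlk | rfl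
  · obtain ⟨w', rfl⟩ : ∃ w', w = Finsupp.single k 1 + w' := by
      refine ⟨w - Finsupp.single k 1, (add_tsub_cancel_of_le ?_).symm⟩
      rw [Finsupp.single_le_iff]
      simp only [Finsupp.add_apply, ne_eq, hlk.ne', not_false_eq_true, Finsupp.single_eq_of_ne,
        zero_add] at hvk
      omega
    refine ⟨Finsupp.single l 1 + w', k, hJ w' k l hlk (fun a ha => ?_) hw, hlast _ ?_, ?_⟩
    · have := hvl a ha
      simp only [Finsupp.add_apply] at this
      omega
    · rw [add_left_comm]
      exact le_add_self
    · rw [add_left_comm]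
  · exact ⟨w, l, hw, hlast _ le_add_self, rfl⟩

/-- The hockey-stick identity, from `m` on. -/
theorem sum_choose_add (n m i : ℕ) (hm : m ≤ n) :
    ∑ l : Fin n, (if m ≤ l then (l : ℕ).choose i else 0) + m.choose (i + 1) =
      n.choose (i + 1) := by
  rw [Fin.sum_univ_eq_sum_range (fun l => if m ≤ l then l.choose i else 0)]
  induction n, hm using Nat.le_induction with
  | base =>
    rw [Finset.sum_eq_zero, zero_add]
    intro l hl
    rw [if_neg]
    exact not_le.2 (Finset.mem_range.1 hl)
  | succ n hm ih =>
    rw [Finset.sum_range_succ, if_pos hm, Nat.choose_succ_succ, ← ih]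
    ring

open Classical in
/-- The formula of Eliahou and Kervaire for the Betti numbers of a stable ideal. -/
theorem IsStable.betti_eq {J : Ideal (MvPolynomial (Fin n) K)} (hJ : IsStable J)
    (hmono : IsMonomialIdeal J) (h1 : monomial (0 : Fin n →₀ ℕ) (1 : K) ∉ J) (i d : ℕ) :
    betti J i (i + d) = ∑ u ∈ (monosIn J d).filter (· ∈ minGens J), (lastVar u).choose i := by
  have h2 := betti_add_finrank_koszulChains J i (i + d)
  rw [hJ.finrank_koszulCycles hmono h1, finrank_koszulChains,
    ← Finset.sum_filter_add_sum_filter_not (monosIn J d) (· ∈ minGens J)] at h2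
  rcases d with _ | d
  · have h3 : monosIn J 0 = ∅ := by
      refine Finset.eq_empty_of_forall_notMem fun u hu => ?_
      obtain ⟨hu1, hu2⟩ := mem_monosIn.1 hu
      rw [Finsupp.degree_eq_zero_iff] at hu1
      rw [hu1] at hu2
      exact h1 hu2
    have h4 : koszulCycles J (i + 1) (i + 0) = ⊥ := (Submodule.eq_bot_iff _).2 fun f hf =>
      koszulChains_zero_of_lt (by omega) (mem_koszulCycles.1 hf).1
    rw [h4, finrank_bot, h3, if_neg (by omega)] at h2
    rw [h3]
    simpa using h2
  · rw [if_pos (by omega), show i + (d + 1) = (i + 1) + d by ring, Nat.add_sub_cancel_left,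
      hJ.finrank_koszulCycles hmono h1, hmono.finrank_gradedPiece] at h2
    -- The other monomials of degree `d + 1` are uniquely `x_l x^u` with `x^u ∈ J`, `l ≥ lastVar u`.
    have h3 : ∑ u ∈ (monosIn J (d + 1)).filter (¬ · ∈ minGens J), (lastVar u).choose i =
        ∑ u ∈ monosIn J d, ∑ l : Fin n, if lastVar u ≤ l then (l : ℕ).choose i else 0 := by
      rw [← Finset.sum_product', ← Finset.sum_filter]
      symm
      refine Finset.sum_bij (fun r _ => Finsupp.single r.2 1 + r.1) ?_ ?_ ?_ ?_
      · rintro ⟨u, l⟩ hr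
        simp only [Finset.mem_filter, Finset.mem_product, Finset.mem_univ, and_true,
          mem_monosIn] at hr ⊢
        obtain ⟨⟨hd, hu⟩, -⟩ := hr
        refine ⟨⟨by simp [hd, add_comm], monomial_mem_of_le le_add_self hu⟩, fun hG => ?_⟩
        have := congrArg Finsupp.degree (hG.2 u le_add_self hu)
        simp at this
      · rintro ⟨u, l⟩ hr ⟨u', l'⟩ hr' h
        simp only [Finset.mem_filter] at hr hr'
        dsimp only at h
        have h4 : l = l' := Fin.ext (by
          rw [← lastVar_single_add hr.2, h, lastVar_single_add hr'.2])
        subst h4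
        rw [add_left_cancel h]
      · intro v hv
        simp only [Finset.mem_filter, mem_monosIn] at hv
        obtain ⟨⟨hd, hvJ⟩, hvG⟩ := hv
        obtain ⟨u, l, hu, hul, rfl⟩ := hJ.exists_eq_single_add hvJ hvG
        refine ⟨(u, l), ?_, rfl⟩
        simp only [Finset.mem_filter, Finset.mem_product, Finset.mem_univ, and_true, mem_monosIn]
        refine ⟨⟨?_, hu⟩, hul⟩
        simp at hd
        omega
      · rintro ⟨u, l⟩ hr
        simp only [Finset.mem_filter] at hr
        rw [lastVar_single_add hr.2]
    have h4 : ∑ u ∈ monosIn J d, (∑ l : Fin n, (if lastVar u ≤ l then (l : ℕ).choose i else 0) +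
        (lastVar u).choose (i + 1)) = (monosIn J d).card * n.choose (i + 1) := by
      rw [Finset.sum_congr rfl (g := fun _ => n.choose (i + 1)), Finset.sum_const, smul_eq_mul]
      intro u hu
      refine sum_choose_add n _ i ?_
      have hu0 : u ≠ 0 := by
        rintro rfl
        exact h1 (mem_monosIn.1 hu).2
      obtain ⟨k, hk, -⟩ := exists_lastVar hu0
      rw [hk]
      exact k.isLt.le
    rw [Finset.sum_add_distrib, ← h3] at h4
    have h5 : (monosIn J d).card = ((degExps n d).filter fun u => monomial u (1 : K) ∈ J).card :=
      rfl
    rw [← h5, mul_comm, ← h4] at h2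
    rw [show i + (d + 1) = (i + 1) + d by ring]
    omega

open Classical in
theorem IsStable.betti_eq_sum {J : Ideal (MvPolynomial (Fin n) K)} (hJ : IsStable J)
    (hmono : IsMonomialIdeal J) (h1 : monomial (0 : Fin n →₀ ℕ) (1 : K) ∉ J)
    {G : Finset (Fin n →₀ ℕ)} (hG : (G : Set (Fin n →₀ ℕ)) = minGens J) (i j : ℕ) :
    betti J i j = ∑ u ∈ G.filter (fun u => i + u.degree = j), (lastVar u).choose i := by
  by_cases hij : i ≤ j
  · obtain ⟨d, rfl⟩ := Nat.exists_eq_add_of_le hij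
    rw [hJ.betti_eq hmono h1]
    refine Finset.sum_congr ?_ fun _ _ => rfl
    ext u
    rw [Finset.mem_filter, Finset.mem_filter, mem_monosIn, ← Finset.mem_coe (s := G), hG]
    constructor
    · rintro ⟨⟨h2, h3⟩, h4⟩
      exact ⟨h4, by omega⟩
    · rintro ⟨h2, h3⟩
      exact ⟨⟨by omega, h2.1⟩, h2⟩
  · have h0 : koszulCycles J i j = ⊥ := (Submodule.eq_bot_iff _).2 fun f hf =>
      koszulChains_zero_of_lt (not_le.1 hij) (mem_koszulCycles.1 hf).1
    have h2 := betti_add J i j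
    rw [h0, finrank_bot] at h2
    rw [Finset.filter_false_of_mem, Finset.sum_empty]
    · omega
    · intro u _; omega

theorem IsStable.totalBetti_eq {J : Ideal (MvPolynomial (Fin n) K)} (hJ : IsStable J)
    (hmono : IsMonomialIdeal J) (h1 : monomial (0 : Fin n →₀ ℕ) (1 : K) ∉ J)
    {G : Finset (Fin n →₀ ℕ)} (hG : (G : Set (Fin n →₀ ℕ)) = minGens J) (i : ℕ) :
    totalBetti J i = (∑ u ∈ G, (lastVar u).choose i : ℕ) := by
  classical
  rw [totalBetti, tsum_eq_sum (s := G.image fun u => i + u.degree)]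
  · simp only [hJ.betti_eq_sum hmono h1 hG]
    rw [← Nat.cast_sum, Finset.sum_fiberwise_of_maps_to]
    exact fun u hu => Finset.mem_image_of_mem _ hu
  · intro j hj
    rw [hJ.betti_eq_sum hmono h1 hG, Finset.filter_false_of_mem, Finset.sum_empty, Nat.cast_zero]
    intro u hu h
    exact hj (Finset.mem_image.2 ⟨u, hu, h⟩)

/-! ### Stable ideals with maximal Betti numbers -/

theorem sum_range_choose_eq (s i : ℕ) :
    ∑ k ∈ Finset.range s, k.choose i = s.choose (i + 1) := by
  induction s with
  | zero => simp
  | succ s ih => rw [Finset.sum_range_succ, ih, Nat.choose_succ_succ, add_comm]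

/-- If the values of `f` on a set of `s` elements form an initial segment of `ℕ`, then
`∑ u, (f u).choose i ≤ s.choose (i + 1)`, and for `1 ≤ i < s` equality forces `f` to be
a bijection onto `{0, …, s - 1}`. -/
theorem bijective_of_sum_choose_eq {α : Type*} {G : Finset α} {f : α → ℕ} {i : ℕ}
    (hf : ∀ u ∈ G, ∀ l < f u, ∃ v ∈ G, f v = l) (hi : 1 ≤ i) (his : i < G.card)
    (hsum : ∑ u ∈ G, (f u).choose i = G.card.choose (i + 1)) :
    Set.InjOn f G ∧ G.image f = Finset.range G.card := by
  classical
  have hne : G.Nonempty := Finset.card_pos.1 (by omega)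
  obtain ⟨u₀, hu₀, hmax⟩ := Finset.exists_max_image G f hne
  -- The values of `f` are exactly the numbers up to `f u₀`.
  have hatt : ∀ k, k < f u₀ + 1 → ∃ v ∈ G, f v = k := by
    intro k hk
    rcases (Nat.lt_succ_iff.1 hk).lt_or_eq with h | rfl
    · exact hf u₀ hu₀ k h
    · exact ⟨u₀, hu₀, rfl⟩
  have himage : G.image f = Finset.range (f u₀ + 1) := by
    ext k
    rw [Finset.mem_image, Finset.mem_range]
    constructor
    · rintro ⟨u, hu, rfl⟩
      exact Nat.lt_succ_iff.2 (hmax u hu)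
    · exact hatt k
  have hcard : f u₀ + 1 ≤ G.card := by
    rw [← Finset.card_range (f u₀ + 1), ← himage]
    exact Finset.card_image_le
  rcases hcard.lt_or_eq with hlt | heq
  · exfalso
    -- A set `H` of representatives of the values; the remaining elements contribute too little.
    have : Nonempty α := ⟨u₀⟩
    choose! u hu hfu using hatt
    set H := (Finset.range (f u₀ + 1)).image u with hH
    have hinj : Set.InjOn u (Finset.range (f u₀ + 1)) := by
      intro a ha b hb hab
      rw [← hfu a (Finset.mem_range.1 ha), hab, hfu b (Finset.mem_range.1 hb)]
    have hHG : H ⊆ G := by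
      intro x hx
      obtain ⟨k, hk, rfl⟩ := Finset.mem_image.1 hx
      exact hu k (Finset.mem_range.1 hk)
    have h1 : ∑ x ∈ H, (f x).choose i = (f u₀ + 1).choose (i + 1) := by
      rw [hH, Finset.sum_image hinj, ← sum_range_choose_eq]
      exact Finset.sum_congr rfl fun k hk => by rw [hfu k (Finset.mem_range.1 hk)]
    have h2 : ∑ x ∈ G \ H, (f x).choose i ≤
        ∑ k ∈ Finset.Ico (f u₀ + 1) G.card, (f u₀).choose i := by
      refine (Finset.sum_le_card_nsmul _ _ ((f u₀).choose i) fun x hx => ?_).trans_eq ?_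
      · exact Nat.choose_le_choose i (hmax x (Finset.mem_sdiff.1 hx).1)
      · rw [Finset.card_sdiff_of_subset hHG, hH, Finset.card_image_of_injOn hinj,
          Finset.card_range, Finset.sum_const, Nat.card_Ico]
    have h3 : ∑ k ∈ Finset.Ico (f u₀ + 1) G.card, (f u₀).choose i <
        ∑ k ∈ Finset.Ico (f u₀ + 1) G.card, k.choose i := by
      refine Finset.sum_lt_sum (fun k hk => Nat.choose_le_choose i ?_) ⟨G.card - 1, ?_, ?_⟩
      · have := Finset.mem_Ico.1 hk
        omega
      · rw [Finset.mem_Ico]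
        omega
      · obtain ⟨s, hs⟩ : ∃ s, G.card = s + 2 := ⟨G.card - 2, by omega⟩
        obtain ⟨i, rfl⟩ : ∃ i', i = i' + 1 := ⟨i - 1, by omega⟩
        rw [hs, show s + 2 - 1 = s + 1 from rfl, Nat.choose_succ_succ']
        have h4 := Nat.choose_le_choose (i + 1) (show f u₀ ≤ s by omega)
        have h5 := Nat.choose_pos (show i ≤ s by omega)
        omega
    have h6 := Finset.sum_range_add_sum_Ico (fun k => k.choose i) hcard
    rw [sum_range_choose_eq, sum_range_choose_eq] at h6
    have h7 := Finset.sum_sdiff hHG (f := fun x => (f x).choose i)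
    omega
  · rw [heq] at himage
    refine ⟨?_, himage⟩
    rw [← Finset.card_image_iff, himage, Finset.card_range]

theorem exists_minGens_le {J : Ideal (MvPolynomial (Fin n) K)} {u : Fin n →₀ ℕ}
    (hu : monomial u (1 : K) ∈ J) : ∃ v ∈ minGens J, v ≤ u := by
  obtain ⟨v, hvu, hv⟩ := exists_minimal_le_of_wellFoundedLT
    (fun v => monomial v (1 : K) ∈ J) u hu
  exact ⟨v, ⟨hv.1, fun w hw hwJ => le_antisymm hw (hv.2 hwJ hw)⟩, hvu⟩

/-- Exchanging the last variable `x_k` of a generator `u` for an earlier variable `x_l` leads to a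
multiple of another generator, for which the exponent of `x_l` is larger by one. -/
theorem IsStable.exists_exchange {J : Ideal (MvPolynomial (Fin n) K)} (hJ : IsStable J)
    {u : Fin n →₀ ℕ} (hu : u ∈ minGens J) {k l : Fin n} (hk : u k ≠ 0)
    (hul : ∀ a, k < a → u a = 0) (hlk : l < k) :
    ∃ v ∈ minGens J, v l = u l + 1 ∧ v k < u k ∧ ∀ a, a ≠ l → v a ≤ u a := by
  obtain ⟨w, rfl⟩ : ∃ w, u = Finsupp.single k 1 + w := by
    refine ⟨u - Finsupp.single k 1, (add_tsub_cancel_of_le ?_).symm⟩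
    rw [Finsupp.single_le_iff]
    omega
  have hwJ := hJ w k l hlk (fun a ha => by
    have := hul a ha
    rw [Finsupp.add_apply] at this
    omega) hu.1
  obtain ⟨v, hv, hvle⟩ := exists_minGens_le hwJ
  have hva : ∀ a, a ≠ l → v a ≤ w a := fun a ha => by
    have := hvle a
    simpa [ha] using this
  refine ⟨v, hv, ?_, ?_, fun a ha => (hva a ha).trans ?_⟩
  · have h1 := hvle l
    simp only [Finsupp.add_apply, Finsupp.single_eq_same, ne_eq, hlk.ne, not_false_eq_true,
      Finsupp.single_eq_of_ne, zero_add] at h1 ⊢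
    by_contra h
    have h2 : v ≤ w := fun a => by
      rcases eq_or_ne a l with rfl | ha
      · omega
      · exact hva a ha
    have h3 := hu.2 v (h2.trans le_add_self) hv.1
    rw [h3] at h2
    have := h2 k
    simp at this
  · have := hva k hlk.ne'
    simp only [Finsupp.add_apply, Finsupp.single_eq_same]
    omega
  · rw [Finsupp.add_apply]
    omega

/-- In `IsStable.exists_exchange`, the last variable of `v` lies between `x_l` and `x_k`. -/
theorem exists_lastVar_between {u v : Fin n →₀ ℕ}
    {k l : Fin n} (hul : ∀ a, k < a → u a = 0) (hlk : l < k) (hvl : v l = u l + 1)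
    (hva : ∀ a, a ≠ l → v a ≤ u a) :
    ∃ j : Fin n, l ≤ j ∧ j ≤ k ∧ lastVar v = j ∧ v j ≠ 0 := by
  obtain ⟨j, hj, hvj, hjl⟩ := exists_lastVar (u := v) (fun h => by simp [h] at hvl)
  refine ⟨j, ?_, ?_, hj, hvj⟩
  · by_contra hlt
    have := hjl l (not_le.1 hlt)
    omega
  · by_contra hlt
    rw [not_le] at hlt
    have h1 := hva j (hlk.trans hlt).ne'
    rw [hul j hlt] at h1
    omega

theorem ne_zero_of_mem_minGens {J : Ideal (MvPolynomial (Fin n) K)}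
    (h1 : monomial (0 : Fin n →₀ ℕ) (1 : K) ∉ J) {u : Fin n →₀ ℕ} (hu : u ∈ minGens J) :
    u ≠ 0 := by
  rintro rfl
  exact h1 hu.1

/-- The last variables of the minimal generators of a stable ideal form an initial segment. -/
theorem IsStable.exists_minGens_lastVar {J : Ideal (MvPolynomial (Fin n) K)} (hJ : IsStable J)
    {u : Fin n →₀ ℕ} (hu : u ∈ minGens J) {l : ℕ} (hl : l < lastVar u) :
    ∃ v ∈ minGens J, lastVar v = l := by
  -- An exchange that does not change the last variable lowers its exponent.
  have key : ∀ (k : ℕ) (N : ℕ) (u : Fin n →₀ ℕ) (k' : Fin n), u ∈ minGens J → lastVar u = k' →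
      (k' : ℕ) = k → u k' = N → u k' ≠ 0 → l < k → ∃ v ∈ minGens J, lastVar v = l := by
    intro k
    induction k using Nat.strong_induction_on with
    | _ k ihk =>
      intro N
      induction N using Nat.strong_induction_on with
      | _ N ihN =>
        rintro u k' hu huk rfl rfl huk0 hlk
        have hul : ∀ a, k' < a → u a = 0 := fun a ha =>
          eq_zero_of_lastVar_lt (by rw [huk]; exact ha)
        have hlk' : (⟨l, hlk.trans k'.isLt⟩ : Fin n) < k' := hlk
        obtain ⟨v, hv, hvl, hvk, hva⟩ := hJ.exists_exchange hu huk0 hul hlk'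
        obtain ⟨j, hlj, hjk, hvj, hvj0⟩ := exists_lastVar_between hul hlk' hvl hva
        rcases hlj.lt_or_eq with hlj | rfl
        · rcases hjk.lt_or_eq with hjk | rfl
          · exact ihk j hjk _ v j hv hvj rfl rfl hvj0 hlj
          · exact ihN _ hvk v j hv hvj rfl rfl hvj0 hlj
        · exact ⟨v, hv, hvj⟩
  obtain ⟨k, hk, huk, -⟩ := exists_lastVar (u := u) (by
    rintro rfl
    simp [lastVar] at hl)
  exact key k _ u k hu hk rfl rfl huk (hk ▸ hl)

/-- If a stable ideal has at most one minimal generator for each last variable, then the generator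
with last variable `x_l` exceeds by one in the exponent of `x_l` all those with a later last
variable. -/
theorem IsStable.apply_add_one_of_injOn {J : Ideal (MvPolynomial (Fin n) K)} (hJ : IsStable J)
    (hinj : Set.InjOn lastVar (minGens J)) {u v : Fin n →₀ ℕ} {k l : Fin n}
    (hu : u ∈ minGens J) (hv : v ∈ minGens J) (huk : lastVar u = k) (huk0 : u k ≠ 0)
    (hvl : lastVar v = l) (hlk : l < k) : u l + 1 = v l := by
  induction k using WellFoundedLT.induction generalizing u with
  | _ k ih =>
    have hul : ∀ a, k < a → u a = 0 := fun a ha =>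
      eq_zero_of_lastVar_lt (by rw [huk]; exact ha)
    obtain ⟨w, hw, hwl, hwk, hwa⟩ := hJ.exists_exchange hu huk0 hul hlk
    obtain ⟨j, hlj, hjk, hwj, hwj0⟩ := exists_lastVar_between hul hlk hwl hwa
    have hjk : j < k := hjk.lt_of_ne fun h => by
      rw [hinj hw hu (by rw [hwj, huk, h])] at hwk
      exact lt_irrefl _ hwk
    rcases hlj.lt_or_eq with hlj | rfl
    · exfalso
      -- A second exchange, of `x_k` for `x_j`, does not increase the exponent of `x_l`.
      have h1 := ih j hjk hw hwj hwj0 hlj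
      obtain ⟨z, hz, hzj, hzk, hza⟩ := hJ.exists_exchange hu huk0 hul hjk
      obtain ⟨p, hjp, hpk, hzp, hzp0⟩ := exists_lastVar_between hul hjk hzj hza
      have hpk : p < k := hpk.lt_of_ne fun h => by
        rw [hinj hz hu (by rw [hzp, huk, h])] at hzk
        exact lt_irrefl _ hzk
      have h2 := ih p hpk hz hzp hzp0 (hlj.trans_le hjp)
      have h3 := hza l hlj.ne
      omega
    · rw [← hinj hw hv (by rw [hwj, hvl]), hwl]

/-- A stable ideal with at most one minimal generator for each last variable is lexsegment. -/
theorem IsStable.isLexsegment_of_injOn {J : Ideal (MvPolynomial (Fin n) K)} (hJ : IsStable J)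
    (hmono : IsMonomialIdeal J) (h1 : monomial (0 : Fin n →₀ ℕ) (1 : K) ∉ J)
    (hinj : Set.InjOn lastVar (minGens J)) : IsLexsegment J := by
  refine ⟨hmono, fun u v _ huv huJ => ?_⟩
  obtain ⟨p, hpe, hp⟩ := huv
  change ∀ q, q < p → u q = v q at hpe
  change u p < v p at hp
  obtain ⟨g, hg, hgu⟩ := exists_minGens_le huJ
  obtain ⟨k, hgk, hgk0, hgl⟩ := exists_lastVar (ne_zero_of_mem_minGens h1 hg)
  rcases lt_or_ge p k with hpk | hkp
  · -- The generator with last variable `x_p` divides `x^v`.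
    obtain ⟨z, hz, hzp⟩ := hJ.exists_minGens_lastVar hg (l := p) (hgk ▸ hpk)
    obtain ⟨p', hzp', hzp0, hzl⟩ := exists_lastVar (ne_zero_of_mem_minGens h1 hz)
    obtain rfl : p' = p := Fin.ext (hzp'.symm.trans hzp)
    refine monomial_mem_of_le (fun a => ?_) hz.1
    rcases lt_trichotomy a p' with ha | rfl | ha
    · -- Both exponents are one less than that of the generator with last variable `x_a`.
      obtain ⟨y, hy, hya⟩ := hJ.exists_minGens_lastVar hz (l := a) (hzp ▸ ha)
      have e1 := hJ.apply_add_one_of_injOn hinj hz hy hzp hzp0 hya ha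
      have e2 := hJ.apply_add_one_of_injOn hinj hg hy hgk hgk0 hya (ha.trans hpk)
      have e3 := hgu a
      have e4 := hpe a ha
      omega
    · have e1 := hJ.apply_add_one_of_injOn hinj hg hz hgk hgk0 hzp hpk
      have e3 := hgu a
      omega
    · rw [hzl a ha]
      exact Nat.zero_le _
  · refine monomial_mem_of_le (fun a => ?_) hg.1
    have e3 := hgu a
    rcases lt_trichotomy a p with ha | rfl | ha
    · exact e3.trans (hpe a ha).le
    · exact e3.trans hp.le
    · rw [hgl a (hkp.trans_lt ha)]
      exact Nat.zero_le _

theorem minGens_eq_of_one_mem {J : Ideal (MvPolynomial (Fin n) K)}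
    (h1 : monomial (0 : Fin n →₀ ℕ) (1 : K) ∈ J) : minGens J = {0} := by
  ext u
  constructor
  · exact fun hu => (hu.2 0 zero_le h1).symm
  · rintro rfl
    exact ⟨h1, fun v hv _ => le_antisymm hv zero_le⟩

end CompLinear

end

theorem mainTheorem2 {K : Type*} [Field K] [Infinite K] {n : ℕ}
    (I : Ideal (MvPolynomial (Fin n) K)) (hI : CompLinear.IsComponentwiseLinear I)
    (s : ℕ) (hs : (CompLinear.minGens (CompLinear.gin I)).encard = s)
    (i : ℕ) (hi : 1 ≤ i) (his : i < s)
    (hβ : CompLinear.totalBetti (CompLinear.gin I) i = (s.choose (i + 1) : ℕ)) :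
    CompLinear.IsGotzmann I ∧
      ∀ j : ℕ, CompLinear.totalBetti I j = (s.choose (j + 1) : ℕ) := by
  classical
  have hJ := hI.isStable_gin
  have hmono := CompLinear.isMonomialIdeal_gin I
  have h1 : monomial (0 : Fin n →₀ ℕ) (1 : K) ∉ CompLinear.gin I := by
    intro h1
    rw [CompLinear.minGens_eq_of_one_mem h1, Set.encard_singleton] at hs
    have : s = 1 := by exact_mod_cast hs.symm
    omega
  obtain ⟨G, hG⟩ := (Set.finite_of_encard_eq_coe hs).exists_finset_coe
  obtain rfl : G.card = s := by
    rw [← hG, Set.encard_coe_eq_coe_finsetCard] at hs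
    exact_mod_cast hs
  have hmem : ∀ u, u ∈ G ↔ u ∈ CompLinear.minGens (CompLinear.gin I) := fun u => by
    rw [← hG, Finset.mem_coe]
  obtain ⟨hinj, himage⟩ := CompLinear.bijective_of_sum_choose_eq (f := CompLinear.lastVar)
    (fun u hu l hl => by
      obtain ⟨v, hv, hvl⟩ := hJ.exists_minGens_lastVar ((hmem u).1 hu) hl
      exact ⟨v, (hmem v).2 hv, hvl⟩) hi his (by
      rw [hJ.totalBetti_eq hmono h1 hG] at hβ
      exact_mod_cast hβ)
  refine ⟨⟨hI.1, CompLinear.gin I, ?_, hI.sameHilbertFunction_gin,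
    fun a b => (hI.betti_gin a b).symm⟩, fun j => ?_⟩
  · exact hJ.isLexsegment_of_injOn hmono h1 (hG ▸ hinj)
  · have h2 : CompLinear.totalBetti I j = CompLinear.totalBetti (CompLinear.gin I) j := by
      simp only [CompLinear.totalBetti, hI.betti_gin]
    rw [h2, hJ.totalBetti_eq hmono h1 hG, ← CompLinear.sum_range_choose_eq, ← himage,
      Finset.sum_image hinj]
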